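/- Let $0\le\Lambda<1/4$. Consider the static spherically symmetric $SU(2)$ Einstein--Yang--Mills equations with cosmological constant $\Lambda$, $$rA'+2A{w'}^2=\Phi,\qquad r^2Aw''+rw'\Phi+w(1-w^2)=0,\qquad \Phi(r)=1-A-\frac{(1-w^2)^2}{r^2}-\Lambda r^2 ,$$ and, for $\lambda\ge 0$, the solution $(A,w)$ that is smooth at the origin with $(A,w,w',w'')(0)=(1,1,0,-\lambda)$. Let $r_c=r_c(\lambda)\in(0,\infty]$ be the right end of the largest interval $[0,r_c)$ on which this solution exists with $A>0$, and let a subscript $c$ denote a limit as $r\nearrow r_c$. With the parameter $\tau$ given by $dr/d\tau=rN$, and with $N=\sqrt A$, $U=Nw'$ and $2N\kappa=\Phi+2U^2+2N^2$, the equations become $$\dot r=rN,\quad \dot w=rU,\quad \dot N=(\kappa-N)N-2U^2,\quad \dot U=-\frac{w(1-w^2)}{r}-(\kappa-N)U,\quad \dot\kappa=1+2U^2-\kappa^2-2\Lambda r^2,$$ which remain meaningful where $N\le 0$. The solution is called *generic* if $r_c<\infty$, $r_c$ is reached at a finite value $\tau_c$ of $\tau$ with $N(\tau_c)=0$, and the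 solution of the system in $\tau$ (with the constraint $2N\kappa=\Phi+2U^2+2N^2$, where $A=N^2$ in $\Phi$) continues through $\tau_c$ to an interval $(-\infty,\tau_0)$, $\tau_c<\tau_0<\infty$, such that $N<0$ on $(\tau_c,\tau_0)$ and, as $\tau\nearrow\tau_0$, $r\to 0$ with a Reissner--Nordström-like singularity: $A=N^2\to\infty$, $w$ tends to a finite limit $w_0$, and $r^2A\to(1-w_0^2)^2$. (Thus the spatial slice is an $S^3$ with a regular center at one pole, a singularity at the other, and the maximal radius $r_c$ at the equator.) The solution is called *oscillating* if $r_c<\infty$, $A_c=0$, there is no horizon, that is, $\tau=\int dr/(r\sqrt A)$ diverges as $r\nearrow r_c$ (the zero of $A$ is not attained at finite $\tau$), $\Phi_c=0$, $w_c=0$, and $w$ has infinitely many zeros in $(0,r_c)$. Then: 1. there is a $\lambda\ge 0$ for which the solution is generic; 2. there is a $\lambda_c\ge 0$ for which the solution is oscillating and at which the function $r_c:[0,\infty)\to(0,\infty]$ is discontinuous. -/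

import Mathlib

open Set Filter Topology
open scoped ContDiff ENNReal

noncomputable section

namespace EYM

/-- `Φ(r) = 1 - A - (1 - w²)² / r² - Λ r²`. -/
def Phi (Λ : ℝ) (A w : ℝ → ℝ) (r : ℝ) : ℝ :=
  1 - A r - (1 - w r ^ 2) ^ 2 / r ^ 2 - Λ * r ^ 2

/-- `(A, w)` is a solution on `[0, R)`, with `A > 0`, of the static spherically symmetric SU(2)
Einstein-Yang-Mills equations with cosmological constant `Λ` which is smooth at the origin (derivatives at
`r = 0` being one-sided) and is the member with parameter `lam` of the family
`(A, w, w', w'')(0) = (1, 1, 0, -lam)`. -/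
structure IsRegularSolution (Λ lam R : ℝ) (A w : ℝ → ℝ) : Prop where
  R_pos : 0 < R
  smooth_A : ContDiffOn ℝ ∞ A (Ico 0 R)
  smooth_w : ContDiffOn ℝ ∞ w (Ico 0 R)
  A_pos : ∀ r ∈ Ico 0 R, 0 < A r
  A_eq : ∀ r ∈ Ioo 0 R, r * deriv A r + 2 * A r * deriv w r ^ 2 = Phi Λ A w r
  w_eq : ∀ r ∈ Ioo 0 R,
    r ^ 2 * A r * deriv (deriv w) r + r * deriv w r * Phi Λ A w r + w r * (1 - w r ^ 2) = 0
  A_zero : A 0 = 1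
  w_zero : w 0 = 1
  dw_zero : derivWithin w (Ico 0 R) 0 = 0
  ddw_zero : iteratedDerivWithin 2 w (Ico 0 R) 0 = -lam

/-- The radius `r_c ∈ [0, ∞]`: the right end of the largest interval `[0, r_c)` on which the smooth solution
with parameter `lam` exists with `A > 0`. It is `∞` when `A` never reaches `0`. -/
def crashRadius (Λ lam : ℝ) : ℝ≥0∞ :=
  sSup {ρ : ℝ≥0∞ | ∃ (R : ℝ) (A w : ℝ → ℝ), IsRegularSolution Λ lam R A w ∧ ρ = ENNReal.ofReal R}

/-- The equations in the parameter `τ`, where `dr/dτ = r N`, `A = N²`, `U = N w'`, and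
`2 N κ = Φ + 2 U² + 2 N²`. They stay nonsingular where `N` vanishes, and `N < 0` is the region where `r`
decreases. -/
structure IsTauSolution (Λ : ℝ) (I : Set ℝ) (r N w U κ : ℝ → ℝ) : Prop where
  r_pos : ∀ τ ∈ I, 0 < r τ
  r_eq : ∀ τ ∈ I, HasDerivAt r (r τ * N τ) τ
  w_eq : ∀ τ ∈ I, HasDerivAt w (r τ * U τ) τ
  N_eq : ∀ τ ∈ I, HasDerivAt N ((κ τ - N τ) * N τ - 2 * U τ ^ 2) τ
  U_eq : ∀ τ ∈ I, HasDerivAt U (-(w τ * (1 - w τ ^ 2) / r τ) - (κ τ - N τ) * U τ) τ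
  κ_eq : ∀ τ ∈ I, HasDerivAt κ (1 + 2 * U τ ^ 2 - κ τ ^ 2 - 2 * Λ * r τ ^ 2) τ
  constraint : ∀ τ ∈ I, 2 * N τ * κ τ =
    (1 - N τ ^ 2 - (1 - w τ ^ 2) ^ 2 / r τ ^ 2 - Λ * r τ ^ 2) + 2 * U τ ^ 2 + 2 * N τ ^ 2

/-- The smooth solution with parameter `lam` is generic: it has `A > 0` up to `r_c < ∞`, which is reached at a
finite `τc` and is the maximum of `r` (the equator); it continues regularly through `τc` to a solution on
`(-∞, τ0)` with `N > 0` before `τc` and `N < 0` after, `r` decreasing back to `0` as `τ → τ0`, where the second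
pole is a singularity of Reissner-Nordström type: `A = N² → ∞`, `w` has a finite limit `w0`, and
`r² A → (1 - w0²)²`. -/
def IsGeneric (Λ lam : ℝ) : Prop :=
  ∃ (τc τ0 : ℝ) (r N w U κ : ℝ → ℝ),
    τc < τ0 ∧ IsTauSolution Λ (Iio τ0) r N w U κ ∧
    -- up to `τc` this is the solution that is smooth at the origin
    (∃ A W : ℝ → ℝ, IsRegularSolution Λ lam (r τc) A W ∧
      ∀ τ < τc, r τ < r τc ∧ N τ = √(A (r τ)) ∧ w τ = W (r τ) ∧
        U τ = √(A (r τ)) * deriv W (r τ)) ∧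
    Tendsto r atBot (𝓝 0) ∧
    crashRadius Λ lam = ENNReal.ofReal (r τc) ∧
    -- the equator
    N τc = 0 ∧ (∀ τ ∈ Ioo τc τ0, N τ < 0) ∧
    -- the second pole
    Tendsto r (𝓝[<] τ0) (𝓝 0) ∧ Tendsto (fun τ => N τ ^ 2) (𝓝[<] τ0) atTop ∧
    ∃ w0 : ℝ, Tendsto w (𝓝[<] τ0) (𝓝 w0) ∧
      Tendsto (fun τ => r τ ^ 2 * N τ ^ 2) (𝓝[<] τ0) (𝓝 ((1 - w0 ^ 2) ^ 2))

/-- The smooth solution with parameter `lam` is oscillating: it exists with `A > 0` exactly up to a finite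
`r_c`, where `A`, `Φ` and `w` tend to `0`; `w` has infinitely many zeros; and there is no horizon, that is,
`τ = ∫ dr / (r √A)` diverges at `r_c`, so that `A = 0` is not attained. (As `r_c` is positive and finite, this
says equally that the proper distance `∫ dr / √A` from the origin to `r_c` is infinite.) -/
def IsOscillating (Λ lam : ℝ) : Prop :=
  ∃ (rc : ℝ) (A w : ℝ → ℝ),
    IsRegularSolution Λ lam rc A w ∧
    crashRadius Λ lam = ENNReal.ofReal rc ∧
    Tendsto A (𝓝[<] rc) (𝓝 0) ∧
    Tendsto (fun ρ => ∫ s in (rc / 2)..ρ, 1 / (s * √(A s))) (𝓝[<] rc) atTop ∧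
    Tendsto (Phi Λ A w) (𝓝[<] rc) (𝓝 0) ∧
    Tendsto w (𝓝[<] rc) (𝓝 0) ∧
    {s | s ∈ Ioo 0 rc ∧ w s = 0}.Infinite

end EYM

end

/-! The proof is a shooting argument in the parameter `lam`, carried out in the autonomous system in
`τ`, where the zero of `A` is a regular point. The point `r² = s₁`, `N = w = U = 0`, with `s₁` the
smaller root of `s - Λ s² = 1`, is the limit that oscillating solutions must reach. Because `Λ <
1/4`, there is room for some `s₂ > s₁` such that `κ` keeps a positive lower bound `k` as long as `r²
≤ s₂`. This bound gives compactness (`IsTauSolution.bounds`) and drives all later estimates.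

Starting data at a small radius depend continuously on `lam` (`exists_localFamily`). Two outcomes
are singled out. In `Crash`, `N` becomes negative while `r² < s₁` and `w² < 1`. In `Escape`, the
region `r² ≤ s₁`, `w² ≤ 1` is left while `N > 0`. Both are open in the initial point and they
exclude each other. The vacuum solution `lam = 0` escapes (`LocalFamily.escape_zero`). For large
`lam`, the quantity `(1 - w²) / r` would grow exponentially beyond an a priori bound if `N` remained
positive, all at tiny `r`; so the solution crashes (`LocalFamily.exists_crash`).

A crashing solution is generic: beyond the equator `N` obeys a Riccati inequality and blows up in
finite `τ`, and the constraint identifies the limit of `r² A` (`TauSol.collapse`).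

Let `lam` be the supremum of the escaping parameters below a crashing one. By openness it neither
escapes nor crashes, so its solution stays in a compact region with `N > 0` for all `τ`. Since `r`
is monotone, Barbalat's lemma applied to one coordinate after another shows convergence to the fixed
point (`TauSol.tendsto_fixed`). A phase angle there decreases at a definite rate, so `w` has
infinitely many zeros, and `r_c = √s₁`.

Escaping parameters accumulate at this `lam`. Their solutions pass close to the fixed point, where
`w` stays small, so they can leave only through `r² > s₁`; after that `N` cannot vanish until `r²`
has exceeded `s₁` by a fixed amount (`exists_large_radius`). This is the jump of `r_c`. -/

open scoped NNReal Manifold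

namespace EYM

/-! ### Integral curves of a `C¹` field on an open set: uniqueness, dependence on data, maximality
-/

section ODE

variable {E : Type*} [NormedAddCommGroup E] [NormedSpace ℝ E]

/-- A vector field that is `C¹` on an open set agrees on any compact subset with a globally Lipschitz,
bounded vector field. -/
theorem exists_lipschitz_eqOn [FiniteDimensional ℝ E] {F : Type*} [NormedAddCommGroup F] [NormedSpace ℝ F]
    {V : E → F} {Ω K : Set E} (hΩ : IsOpen Ω) (hV : ContDiffOn ℝ 1 V Ω)
    (hK : IsCompact K) (hKΩ : K ⊆ Ω) :
    ∃ (W : E → F) (L : ℝ≥0) (M : ℝ≥0), LipschitzWith L W ∧ (∀ x, ‖W x‖ ≤ M) ∧ EqOn W V K := by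
  obtain ⟨K', hK', hKK', hK'Ω⟩ := exists_compact_between hK hΩ hKΩ
  obtain ⟨χ, hχ1, hχ0, -⟩ := exists_contMDiffMap_one_nhds_of_subset_interior (n := 1) 𝓘(ℝ, E)
    hK.isClosed hKK'
  have hχs : ContDiff ℝ 1 χ := χ.contMDiff.contDiff
  have hWs : ContDiff ℝ 1 (fun x => χ x • V x) := by
    rw [contDiff_iff_contDiffAt]
    intro x
    by_cases hx : x ∈ Ω
    · exact hχs.contDiffAt.smul (hV.contDiffAt (hΩ.mem_nhds hx))
    · have hx' : x ∈ K'ᶜ := fun h => hx (hK'Ω h)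
      have : (fun x => χ x • V x) =ᶠ[𝓝 x] fun _ => 0 := by
        filter_upwards [hK'.isClosed.isOpen_compl.mem_nhds hx'] with y hy
        simp [hχ0 y hy]
      exact contDiffAt_const.congr_of_eventuallyEq this
  have hWc : HasCompactSupport (fun x => χ x • V x) := by
    refine HasCompactSupport.intro hK' fun x hx => ?_
    simp [hχ0 x hx]
  obtain ⟨L, hL⟩ := ContDiff.lipschitzWith_of_hasCompactSupport hWc hWs one_ne_zero
  obtain ⟨M, hM⟩ := hWc.exists_bound_of_continuous hWs.continuous
  refine ⟨_, L, M.toNNReal, hL, fun x => (hM x).trans (Real.le_coe_toNNReal M), fun x hx => ?_⟩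
  simp [hχ1.self_of_nhdsSet x hx]

theorem eqOn_of_lipschitz {W : E → E} {L : ℝ≥0} (hW : LipschitzWith L W) {x y : ℝ → E} {a b c : ℝ}
    (hx : ∀ t ∈ Icc a b, HasDerivAt x (W (x t)) t) (hy : ∀ t ∈ Icc a b, HasDerivAt y (W (y t)) t)
    (hc : c ∈ Icc a b) (h : x c = y c) : EqOn x y (Icc a b) := by
  have hxc : ContinuousOn x (Icc a b) := HasDerivAt.continuousOn hx
  have hyc : ContinuousOn y (Icc a b) := HasDerivAt.continuousOn hy
  have h1 : Icc a c ⊆ Icc a b := Icc_subset_Icc_right hc.2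
  have h2 : Icc c b ⊆ Icc a b := Icc_subset_Icc_left hc.1
  rw [← Icc_union_Icc_eq_Icc hc.1 hc.2]
  refine EqOn.union ?_ ?_
  · exact ODE_solution_unique_of_mem_Icc_left (v := fun _ => W) (s := fun _ => univ)
      (fun t _ => hW.lipschitzOnWith) (hxc.mono h1)
      (fun t ht => (hx t (h1 (Ioc_subset_Icc_self ht))).hasDerivWithinAt) (fun _ _ => trivial)
      (hyc.mono h1) (fun t ht => (hy t (h1 (Ioc_subset_Icc_self ht))).hasDerivWithinAt)
      (fun _ _ => trivial) h
  · exact ODE_solution_unique_of_mem_Icc_right (v := fun _ => W) (s := fun _ => univ)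
      (fun t _ => hW.lipschitzOnWith) (hxc.mono h2)
      (fun t ht => (hx t (h2 (Ico_subset_Icc_self ht))).hasDerivWithinAt) (fun _ _ => trivial)
      (hyc.mono h2) (fun t ht => (hy t (h2 (Ico_subset_Icc_self ht))).hasDerivWithinAt)
      (fun _ _ => trivial) h

/-- Bounded Lipschitz vector fields have global integral curves. -/
theorem exists_global_solution [CompleteSpace E] {W : E → E} {L M : ℝ≥0} (hW : LipschitzWith L W)
    (hM : ∀ x, ‖W x‖ ≤ M) (x₀ : E) :
    ∃ x : ℝ → E, x 0 = x₀ ∧ ∀ t, HasDerivAt x (W (x t)) t := by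
  have key : ∀ n : ℕ, ∃ x : ℝ → E, x 0 = x₀ ∧
      ∀ t ∈ Icc (-(n + 1) : ℝ) (n + 1), HasDerivAt x (W (x t)) t := by
    intro n
    have hn : (0 : ℝ) ≤ n := n.cast_nonneg
    have h0 : (0 : ℝ) ∈ Icc (-(n + 2) : ℝ) (n + 2) := ⟨by linarith, by linarith⟩
    -- A field bounded by `M` cannot leave the ball of radius `M * (n + 2)` in time `n + 2`, so the
    -- time interval may be arbitrarily long. One spare unit at each end turns derivatives within
    -- the interval into two-sided ones.
    have hpl : IsPicardLindelof (fun _ => W) (⟨0, h0⟩ : Icc (-(n + 2) : ℝ) (n + 2)) x₀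
        (M * (n + 2)) 0 M L :=
      { lipschitzOnWith := fun _ _ => hW.lipschitzOnWith
        continuousOn := fun _ _ => continuousOn_const
        norm_le := fun _ _ x _ => hM x
        mul_max_le := by simp }
    obtain ⟨x, hx0, hx⟩ := hpl.exists_eq_forall_mem_Icc_hasDerivWithinAt₀
    refine ⟨x, hx0, fun t ht => (hx t ⟨by linarith [ht.1], by linarith [ht.2]⟩).hasDerivAt
      (Icc_mem_nhds (by linarith [ht.1]) (by linarith [ht.2]))⟩
  choose y hy0 hy using key
  have hcompat : ∀ n m : ℕ, ∀ t : ℝ, |t| ≤ n + 1 → |t| ≤ m + 1 → y n t = y m t := by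
    have aux : ∀ n m : ℕ, n ≤ m → ∀ t : ℝ, |t| ≤ n + 1 → y n t = y m t := by
      intro n m hnm t ht
      have hnm' : (n : ℝ) ≤ m := by exact_mod_cast hnm
      have hn : (0 : ℝ) ≤ n := n.cast_nonneg
      refine eqOn_of_lipschitz hW (hy n)
        (fun s hs => hy m s ⟨by linarith [hs.1], by linarith [hs.2]⟩)
        (c := 0) ⟨by linarith, by linarith⟩ (by rw [hy0, hy0]) (abs_le.1 ht)
    intro n m t hn hm
    rcases le_total n m with h | h
    · exact aux n m h t hn
    · exact (aux m n h t hm).symm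
  refine ⟨fun t => y ⌈|t|⌉₊ t, by simp [hy0], fun t => ?_⟩
  set n := ⌈|t|⌉₊ + 1 with hn
  have ht : |t| < n := by
    have := Nat.le_ceil |t|
    push_cast [hn]; linarith
  have hev : (fun s => y ⌈|s|⌉₊ s) =ᶠ[𝓝 t] y n := by
    filter_upwards [continuous_abs.continuousAt.eventually_lt_const ht] with s hs
    exact hcompat _ _ s ((Nat.le_ceil _).trans (by linarith)) (by linarith)
  have h1 : HasDerivAt (y n) (W (y n t)) t :=
    hy n t (abs_le.1 (by linarith))
  simpa [hev.self_of_nhds] using h1.congr_of_eventuallyEq hev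

/-- `x` is an integral curve of `V` inside `Ω` over the times in `I`. -/
def IsSolOn (V : E → E) (Ω : Set E) (x : ℝ → E) (I : Set ℝ) : Prop :=
  ∀ t ∈ I, HasDerivAt x (V (x t)) t ∧ x t ∈ Ω

theorem IsSolOn.mono {V : E → E} {Ω : Set E} {x : ℝ → E} {I J : Set ℝ} (h : IsSolOn V Ω x I)
    (hJ : J ⊆ I) : IsSolOn V Ω x J := fun t ht => h t (hJ ht)

theorem IsSolOn.continuousOn {V : E → E} {Ω : Set E} {x : ℝ → E} {I : Set ℝ}
    (h : IsSolOn V Ω x I) : ContinuousOn x I := HasDerivAt.continuousOn fun t ht => (h t ht).1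

theorem IsSolOn.comp_add {V : E → E} {Ω : Set E} {x : ℝ → E} {I J : Set ℝ}
    (h : IsSolOn V Ω x I) (c : ℝ) (hJ : ∀ t ∈ J, t + c ∈ I) :
    IsSolOn V Ω (fun t => x (t + c)) J := fun t ht =>
  ⟨(h _ (hJ t ht)).1.comp_add_const t c, (h _ (hJ t ht)).2⟩

variable [FiniteDimensional ℝ E] {V : E → E} {Ω : Set E}

theorem IsSolOn.eqOn (hΩ : IsOpen Ω) (hV : ContDiffOn ℝ 1 V Ω) {x y : ℝ → E} {a b c : ℝ}
    (hx : IsSolOn V Ω x (Icc a b)) (hy : IsSolOn V Ω y (Icc a b))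
    (hc : c ∈ Icc a b) (h : x c = y c) : EqOn x y (Icc a b) := by
  have hK : IsCompact (x '' Icc a b ∪ y '' Icc a b) :=
    (isCompact_Icc.image_of_continuousOn hx.continuousOn).union
      (isCompact_Icc.image_of_continuousOn hy.continuousOn)
  have hKΩ : x '' Icc a b ∪ y '' Icc a b ⊆ Ω := by
    rintro _ (⟨t, ht, rfl⟩ | ⟨t, ht, rfl⟩)
    exacts [(hx t ht).2, (hy t ht).2]
  obtain ⟨W, L, M, hL, -, hWV⟩ := exists_lipschitz_eqOn hΩ hV hK hKΩ
  refine eqOn_of_lipschitz hL (fun t ht => ?_) (fun t ht => ?_) hc h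
  · rw [hWV (Or.inl (mem_image_of_mem x ht))]; exact (hx t ht).1
  · rw [hWV (Or.inr (mem_image_of_mem y ht))]; exact (hy t ht).1

/-- Continuous dependence: solutions from nearby data exist on the same compact time interval and stay
uniformly close. -/
theorem IsSolOn.dependence (hΩ : IsOpen Ω) (hV : ContDiffOn ℝ 1 V Ω) {x : ℝ → E} {T : ℝ}
    (hx : IsSolOn V Ω x (Icc 0 T)) {ε : ℝ} (hε : 0 < ε) :
    ∀ᶠ y₀ in 𝓝 (x 0), ∃ y : ℝ → E, y 0 = y₀ ∧ IsSolOn V Ω y (Icc 0 T) ∧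
      ∀ t ∈ Icc 0 T, dist (y t) (x t) ≤ ε := by
  have hK : IsCompact (x '' Icc 0 T) := isCompact_Icc.image_of_continuousOn hx.continuousOn
  have hKΩ : x '' Icc 0 T ⊆ Ω := by
    rintro _ ⟨t, ht, rfl⟩; exact (hx t ht).2
  obtain ⟨δ, hδ, hδΩ⟩ := hK.exists_cthickening_subset_open hΩ hKΩ
  set K' := Metric.cthickening (min δ ε) (x '' Icc 0 T) with hK'def
  have hK' : IsCompact K' := hK.cthickening
  have hK'Ω : K' ⊆ Ω := (Metric.cthickening_mono (min_le_left _ _) _).trans hδΩ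
  obtain ⟨W, L, M, hL, hM, hWV⟩ := exists_lipschitz_eqOn hΩ hV hK' hK'Ω
  have hmin : 0 < min δ ε := lt_min hδ hε
  -- The initial distance compensates the Grönwall factor `exp (L * T)`. The perturbed curve then
  -- stays in `K'`, where the modified field equals the original one.
  have hpos : 0 < min δ ε * Real.exp (-(L * T)) := mul_pos hmin (Real.exp_pos _)
  filter_upwards [Metric.closedBall_mem_nhds (x 0) hpos] with y₀ hy₀
  obtain ⟨y, hy0, hy⟩ := exists_global_solution hL hM y₀
  have hxK : ∀ t ∈ Icc 0 T, x t ∈ K' := fun t ht =>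
    Metric.self_subset_cthickening _ (mem_image_of_mem x ht)
  have hd : ∀ t ∈ Icc 0 T, dist (y t) (x t) ≤ min δ ε := by
    intro t ht
    have h := dist_le_of_trajectories_ODE (v := fun _ => W) (fun _ => hL) (f := y) (g := x)
      (a := 0) (b := T) (δ := min δ ε * Real.exp (-(L * T)))
      (HasDerivAt.continuousOn fun s _ => hy s) (fun s _ => (hy s).hasDerivWithinAt)
      hx.continuousOn
      (fun s hs => by
        rw [hWV (hxK s (Ico_subset_Icc_self hs))]
        exact (hx s (Ico_subset_Icc_self hs)).1.hasDerivWithinAt)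
      (by rw [hy0]; exact hy₀) t ht
    refine h.trans ?_
    rw [mul_assoc, ← Real.exp_add]
    refine mul_le_of_le_one_right hmin.le (Real.exp_le_one_iff.2 ?_)
    have := mul_le_mul_of_nonneg_left ht.2 L.coe_nonneg
    linarith
  have hyK : ∀ t ∈ Icc 0 T, y t ∈ K' := fun t ht =>
    Metric.mem_cthickening_of_dist_le _ (x t) _ _ (mem_image_of_mem x ht) (hd t ht)
  refine ⟨y, hy0, fun t ht => ⟨?_, hK'Ω (hyK t ht)⟩, fun t ht => (hd t ht).trans (min_le_right _ _)⟩
  rw [← hWV (hyK t ht)]; exact hy t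

theorem exists_local_solution (hΩ : IsOpen Ω) (hV : ContDiffOn ℝ 1 V Ω) {x₀ : E} (hx₀ : x₀ ∈ Ω) :
    ∃ ε > 0, ∃ x : ℝ → E, x 0 = x₀ ∧ IsSolOn V Ω x (Icc (-ε) ε) := by
  obtain ⟨x, hx0, ε, hε, hx⟩ := (hV.contDiffAt
    (hΩ.mem_nhds hx₀)).exists_forall_mem_closedBall_exists_eq_forall_mem_Ioo_hasDerivAt₀ 0
  have hc : ContinuousAt x 0 := (hx 0 ⟨by linarith, by linarith⟩).continuousAt
  have hev : ∀ᶠ t in 𝓝 (0 : ℝ), x t ∈ Ω := hc.eventually_mem (hΩ.mem_nhds (by rwa [hx0]))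
  obtain ⟨δ, hδ, h⟩ := Metric.eventually_nhds_iff.1 hev
  refine ⟨min ε δ / 2, by positivity, x, hx0, fun t ht => ?_⟩
  have h1 : min ε δ / 2 < ε := by linarith [min_le_left ε δ, lt_min hε hδ]
  have h2 : min ε δ / 2 < δ := by linarith [min_le_right ε δ, lt_min hε hδ]
  refine ⟨hx t ⟨by linarith [ht.1], by linarith [ht.2]⟩, h ?_⟩
  rw [Real.dist_eq, sub_zero, abs_lt]
  exact ⟨by linarith [ht.1], by linarith [ht.2]⟩

/-- Two solutions that agree at a time interior to the overlap of their intervals can be joined. -/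
theorem IsSolOn.glue (hΩ : IsOpen Ω) (hV : ContDiffOn ℝ 1 V Ω) {x y : ℝ → E} {I J : Set ℝ} {c ε : ℝ}
    (hε : 0 < ε) (hx : IsSolOn V Ω x I) (hy : IsSolOn V Ω y J) (hc : x c = y c)
    (hI : Icc (c - ε) (c + ε) ⊆ I) (hJ : Icc (c - ε) (c + ε) ⊆ J) :
    IsSolOn V Ω (fun t => if t ≤ c then x t else y t) (I ∩ Iic c ∪ J ∩ Ici c) := by
  have heq : EqOn x y (Icc (c - ε) (c + ε)) :=
    (hx.mono hI).eqOn hΩ hV (hy.mono hJ) ⟨by linarith, by linarith⟩ hc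
  have hloc : ∀ t, |t - c| < ε → (fun t => if t ≤ c then x t else y t) =ᶠ[𝓝 t] x := by
    intro t ht
    have : ∀ᶠ s in 𝓝 t, |s - c| < ε :=
      ((continuous_id.sub continuous_const).abs.continuousAt).eventually_lt_const ht
    filter_upwards [this] with s hs
    split_ifs
    · rfl
    · exact (heq ⟨by linarith [(abs_lt.1 hs).1], by linarith [(abs_lt.1 hs).2]⟩).symm
  intro t ht
  by_cases htc : |t - c| < ε
  · have h1 := hx t (hI ⟨by linarith [(abs_lt.1 htc).1], by linarith [(abs_lt.1 htc).2]⟩)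
    have h2 := (hloc t htc)
    have h3 : (if t ≤ c then x t else y t) = x t := h2.self_of_nhds
    refine ⟨?_, by simpa only [h3] using h1.2⟩
    simpa only [h3] using h1.1.congr_of_eventuallyEq h2
  · rcases lt_or_ge t c with hlt | hge
    · have hev : (fun t => if t ≤ c then x t else y t) =ᶠ[𝓝 t] x := by
        filter_upwards [gt_mem_nhds hlt] with s hs
        simp [hs.le]
      have htI : t ∈ I := by
        rcases ht with ht | ht
        · exact ht.1
        · exact absurd ht.2 (not_le.2 hlt)
      have h3 : (if t ≤ c then x t else y t) = x t := hev.self_of_nhds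
      refine ⟨?_, by simpa only [h3] using (hx t htI).2⟩
      simpa only [h3] using (hx t htI).1.congr_of_eventuallyEq hev
    · have hgt : c < t := lt_of_le_of_ne hge (by rintro rfl; simp [hε] at htc)
      have hev : (fun t => if t ≤ c then x t else y t) =ᶠ[𝓝 t] y := by
        filter_upwards [lt_mem_nhds hgt] with s hs
        simp [not_le.2 hs]
      have htJ : t ∈ J := by
        rcases ht with ht | ht
        · exact absurd ht.2 (not_le.2 hgt)
        · exact ht.1
      have h3 : (if t ≤ c then x t else y t) = y t := hev.self_of_nhds
      refine ⟨?_, by simpa only [h3] using (hy t htJ).2⟩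
      simpa only [h3] using (hy t htJ).1.congr_of_eventuallyEq hev

/-- A solution on `[0, T]` extends a little beyond `T`. -/
theorem IsSolOn.extend (hΩ : IsOpen Ω) (hV : ContDiffOn ℝ 1 V Ω) {x : ℝ → E} {T : ℝ} (hT : 0 ≤ T)
    (hx : IsSolOn V Ω x (Icc 0 T)) :
    ∃ ε > 0, ∃ y : ℝ → E, EqOn y x (Iic T) ∧ IsSolOn V Ω y (Icc 0 (T + ε)) := by
  obtain ⟨ε, hε, z, hz0, hz⟩ := exists_local_solution hΩ hV (hx T ⟨hT, le_rfl⟩).2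
  have hz' : IsSolOn V Ω (fun t => z (t + -T)) (Icc (T - ε) (T + ε)) :=
    hz.comp_add _ fun t ht => ⟨by linarith [ht.1], by linarith [ht.2]⟩
  have hzT : z (T + -T) = x T := by simp [hz0]
  have hloc : ∃ δ > 0, IsSolOn V Ω x (Icc (T - δ) T) ∨ T = 0 := by
    rcases hT.eq_or_lt with h | h
    · exact ⟨1, one_pos, Or.inr h.symm⟩
    · exact ⟨T, h, Or.inl (by simpa using hx)⟩
  refine ⟨ε, hε, fun t => if t ≤ T then x t else z (t + -T), fun t ht => by simp [mem_Iic.1 ht], ?_⟩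
  intro t ht
  rcases lt_trichotomy t T with hlt | rfl | hgt
  · have hev : (fun t => if t ≤ T then x t else z (t + -T)) =ᶠ[𝓝 t] x := by
      filter_upwards [gt_mem_nhds hlt] with s hs
      simp [hs.le]
    have h := hx t ⟨ht.1, hlt.le⟩
    have h3 : (if t ≤ T then x t else z (t + -T)) = x t := hev.self_of_nhds
    refine ⟨?_, by simpa only [h3] using h.2⟩
    simpa only [h3] using h.1.congr_of_eventuallyEq hev
  -- At the junction both one-sided derivatives equal the field at the common point.
  · have h := hx t ⟨hT, le_rfl⟩
    have h3 : (if t ≤ t then x t else z (t + -t)) = x t := by simp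
    refine ⟨?_, by simpa only [h3] using h.2⟩
    have hzt := (hz' t ⟨by linarith, by linarith⟩).1
    simp only [hzT] at hzt
    simp only [h3]
    have hl : HasDerivWithinAt (fun s => if s ≤ t then x s else z (s + -t)) (V (x t)) (Iic t) t :=
      h.1.hasDerivWithinAt.congr (fun s hs => by simp [mem_Iic.1 hs]) (by simp)
    have hr : HasDerivWithinAt (fun s => if s ≤ t then x s else z (s + -t)) (V (x t)) (Ici t) t := by
      refine hzt.hasDerivWithinAt.congr (fun s hs => ?_) (by simp [hz0])
      rcases (mem_Ici.1 hs).eq_or_lt with rfl | hlt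
      · simp [hz0]
      · simp [not_le.2 hlt]
    simpa using hl.union hr
  · have hev : (fun t => if t ≤ T then x t else z (t + -T)) =ᶠ[𝓝 t] fun t => z (t + -T) := by
      filter_upwards [lt_mem_nhds hgt] with s hs
      simp [not_le.2 hs]
    have h := hz' t ⟨by linarith, ht.2⟩
    have h3 : (if t ≤ T then x t else z (t + -T)) = z (t + -T) := hev.self_of_nhds
    refine ⟨?_, by simpa only [h3] using h.2⟩
    simpa only [h3] using h.1.congr_of_eventuallyEq hev

/-- A solution on `[0, T)` that stays in a compact subset of `Ω` continues beyond `T`. -/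
theorem IsSolOn.continue_of_compact (hΩ : IsOpen Ω) (hV : ContDiffOn ℝ 1 V Ω) {x : ℝ → E} {T : ℝ}
    (hT : 0 < T) (hx : IsSolOn V Ω x (Ico 0 T)) {K : Set E} (hK : IsCompact K) (hKΩ : K ⊆ Ω)
    {t₀ : ℝ} (ht₀ : t₀ < T) (hxK : ∀ t ∈ Ico 0 T, t₀ ≤ t → x t ∈ K) :
    ∃ y : ℝ → E, EqOn y x (Ico 0 T) ∧ IsSolOn V Ω y (Icc 0 T) := by
  obtain ⟨t₁, ht₁, ht₁T⟩ : ∃ t₁, max 0 t₀ < t₁ ∧ t₁ < T := exists_between (max_lt hT ht₀)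
  have ht₁0 : 0 < t₁ := (le_max_left _ _).trans_lt ht₁
  have ht₁0' : t₀ < t₁ := (le_max_right _ _).trans_lt ht₁
  obtain ⟨W, L, M, hL, hM, hWV⟩ := exists_lipschitz_eqOn hΩ hV hK hKΩ
  obtain ⟨z, hz0, hz⟩ := exists_global_solution hL hM (x t₁)
  have hz' : ∀ t, HasDerivAt (fun t => z (t + -t₁)) (W (z (t + -t₁))) t := fun t =>
    (hz _).comp_add_const t _
  have heq : ∀ t, t₁ ≤ t → t < T → z (t + -t₁) = x t := by
    intro t ht htT
    refine (eqOn_of_lipschitz hL (fun s hs => ?_) (fun s _ => hz' s) (c := t₁) (a := t₁) (b := t)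
      ⟨le_rfl, ht⟩ (by simp [hz0]) ⟨ht, le_rfl⟩).symm
    have hs' : s ∈ Ico 0 T := ⟨ht₁0.le.trans hs.1, hs.2.trans_lt htT⟩
    rw [hWV (hxK s hs' (ht₁0'.le.trans hs.1))]
    exact (hx s hs').1
  -- Closedness of `K` places the endpoint inside `K`, so the modified field is the true one there
  -- and the equation holds at `T` itself.
  have hzT : z (T + -t₁) ∈ K := by
    have hc : Tendsto (fun t => z (t + -t₁)) (𝓝[<] T) (𝓝 (z (T + -t₁))) :=
      (hz' T).continuousAt.tendsto.mono_left nhdsWithin_le_nhds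
    refine hK.isClosed.mem_of_tendsto hc ?_
    filter_upwards [Ioo_mem_nhdsLT ht₁T] with t ht
    rw [heq t ht.1.le ht.2]
    exact hxK t ⟨ht₁0.le.trans ht.1.le, ht.2⟩ (ht₁0'.le.trans ht.1.le)
  refine ⟨fun t => if t < t₁ then x t else z (t + -t₁), fun t ht => ?_, fun t ht => ?_⟩
  · dsimp only
    split_ifs with h
    · rfl
    · exact heq t (not_lt.1 h) ht.2
  · rcases ht.2.lt_or_eq with hlt | rfl
    · have hev : (fun t => if t < t₁ then x t else z (t + -t₁)) =ᶠ[𝓝 t] x := by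
        filter_upwards [gt_mem_nhds hlt] with s hs
        split_ifs with h
        · rfl
        · exact heq s (not_lt.1 h) hs
      have h := hx t ⟨ht.1, hlt⟩
      have h3 : (if t < t₁ then x t else z (t + -t₁)) = x t := hev.self_of_nhds
      refine ⟨?_, by simpa only [h3] using h.2⟩
      simpa only [h3] using h.1.congr_of_eventuallyEq hev
    · have hev : (fun s => if s < t₁ then x s else z (s + -t₁)) =ᶠ[𝓝 t] fun s => z (s + -t₁) := by
        filter_upwards [lt_mem_nhds ht₁T] with s hs
        simp [not_lt.2 hs.le]
      have h3 : (if t < t₁ then x t else z (t + -t₁)) = z (t + -t₁) := hev.self_of_nhds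
      refine ⟨?_, by simpa only [h3] using hKΩ hzT⟩
      have := (hz' t).congr_of_eventuallyEq hev
      rw [hWV hzT] at this
      simpa only [h3] using this

/-- Maximal solutions: either the solution is global in the future, or it has a finite life time and leaves
every compact set. -/
theorem exists_maximal_solution (hΩ : IsOpen Ω) (hV : ContDiffOn ℝ 1 V Ω) {x₀ : E} (hx₀ : x₀ ∈ Ω) :
    ∃ x : ℝ → E, x 0 = x₀ ∧ (IsSolOn V Ω x (Ici 0) ∨
      ∃ T > 0, IsSolOn V Ω x (Ico 0 T) ∧
        ∀ K, IsCompact K → K ⊆ Ω → ∀ t₀ < T, ∃ t ∈ Ico 0 T, t₀ ≤ t ∧ x t ∉ K) := by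
  set S : Set ℝ := {T | 0 ≤ T ∧ ∃ x : ℝ → E, x 0 = x₀ ∧ IsSolOn V Ω x (Icc 0 T)} with hS
  have hloc : ∃ ε > 0, ε ∈ S := by
    obtain ⟨ε, hε, x, hx0, hx⟩ := exists_local_solution hΩ hV hx₀
    exact ⟨ε, hε, hε.le, x, hx0, hx.mono (Icc_subset_Icc_left (by linarith))⟩
  have hdown : ∀ T ∈ S, ∀ T', 0 ≤ T' → T' ≤ T → T' ∈ S := by
    rintro T ⟨hT, x, hx0, hx⟩ T' hT' hle
    exact ⟨hT', x, hx0, hx.mono (Icc_subset_Icc_right hle)⟩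
  have hchoose : ∀ T : ℝ, ∃ x : ℝ → E, T ∈ S → x 0 = x₀ ∧ IsSolOn V Ω x (Icc 0 T) := by
    intro T
    by_cases h : T ∈ S
    · obtain ⟨hT, x, hx⟩ := h
      exact ⟨x, fun _ => hx⟩
    · exact ⟨fun _ => x₀, fun h' => absurd h' h⟩
  choose y hy using hchoose
  have hcompat : ∀ T ∈ S, ∀ T' ∈ S, ∀ t, 0 ≤ t → t ≤ T → t ≤ T' → y T t = y T' t := by
    intro T hT T' hT' t h0 h1 h2
    exact (((hy T hT).2.mono (Icc_subset_Icc_right h1)).eqOn hΩ hV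
      ((hy T' hT').2.mono (Icc_subset_Icc_right h2)) (c := 0) ⟨le_rfl, h0⟩
      (by rw [(hy T hT).1, (hy T' hT').1])) ⟨h0, le_rfl⟩
  by_cases hbdd : BddAbove S
  · obtain ⟨ε, hε, hεS⟩ := hloc
    set T := sSup S with hTdef
    have hTpos : 0 < T := hε.trans_le (le_csSup hbdd hεS)
    have hmem : ∀ t, 0 ≤ t → t < T → t ∈ S := by
      intro t ht0 ht
      obtain ⟨s, hs, hts⟩ := exists_lt_of_lt_csSup ⟨ε, hεS⟩ ht
      exact hdown s hs t ht0 hts.le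
    -- The midpoint of `t` and `T` is an admissible life time that lies strictly beyond `t`. For `t
    -- ≤ 0` the index is constant, which gives a two-sided derivative at `0`.
    set x : ℝ → E := fun t => y ((max t 0 + T) / 2) t with hxdef
    have hxy : ∀ T' ∈ S, T' < T → ∀ t, 0 ≤ t → t ≤ T' → x t = y T' t := by
      intro T' hT' hlt t ht0 ht
      have hmax : max t 0 = t := max_eq_left ht0
      refine hcompat _ (hmem _ ?_ ?_) _ hT' t ht0 ?_ ht
      · rw [hmax]; linarith
      · rw [hmax]; linarith
      · rw [hmax]; linarith
    have hTn : T ∉ S := by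
      intro hTS
      obtain ⟨δ, hδ, z, hz, hzs⟩ := (hy T hTS).2.extend hΩ hV hTpos.le
      have : T + δ ∈ S := ⟨by linarith, z, by rw [hz hTpos.le, (hy T hTS).1], hzs⟩
      linarith [le_csSup hbdd this]
    have hx0 : x 0 = x₀ := by
      rw [hxy (T / 2) (hmem _ (by linarith) (by linarith)) (by linarith) 0 le_rfl (by linarith)]
      exact (hy _ (hmem _ (by linarith) (by linarith))).1
    have hxs : IsSolOn V Ω x (Ico 0 T) := by
      intro t ht
      obtain ⟨T', htT', hT'⟩ := exists_between ht.2
      have hT'S := hmem T' (ht.1.trans htT'.le) hT'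
      have h := (hy T' hT'S).2 t ⟨ht.1, htT'.le⟩
      have hxt := hxy T' hT'S hT' t ht.1 htT'.le
      refine ⟨?_, by rw [hxt]; exact h.2⟩
      rcases ht.1.eq_or_lt with h0 | h0
      · subst h0
        have hev : x =ᶠ[𝓝 0] y (T / 2) := by
          filter_upwards [gt_mem_nhds (half_pos hTpos)] with s hs
          rcases le_total 0 s with h0 | h0
          · exact hxy _ (hmem _ (by linarith) (by linarith)) (by linarith) s h0 hs.le
          · simp [hxdef, max_eq_right h0]
        have h' := (hy (T / 2) (hmem _ (by linarith) (by linarith))).2 0 ⟨le_rfl, by linarith⟩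
        rw [hev.self_of_nhds]
        exact h'.1.congr_of_eventuallyEq hev
      · have hev : x =ᶠ[𝓝 t] y T' := by
          filter_upwards [Ioo_mem_nhds h0 htT'] with s hs
          exact hxy T' hT'S hT' s hs.1.le hs.2.le
        rw [hxt]
        exact h.1.congr_of_eventuallyEq hev
    refine ⟨x, hx0, Or.inr ⟨T, hTpos, hxs, fun K hK hKΩ t₀ ht₀ => ?_⟩⟩
    by_contra! hcon
    obtain ⟨z, hzx, hz⟩ := hxs.continue_of_compact hΩ hV hTpos hK hKΩ ht₀ hcon
    exact hTn ⟨hTpos.le, z, by rw [hzx ⟨le_rfl, hTpos⟩, hx0], hz⟩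
  · have hmem : ∀ t, 0 ≤ t → t ∈ S := by
      intro t ht0
      obtain ⟨s, hs, hts⟩ := not_bddAbove_iff.1 hbdd t
      exact hdown s hs t ht0 hts.le
    set x : ℝ → E := fun t => y (max t 0 + 1) t with hxdef
    have hxy : ∀ T', 0 ≤ T' → ∀ t, 0 ≤ t → t ≤ T' → x t = y T' t := by
      intro T' hT' t ht0 ht
      have hmax : max t 0 = t := max_eq_left ht0
      refine hcompat _ (hmem _ ?_) _ (hmem _ hT') t ht0 ?_ ht <;> rw [hmax] <;> linarith
    refine ⟨x, ?_, Or.inl ?_⟩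
    · rw [hxy 0 le_rfl 0 le_rfl le_rfl]
      exact (hy 0 (hmem 0 le_rfl)).1
    · intro t ht
      have ht0 : 0 ≤ t := ht
      have h := (hy (t + 1) (hmem _ (by linarith))).2 t ⟨ht, by linarith⟩
      have hxt := hxy (t + 1) (by linarith) t ht (by linarith)
      refine ⟨?_, by rw [hxt]; exact h.2⟩
      rcases ht0.eq_or_lt with h0 | h0
      · subst h0
        have hev : x =ᶠ[𝓝 0] y 1 := by
          filter_upwards [gt_mem_nhds one_pos] with s hs
          rcases le_total 0 s with h0 | h0
          · exact hxy 1 (by linarith) s h0 hs.le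
          · simp [hxdef, max_eq_right h0]
        have h' := (hy 1 (hmem _ (by linarith))).2 0 ⟨le_rfl, by linarith⟩
        rw [hev.self_of_nhds]
        exact h'.1.congr_of_eventuallyEq hev
      · have hev : x =ᶠ[𝓝 t] y (t + 1) := by
          filter_upwards [Ioo_mem_nhds h0 (lt_add_one t)] with s hs
          exact hxy (t + 1) (by linarith) s hs.1.le hs.2.le
        rw [hxt]
        exact h.1.congr_of_eventuallyEq hev

end ODE

end EYM

namespace EYM

/-! ### Elementary comparison lemmas -/

/-- A barrier principle: the derivative is inspected only at moments of contact with the level, and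
its strict sign there forbids crossing. Most a priori bounds on `N`, `κ` and `(rU)²` come from it.
-/
theorem le_of_deriv_neg_of_eq {f f' : ℝ → ℝ} {a b c : ℝ}
    (hf : ∀ t ∈ Icc a b, HasDerivAt f (f' t) t) (ha : f a ≤ c)
    (hc : ∀ t ∈ Ico a b, f t = c → f' t < 0) : ∀ t ∈ Icc a b, f t ≤ c := fun _ ht =>
  image_le_of_deriv_right_lt_deriv_boundary (HasDerivAt.continuousOn hf)
    (fun t ht => (hf t (Ico_subset_Icc_self ht)).hasDerivWithinAt) ha
    (fun x => hasDerivAt_const x c) hc ht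

theorem ge_of_deriv_pos_of_eq {f f' : ℝ → ℝ} {a b c : ℝ}
    (hf : ∀ t ∈ Icc a b, HasDerivAt f (f' t) t) (ha : c ≤ f a)
    (hc : ∀ t ∈ Ico a b, f t = c → 0 < f' t) : ∀ t ∈ Icc a b, c ≤ f t := by
  intro t ht
  have := le_of_deriv_neg_of_eq (f := fun t => -f t) (f' := fun t => -f' t) (c := -c)
    (fun t ht => (hf t ht).neg) (neg_le_neg ha)
    (fun t ht h => neg_lt_zero.2 (hc t ht (neg_injective h))) t ht
  linarith

theorem monotoneOn_Icc_of_hasDerivAt {f f' : ℝ → ℝ} {a b : ℝ}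
    (hf : ∀ t ∈ Icc a b, HasDerivAt f (f' t) t) (h : ∀ t ∈ Icc a b, 0 ≤ f' t) :
    MonotoneOn f (Icc a b) := by
  refine monotoneOn_of_deriv_nonneg (convex_Icc a b) (HasDerivAt.continuousOn hf)
    (fun t ht => (hf t (interior_subset ht)).differentiableAt.differentiableWithinAt) fun t ht => ?_
  rw [(hf t (interior_subset ht)).deriv]
  exact h t (interior_subset ht)

theorem antitoneOn_Icc_of_hasDerivAt {f f' : ℝ → ℝ} {a b : ℝ}
    (hf : ∀ t ∈ Icc a b, HasDerivAt f (f' t) t) (h : ∀ t ∈ Icc a b, f' t ≤ 0) :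
    AntitoneOn f (Icc a b) := by
  have := monotoneOn_Icc_of_hasDerivAt (f := fun t => -f t) (f' := fun t => -f' t)
    (fun t ht => (hf t ht).neg) (fun t ht => by linarith [h t ht])
  intro s hs t ht hst
  linarith [this hs ht hst]

/-- Backward Grönwall: a nonnegative function with `Q' ≥ -C Q` that vanishes at the right end vanishes. -/
theorem eq_zero_of_deriv_ge {Q Q' : ℝ → ℝ} {a b C : ℝ} (hab : a ≤ b)
    (hQ : ∀ t ∈ Icc a b, HasDerivAt Q (Q' t) t) (h0 : 0 ≤ Q a) (h : ∀ t ∈ Icc a b, -C * Q t ≤ Q' t)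
    (hb : Q b = 0) : Q a = 0 := by
  have hd : ∀ t ∈ Icc a b, HasDerivAt (fun t => Q t * Real.exp (C * t))
      ((Q' t + C * Q t) * Real.exp (C * t)) t := by
    intro t ht
    have he : HasDerivAt (fun t => Real.exp (C * t)) (Real.exp (C * t) * (C * 1)) t :=
      ((hasDerivAt_id t).const_mul C).exp
    exact ((hQ t ht).mul he).congr_deriv (by ring)
  have hm := monotoneOn_Icc_of_hasDerivAt hd
    (fun t ht => mul_nonneg (by linarith [h t ht]) (Real.exp_pos _).le)
  have := hm ⟨le_rfl, hab⟩ ⟨hab, le_rfl⟩ hab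
  simp only [hb, zero_mul] at this
  have hp := Real.exp_pos (C * a)
  nlinarith

/-- Forward Grönwall: a nonnegative function with `Q' ≤ C Q` that vanishes at the left end vanishes. -/
theorem eq_zero_of_deriv_le {Q Q' : ℝ → ℝ} {a b C : ℝ} (hab : a ≤ b)
    (hQ : ∀ t ∈ Icc a b, HasDerivAt Q (Q' t) t) (h0 : 0 ≤ Q b) (h : ∀ t ∈ Icc a b, Q' t ≤ C * Q t)
    (ha : Q a = 0) : Q b = 0 := by
  have hd : ∀ t ∈ Icc a b, HasDerivAt (fun t => Q t * Real.exp (-C * t))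
      ((Q' t - C * Q t) * Real.exp (-C * t)) t := by
    intro t ht
    have he : HasDerivAt (fun t => Real.exp (-C * t)) (Real.exp (-C * t) * (-C * 1)) t :=
      ((hasDerivAt_id t).const_mul (-C)).exp
    exact ((hQ t ht).mul he).congr_deriv (by ring)
  have hm := antitoneOn_Icc_of_hasDerivAt hd
    (fun t ht => mul_nonpos_of_nonpos_of_nonneg (by linarith [h t ht]) (Real.exp_pos _).le)
  have := hm ⟨le_rfl, hab⟩ ⟨hab, le_rfl⟩ hab
  simp only [ha, zero_mul] at this
  have hp := Real.exp_pos (-C * b)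
  nlinarith

/-- The first time at which a continuous function that starts out negative vanishes. -/
theorem exists_first_zero {f : ℝ → ℝ} {a b : ℝ} (hab : a ≤ b) (hf : ContinuousOn f (Icc a b))
    (ha : f a < 0) (hb : 0 ≤ f b) : ∃ t ∈ Ioc a b, f t = 0 ∧ ∀ s ∈ Ico a t, f s < 0 := by
  set S := Icc a b ∩ f ⁻¹' Ici 0 with hS
  have hSc : IsClosed S := hf.preimage_isClosed_of_isClosed isClosed_Icc isClosed_Ici
  have hSb : BddBelow S := ⟨a, fun t ht => ht.1.1⟩
  have hmem := hSc.csInf_mem ⟨b, ⟨hab, le_rfl⟩, hb⟩ hSb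
  set t := sInf S
  have hlt : ∀ s ∈ Ico a t, f s < 0 := by
    intro s hs
    by_contra! h
    exact absurd (csInf_le hSb ⟨⟨hs.1, hs.2.le.trans hmem.1.2⟩, h⟩) (not_le.2 hs.2)
  have hat : a < t := lt_of_le_of_ne hmem.1.1 fun h => by
    have h2 : 0 ≤ f t := hmem.2
    rw [← h] at h2; linarith
  refine ⟨t, ⟨hat, hmem.1.2⟩, le_antisymm ?_ hmem.2, hlt⟩
  have hcw : Tendsto f (𝓝[<] t) (𝓝 (f t)) := by
    have := (hf t hmem.1).mono (Ico_subset_Icc_self.trans (Icc_subset_Icc_right hmem.1.2))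
    have h2 : ContinuousWithinAt f (Ico a t) t := this
    rw [ContinuousWithinAt, nhdsWithin_Ico_eq_nhdsLT hat] at h2
    exact h2
  refine le_of_tendsto hcw ?_
  filter_upwards [Ioo_mem_nhdsLT hat] with s hs
  exact (hlt s ⟨hs.1.le, hs.2⟩).le

/-! ### Vanishing of derivatives along precompact orbits -/

section Barbalat

variable {E : Type*} [NormedAddCommGroup E] [NormedSpace ℝ E] [FiniteDimensional ℝ E]

/-- **Barbalat's lemma** along a solution that stays in a compact set. -/
theorem IsSolOn.tendsto_deriv_zero {V : E → E} {Ω K : Set E} (hΩ : IsOpen Ω)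
    (hV : ContDiffOn ℝ 1 V Ω) {x : ℝ → E} (hx : IsSolOn V Ω x (Ici 0)) (hK : IsCompact K)
    (hKΩ : K ⊆ Ω) (hxK : ∀ t, 0 ≤ t → x t ∈ K) (ℓ : E →L[ℝ] ℝ) {l : ℝ}
    (hl : Tendsto (fun t => ℓ (x t)) atTop (𝓝 l)) :
    Tendsto (fun t => ℓ (V (x t))) atTop (𝓝 0) := by
  obtain ⟨W, L, M, hL, hM, hWV⟩ := exists_lipschitz_eqOn hΩ hV hK hKΩ
  have hxW : ∀ t, 0 ≤ t → HasDerivAt x (W (x t)) t := fun t ht => by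
    rw [hWV (hxK t ht)]; exact (hx t ht).1
  have hxL : ∀ s t, 0 ≤ s → s ≤ t → ‖x t - x s‖ ≤ M * (t - s) := by
    intro s t hs hst
    exact norm_image_sub_le_of_norm_deriv_le_segment' (f := x) (f' := fun t => W (x t)) (C := M)
      (fun u hu => (hxW u (hs.trans hu.1)).hasDerivWithinAt) (fun u _ => hM _) t ⟨hst, le_rfl⟩
  set C : ℝ := ‖ℓ‖ * (L * M) with hC
  have hC0 : 0 ≤ C := by positivity
  have hψ : ∀ s t, 0 ≤ s → s ≤ t → |ℓ (W (x t)) - ℓ (W (x s))| ≤ C * (t - s) := by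
    intro s t hs hst
    rw [← map_sub, ← Real.norm_eq_abs]
    refine (ℓ.le_opNorm _).trans ?_
    rw [hC, mul_assoc, mul_assoc]
    gcongr
    calc ‖W (x t) - W (x s)‖ ≤ L * ‖x t - x s‖ := by
          simpa [dist_eq_norm] using hL.dist_le_mul (x t) (x s)
      _ ≤ L * (M * (t - s)) := by gcongr; exact hxL s t hs hst
  have hφ : ∀ t, 0 ≤ t → HasDerivAt (fun t => ℓ (x t)) (ℓ (W (x t))) t := fun t ht =>
    ℓ.hasFDerivAt.comp_hasDerivAt t (hxW t ht)
  have hmain : Tendsto (fun t => ℓ (W (x t))) atTop (𝓝 0) := by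
    rw [Metric.tendsto_atTop]
    intro ε hε
    -- `C` is a Lipschitz constant in time of the derivative, which therefore varies by less than `ε
    -- / 2` over a window of length `h`. Convergence makes the mean slope over the window small, and
    -- the mean value theorem realises it at some point of the window.
    set h : ℝ := ε / (2 * (C + 1)) with hh
    have hhpos : 0 < h := by positivity
    have hCh : C * h < ε / 2 := by
      rw [hh, mul_div_assoc', div_lt_div_iff₀ (by positivity) (by norm_num)]
      nlinarith
    have hcau : Tendsto (fun t => ℓ (x (t + h)) - ℓ (x t)) atTop (𝓝 (l - l)) :=
      (hl.comp (tendsto_atTop_add_const_right _ h tendsto_id)).sub hl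
    rw [sub_self, Metric.tendsto_atTop] at hcau
    obtain ⟨T, hT⟩ := hcau (h * (ε / 2)) (by positivity)
    refine ⟨max T 0, fun t ht => ?_⟩
    have ht0 : 0 ≤ t := (le_max_right _ _).trans ht
    have h1 := hT t ((le_max_left _ _).trans ht)
    rw [Real.dist_eq, sub_zero] at h1 ⊢
    obtain ⟨ξ, hξ, hξ'⟩ := exists_hasDerivAt_eq_slope (fun t => ℓ (x t)) (fun t => ℓ (W (x t)))
      (show t < t + h by linarith)
      (HasDerivAt.continuousOn fun u hu => hφ u (ht0.trans hu.1))
      (fun u hu => hφ u (ht0.trans hu.1.le))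
    have h2 : |ℓ (W (x ξ))| < ε / 2 := by
      rw [hξ', add_sub_cancel_left, abs_div, abs_of_pos hhpos, div_lt_iff₀ hhpos]
      linarith
    have h3 := hψ t ξ ht0 hξ.1.le
    have h4 : C * (ξ - t) ≤ C * h := by gcongr; linarith [hξ.2]
    have h5 : |ℓ (W (x t))| ≤ |ℓ (W (x ξ))| + |ℓ (W (x ξ)) - ℓ (W (x t))| := by
      have := abs_sub_abs_le_abs_sub (ℓ (W (x t))) (ℓ (W (x ξ)))
      rw [abs_sub_comm] at this
      linarith
    linarith
  refine hmain.congr' ?_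
  filter_upwards [eventually_ge_atTop 0] with t ht
  rw [hWV (hxK t ht)]

end Barbalat

/-! ### Averages `∫₀¹ σᵐ h(xσ) dσ` and Fuchsian systems -/

/-- The weighted average `x ↦ ∫₀¹ σᵐ h(xσ) dσ`. -/
noncomputable def wavg (m : ℕ) (h : ℝ → ℝ) (x : ℝ) : ℝ := ∫ σ in (0 : ℝ)..1, σ ^ m * h (x * σ)

theorem continuous_wavg (m : ℕ) {h : ℝ → ℝ} (hh : Continuous h) : Continuous (wavg m h) := by
  unfold wavg
  refine intervalIntegral.continuous_parametric_intervalIntegral_of_continuous' ?_ 0 1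
  fun_prop

theorem wavg_eq (m : ℕ) (h : ℝ → ℝ) {x : ℝ} (hx : x ≠ 0) :
    x * wavg m h x = (∫ s in (0 : ℝ)..x, s ^ m * h s) / x ^ m := by
  have h1 := intervalIntegral.mul_integral_comp_mul_left (a := 0) (b := 1)
    (f := fun s => s ^ m * h s) (c := x)
  rw [mul_zero, mul_one] at h1
  rw [← h1, wavg, mul_div_assoc, ← intervalIntegral.integral_div]
  congr 1
  refine intervalIntegral.integral_congr fun σ _ => ?_
  have := pow_ne_zero m hx
  simp only [mul_pow]
  field_simp

/-- Away from `0`, `Y(x) = x * wavg m h x` is `x⁻ᵐ ∫₀ˣ sᵐ h`, the solution of `x Y' = -m Y + x h`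
that is regular at `0`. Writing it as an average over `[0, 1]` removes the apparent singularity. -/
theorem hasDerivAt_mul_wavg (m : ℕ) {h : ℝ → ℝ} (hh : Continuous h) (x : ℝ) :
    HasDerivAt (fun x => x * wavg m h x) (h x - m * wavg m h x) x := by
  rcases eq_or_ne x 0 with rfl | hx
  · have hw0 : wavg m h 0 = h 0 / (m + 1) := by
      simp only [wavg, zero_mul]
      rw [intervalIntegral.integral_mul_const, integral_pow]
      simp; ring
    have hd : HasDerivAt (fun x => x * wavg m h x) (wavg m h 0) 0 := by
      rw [hasDerivAt_iff_tendsto_slope]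
      have := ((continuous_wavg m hh).tendsto 0).mono_left
        (nhdsWithin_le_nhds (s := {(0 : ℝ)}ᶜ))
      refine this.congr' ?_
      filter_upwards [self_mem_nhdsWithin] with y hy
      have hy : y ≠ 0 := hy
      simp [slope_def_field, hy]
    refine hd.congr_deriv ?_
    rw [hw0]
    have : (m : ℝ) + 1 ≠ 0 := by positivity
    field_simp; ring
  · have hc : Continuous fun s : ℝ => s ^ m * h s := by fun_prop
    have hI : HasDerivAt (fun x => ∫ s in (0 : ℝ)..x, s ^ m * h s) (x ^ m * h x) x :=
      intervalIntegral.integral_hasDerivAt_right (hc.intervalIntegrable _ _)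
        hc.aestronglyMeasurable.stronglyMeasurableAtFilter hc.continuousAt
    have hd := hI.div (hasDerivAt_pow m x) (pow_ne_zero m hx)
    have hev : (fun x => x * wavg m h x) =ᶠ[𝓝 x] fun x => (∫ s in (0 : ℝ)..x, s ^ m * h s) / x ^ m := by
      filter_upwards [isOpen_ne.mem_nhds hx] with y hy
      exact wavg_eq m h hy
    refine (hd.congr_of_eventuallyEq hev).congr_deriv ?_
    have hI' : (∫ s in (0 : ℝ)..x, s ^ m * h s) = x ^ m * (x * wavg m h x) := by
      rw [wavg_eq m h hx]
      have := pow_ne_zero m hx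
      field_simp
    rw [hI']
    rcases m with _ | m
    · simp
    · have := pow_ne_zero m hx
      simp only [Nat.add_sub_cancel, pow_succ]
      push_cast
      field_simp

/-- Differentiation under the integral sign produces one more factor `σ`, hence the weight `m + 1`.
-/
theorem hasDerivAt_wavg (m : ℕ) {h h' : ℝ → ℝ} {a : ℝ} (hd : ∀ x ∈ Ioo (-a) a, HasDerivAt h (h' x) x)
    (hc : ContinuousOn h' (Ioo (-a) a)) {x : ℝ} (hx : x ∈ Ioo (-a) a) :
    HasDerivAt (wavg m h) (wavg (m + 1) h' x) x := by
  obtain ⟨b, hxb, hba⟩ := exists_between (abs_lt.2 hx)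
  have hb0 : 0 < b := (abs_nonneg x).trans_lt hxb
  have hsub : Icc (-b) b ⊆ Ioo (-a) a := fun y hy => ⟨by linarith [hy.1], by linarith [hy.2]⟩
  obtain ⟨M, hM⟩ := isCompact_Icc.exists_bound_of_continuousOn (hc.mono hsub)
  have hmem : ∀ y ∈ Ioo (-b) b, ∀ σ ∈ Ioc (0 : ℝ) 1, y * σ ∈ Icc (-b) b := by
    intro y hy σ hσ
    rw [mem_Icc, ← abs_le, abs_mul, abs_of_pos hσ.1]
    exact (mul_le_of_le_one_right (abs_nonneg y) hσ.2).trans (abs_lt.2 hy).le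
  have hmem' : ∀ y ∈ Ioo (-b) b, ∀ σ ∈ Icc (0 : ℝ) 1, y * σ ∈ Icc (-b) b := by
    intro y hy σ hσ
    rw [mem_Icc, ← abs_le, abs_mul, abs_of_nonneg hσ.1]
    exact (mul_le_of_le_one_right (abs_nonneg y) hσ.2).trans (abs_lt.2 hy).le
  have hhc : ContinuousOn h (Ioo (-a) a) := HasDerivAt.continuousOn hd
  have hFc : ∀ y ∈ Ioo (-b) b, ContinuousOn (fun σ : ℝ => σ ^ m * h (y * σ)) (Icc 0 1) := by
    intro y hy
    refine ContinuousOn.mul (by fun_prop) (hhc.comp (by fun_prop) fun σ hσ => hsub (hmem' y hy σ hσ))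
  have hF'c : ContinuousOn (fun σ : ℝ => σ ^ (m + 1) * h' (x * σ)) (Icc 0 1) := by
    refine ContinuousOn.mul (by fun_prop)
      (hc.comp (by fun_prop) fun σ hσ => hsub (hmem' x (abs_lt.1 hxb) σ hσ))
  have hIoc : uIoc (0 : ℝ) 1 = Ioc 0 1 := uIoc_of_le zero_le_one
  refine (intervalIntegral.hasDerivAt_integral_of_dominated_loc_of_deriv_le
    (F := fun y σ => σ ^ m * h (y * σ)) (F' := fun y σ => σ ^ (m + 1) * h' (y * σ))
    (s := Ioo (-b) b) (bound := fun _ => M) (Ioo_mem_nhds (abs_lt.1 hxb).1 (abs_lt.1 hxb).2)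
    ?_ ?_ ?_ ?_ ?_ ?_).2
  · filter_upwards [Ioo_mem_nhds (abs_lt.1 hxb).1 (abs_lt.1 hxb).2] with y hy
    rw [hIoc]
    exact ((hFc y hy).mono Ioc_subset_Icc_self).aestronglyMeasurable measurableSet_Ioc
  · refine ContinuousOn.intervalIntegrable ?_
    rw [uIcc_of_le zero_le_one]
    exact hFc x (abs_lt.1 hxb)
  · rw [hIoc]
    exact (hF'c.mono Ioc_subset_Icc_self).aestronglyMeasurable measurableSet_Ioc
  · refine Eventually.of_forall fun σ hσ y hy => ?_
    rw [hIoc] at hσ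
    rw [norm_mul, norm_pow, Real.norm_of_nonneg hσ.1.le]
    calc σ ^ (m + 1) * ‖h' (y * σ)‖ ≤ 1 * M := by
          gcongr
          · exact pow_le_one₀ hσ.1.le hσ.2
          · exact hM _ (hmem y hy σ hσ)
      _ = M := one_mul M
  · exact intervalIntegrable_const
  · refine Eventually.of_forall fun σ hσ y hy => ?_
    rw [hIoc] at hσ
    have h1 := (hd (y * σ) (hsub (hmem y hy σ hσ)))
    have h2 : HasDerivAt (fun y : ℝ => y * σ) σ y := by simpa using (hasDerivAt_id y).mul_const σ
    exact ((h1.comp y h2).const_mul (σ ^ m)).congr_deriv (by ring)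

/-- Averaging loses no derivatives, even at `x = 0`. This is what lets the fixed point of the
integral equation be bootstrapped to a smooth function. -/
theorem contDiffOn_wavg (n : ℕ) : ∀ (m : ℕ) {h : ℝ → ℝ} {a : ℝ},
    ContDiffOn ℝ n h (Ioo (-a) a) → ContDiffOn ℝ n (wavg m h) (Ioo (-a) a) := by
  induction n with
  | zero =>
    intro m h a hh
    simp only [Nat.cast_zero, contDiffOn_zero] at hh ⊢
    intro x hx
    obtain ⟨b, hxb, hba⟩ := exists_between (abs_lt.2 hx)
    have hb0 : 0 < b := (abs_nonneg x).trans_lt hxb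
    -- Clamping the argument makes the integrand continuous on the whole line and leaves the average
    -- unchanged near `x`.
    set c : ℝ → ℝ := fun y => max (-b) (min y b) with hcdef
    have hcc : Continuous c := by fun_prop
    have hmem : ∀ y, c y ∈ Ioo (-a) a := fun y =>
      ⟨by linarith [le_max_left (-b) (min y b)],
        by linarith [max_le (by linarith : -b ≤ b) (min_le_right y b)]⟩
    have hce : ∀ y, |y| ≤ b → c y = y := fun y hy => by
      simp only [hcdef, min_eq_left (abs_le.1 hy).2, max_eq_right (abs_le.1 hy).1]
    have hcont : Continuous fun y => h (c y) := hh.comp_continuous hcc hmem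
    refine (ContinuousAt.congr (continuous_wavg m hcont).continuousAt ?_).continuousWithinAt
    filter_upwards [continuous_abs.continuousAt.eventually_lt_const hxb] with y hy
    refine intervalIntegral.integral_congr fun σ hσ => ?_
    rw [uIcc_of_le zero_le_one] at hσ
    have : |y * σ| ≤ b := by
      rw [abs_mul, abs_of_nonneg hσ.1]
      exact (mul_le_of_le_one_right (abs_nonneg y) hσ.2).trans hy.le
    simp only [hce _ this]
  | succ n ih =>
    intro m h a hh
    have hh' := (contDiffOn_succ_iff_deriv_of_isOpen (n := n) isOpen_Ioo).1 (by exact_mod_cast hh)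
    have hd : ∀ x ∈ Ioo (-a) a, HasDerivAt h (deriv h x) x := fun x hx =>
      (hh'.1.differentiableAt (isOpen_Ioo.mem_nhds hx)).hasDerivAt
    have hd2 : ∀ x ∈ Ioo (-a) a, HasDerivAt (wavg m h) (wavg (m + 1) (deriv h) x) x := fun x hx =>
      hasDerivAt_wavg m hd hh'.2.2.continuousOn hx
    have : ContDiffOn ℝ ((n : WithTop ℕ∞) + 1) (wavg m h) (Ioo (-a) a) := by
      refine (contDiffOn_succ_iff_deriv_of_isOpen isOpen_Ioo).2
        ⟨fun x hx => (hd2 x hx).differentiableAt.differentiableWithinAt, by simp, ?_⟩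
      exact (ih (m + 1) hh'.2.2).congr fun x hx => (hd2 x hx).deriv
    exact_mod_cast this

/-- Singular initial value problem `x Y_i' = -m_i Y_i + x f_i(μ, x, Y)`, `Y(0) = 0`, with a parameter
`μ ∈ [0, 1]`. -/
theorem exists_fuchs_solution {ι : Type*} [Fintype ι] (m : ι → ℕ)
    {f : ℝ × ℝ × (ι → ℝ) → ι → ℝ} (hf : ContDiff ℝ ∞ f) :
    ∃ M : ℝ, 0 < M ∧ ∃ a : ℝ, 0 < a ∧ ∃ Y : ℝ → ℝ → ι → ℝ,
      (∀ μ ∈ Icc (0 : ℝ) 1, ContDiffOn ℝ ∞ (Y μ) (Ioo (-a) a) ∧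
        (∀ x, ‖Y μ x‖ ≤ M * |x|) ∧
        ∀ x ∈ Ioo (-a) a, ∀ i, x * deriv (fun x => Y μ x i) x =
          -(m i) * Y μ x i + x * f (μ, x, Y μ x) i) ∧
      ∀ x, ContinuousOn (fun μ => Y μ x) (Icc 0 1) := by
  classical
  have hKc : IsCompact (Icc (0 : ℝ) 1 ×ˢ Icc (-1 : ℝ) 1 ×ˢ Metric.closedBall (0 : ι → ℝ) 1) :=
    isCompact_Icc.prod (isCompact_Icc.prod (isCompact_closedBall _ _))
  obtain ⟨g, L, M, hL, hM, hgf⟩ := exists_lipschitz_eqOn isOpen_univ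
    ((hf.of_le (by exact_mod_cast le_top)).contDiffOn) hKc (subset_univ _)
  -- The three constraints serve to keep `x` in `[-1, 1]`, to make the integral operator a
  -- contraction with factor `1 / 2`, and to keep its values in the unit ball, where `g` agrees with
  -- `f`.
  set a : ℝ := min 1 (min (1 / (2 * (L + 1))) (1 / (M + 1))) with ha
  have ha0 : 0 < a := by positivity
  have ha1 : a ≤ 1 := min_le_left _ _
  have haL : a * L ≤ 1 / 2 := by
    have h1 : a ≤ 1 / (2 * (L + 1)) := (min_le_right _ _).trans (min_le_left _ _)
    rw [le_div_iff₀ (by positivity)] at h1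
    linarith
  have haM : a * M ≤ 1 := by
    have h1 : a ≤ 1 / (M + 1) := (min_le_right _ _).trans (min_le_right _ _)
    rw [le_div_iff₀ (by positivity)] at h1
    linarith
  -- The clamp lets the operator act on bounded continuous functions on all of `ℝ`; on `[-a, a]` it
  -- changes nothing.
  set c : ℝ → ℝ := fun x => max (-a) (min x a) with hc
  have hcc : Continuous c := by fun_prop
  have hca : ∀ x, |c x| ≤ a := fun x => abs_le.2
    ⟨le_max_left _ _, max_le (by linarith) (min_le_right _ _)⟩
  have hcx : ∀ x, |c x| ≤ |x| := by
    intro x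
    rw [abs_le]
    constructor
    · refine le_max_of_le_right (le_min (neg_abs_le x) (by linarith [abs_nonneg x]))
    · exact max_le (by linarith [abs_nonneg x]) ((min_le_left _ _).trans (le_abs_self x))
  have hce : ∀ x, |x| ≤ a → c x = x := fun y hy => by
    simp only [hc, min_eq_left (abs_le.1 hy).2, max_eq_right (abs_le.1 hy).1]
  have hgc : Continuous g := hL.continuous
  -- the integral operator
  have hint : ∀ (μ : ℝ) (Y : BoundedContinuousFunction ℝ (ι → ℝ)) (i : ι),
      Continuous fun y => g (μ, y, Y y) i := by
    intro μ Y i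
    have := Y.continuous
    fun_prop
  have hwb : ∀ (j : ℕ) (h : ℝ → ℝ) (B : ℝ), (∀ y, |h y| ≤ B) → ∀ x, |wavg j h x| ≤ B := by
    intro j h B hB x
    have := intervalIntegral.norm_integral_le_of_norm_le_const (a := 0) (b := 1)
      (f := fun σ => σ ^ j * h (x * σ)) (C := B) (fun σ hσ => by
        rw [uIoc_of_le zero_le_one] at hσ
        rw [norm_mul, norm_pow, Real.norm_of_nonneg hσ.1.le]
        calc σ ^ j * ‖h (x * σ)‖ ≤ 1 * B := by
              gcongr
              · exact pow_le_one₀ hσ.1.le hσ.2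
              · exact hB _
          _ = B := one_mul B)
    simpa [wavg] using this
  have hop : ∀ (μ : ℝ) (Y : BoundedContinuousFunction ℝ (ι → ℝ)), ∀ x,
      ‖(fun i => c x * wavg (m i) (fun y => g (μ, y, Y y) i) (c x) : ι → ℝ)‖ ≤ |c x| * M := by
    intro μ Y x
    rw [pi_norm_le_iff_of_nonneg (by positivity)]
    intro i
    rw [norm_mul, Real.norm_eq_abs]
    gcongr
    exact hwb _ _ _ (fun y => (norm_le_pi_norm (g (μ, y, Y y)) i).trans (hM _)) _
  set T : ℝ → BoundedContinuousFunction ℝ (ι → ℝ) → BoundedContinuousFunction ℝ (ι → ℝ) :=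
    fun μ Y => BoundedContinuousFunction.ofNormedAddCommGroup
      (fun x i => c x * wavg (m i) (fun y => g (μ, y, Y y) i) (c x))
      (continuous_pi fun i => hcc.mul ((continuous_wavg _ (hint μ Y i)).comp hcc)) (a * M)
      (fun x => (hop μ Y x).trans (by gcongr; exact hca x)) with hT
  have hTa : ∀ μ Y x i, T μ Y x i = c x * wavg (m i) (fun y => g (μ, y, Y y) i) (c x) :=
    fun _ _ _ _ => rfl
  -- One estimate serves twice: `μ = ν` gives the contraction, and applied to the fixed points it
  -- gives their Lipschitz dependence on the parameter.
  have hdist : ∀ μ ν (Y Z : BoundedContinuousFunction ℝ (ι → ℝ)),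
      dist (T μ Y) (T ν Z) ≤ 1 / 2 * max |μ - ν| (dist Y Z) := by
    intro μ ν Y Z
    have hnn : 0 ≤ max |μ - ν| (dist Y Z) := (abs_nonneg _).trans (le_max_left _ _)
    rw [BoundedContinuousFunction.dist_le (by positivity)]
    intro x
    rw [dist_pi_le_iff (by positivity)]
    intro i
    rw [hTa, hTa, Real.dist_eq, ← mul_sub, abs_mul]
    have hsub : wavg (m i) (fun y => g (μ, y, Y y) i) (c x) - wavg (m i) (fun y => g (ν, y, Z y) i) (c x)
        = wavg (m i) (fun y => g (μ, y, Y y) i - g (ν, y, Z y) i) (c x) := by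
      simp only [wavg]
      rw [← intervalIntegral.integral_sub]
      · simp only [mul_sub]
      · have := hint μ Y i
        exact Continuous.intervalIntegrable (by fun_prop) _ _
      · have := hint ν Z i
        exact Continuous.intervalIntegrable (by fun_prop) _ _
    rw [hsub]
    have hbd := hwb (m i) (fun y => g (μ, y, Y y) i - g (ν, y, Z y) i)
      (L * max |μ - ν| (dist Y Z)) (fun y => by
        calc |g (μ, y, Y y) i - g (ν, y, Z y) i| ≤ dist (g (μ, y, Y y)) (g (ν, y, Z y)) := by
              rw [← Real.dist_eq]; exact dist_le_pi_dist _ _ i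
          _ ≤ L * dist (μ, y, Y y) (ν, y, Z y) := hL.dist_le_mul _ _
          _ ≤ L * max |μ - ν| (dist Y Z) := by
              gcongr
              rw [Prod.dist_eq, Prod.dist_eq]
              simp only [dist_self, Real.dist_eq]
              refine max_le (le_max_left _ _) (max_le hnn ?_)
              exact (BoundedContinuousFunction.dist_coe_le_dist y).trans (le_max_right _ _)) (c x)
    calc |c x| * |wavg (m i) (fun y => g (μ, y, Y y) i - g (ν, y, Z y) i) (c x)|
        ≤ a * (L * max |μ - ν| (dist Y Z)) := by gcongr; exact hca x
      _ = (a * L) * max |μ - ν| (dist Y Z) := by ring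
      _ ≤ 1 / 2 * max |μ - ν| (dist Y Z) := by gcongr
  have hctr : ∀ μ, ContractingWith (1 / 2) (T μ) := by
    intro μ
    refine ⟨by rw [← NNReal.coe_lt_coe]; norm_num, LipschitzWith.of_dist_le_mul fun Y Z => ?_⟩
    have := hdist μ μ Y Z
    simpa [dist_nonneg] using this
  choose Y hY using fun μ => (show ∃ Y, T μ Y = Y from ⟨_, (hctr μ).fixedPoint_isFixedPt⟩)
  have hYx : ∀ μ x i, Y μ x i = c x * wavg (m i) (fun y => g (μ, y, Y μ y) i) (c x) := by
    intro μ x i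
    conv_lhs => rw [← hY μ]
    rfl
  have hYn : ∀ μ x, ‖Y μ x‖ ≤ |c x| * M := by
    intro μ x
    have := hop μ (Y μ) x
    rwa [show (fun i => c x * wavg (m i) (fun y => g (μ, y, Y μ y) i) (c x)) = Y μ x from
      funext fun i => (hYx μ x i).symm] at this
  have hgY : ∀ μ ∈ Icc (0 : ℝ) 1, ∀ x, |x| ≤ a → g (μ, x, Y μ x) = f (μ, x, Y μ x) := by
    intro μ hμ x hx
    refine hgf ⟨hμ, abs_le.1 (hx.trans ha1), ?_⟩
    rw [mem_closedBall_zero_iff]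
    calc ‖Y μ x‖ ≤ |c x| * M := hYn μ x
      _ ≤ a * M := by gcongr; exact hca x
      _ ≤ 1 := haM
  refine ⟨M + 1, by positivity, a, ha0, fun μ x => Y μ x, fun μ hμ => ?_, fun x => ?_⟩
  · set h : ι → ℝ → ℝ := fun i x => f (μ, x, Y μ x) i with hh
    have hhc : ∀ i, Continuous (h i) := by
      intro i
      have := (Y μ).continuous
      have := hf.continuous
      fun_prop
    have hYh : ∀ i, ∀ x, |x| ≤ a → Y μ x i = x * wavg (m i) (h i) x := by
      intro i x hx
      rw [hYx, hce x hx]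
      congr 1
      refine intervalIntegral.integral_congr fun σ hσ => ?_
      rw [uIcc_of_le zero_le_one] at hσ
      have : |x * σ| ≤ a := by
        rw [abs_mul, abs_of_nonneg hσ.1]
        exact (mul_le_of_le_one_right (abs_nonneg x) hσ.2).trans hx
      simp only [hh, hgY μ hμ _ this]
    have hYd : ∀ i, ∀ x ∈ Ioo (-a) a,
        HasDerivAt (fun x => Y μ x i) (h i x - m i * wavg (m i) (h i) x) x := by
      intro i x hx
      refine (hasDerivAt_mul_wavg (m i) (hhc i) x).congr_of_eventuallyEq ?_
      filter_upwards [isOpen_Ioo.mem_nhds hx] with y hy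
      exact hYh i y (abs_lt.2 hy).le
    -- If `Y` is `Cⁿ`, so is `h`, and hence also the derivative `h - m * wavg m h` of `Y`.
    have hsm : ∀ n : ℕ, ContDiffOn ℝ n (fun x => Y μ x) (Ioo (-a) a) := by
      intro n
      induction n with
      | zero => simpa using (Y μ).continuous.continuousOn
      | succ n ih =>
        have hhn : ∀ i, ContDiffOn ℝ n (h i) (Ioo (-a) a) := by
          intro i
          have h1 : ContDiffOn ℝ n (fun x : ℝ => (μ, x, Y μ x)) (Ioo (-a) a) :=
            contDiffOn_const.prodMk (contDiffOn_id.prodMk ih)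
          have h2 : ContDiff ℝ n f := hf.of_le (by exact_mod_cast le_top)
          exact contDiffOn_pi.1 (h2.comp_contDiffOn h1) i
        have : ContDiffOn ℝ ((n : WithTop ℕ∞) + 1) (fun x => Y μ x) (Ioo (-a) a) := by
          rw [contDiffOn_pi]
          intro i
          refine (contDiffOn_succ_iff_deriv_of_isOpen isOpen_Ioo).2
            ⟨fun x hx => (hYd i x hx).differentiableAt.differentiableWithinAt, by simp, ?_⟩
          refine ContDiffOn.congr (f := fun x => h i x - m i * wavg (m i) (h i) x) ?_
            fun x hx => (hYd i x hx).deriv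
          exact (hhn i).sub (contDiffOn_const.mul (contDiffOn_wavg n (m i) (hhn i)))
        exact_mod_cast this
    refine ⟨contDiffOn_infty.2 hsm, fun x => ?_, fun x hx i => ?_⟩
    · calc ‖Y μ x‖ ≤ |c x| * M := hYn μ x
        _ ≤ |x| * (M + 1) :=
            mul_le_mul (hcx x) (by linarith) M.coe_nonneg (abs_nonneg x)
        _ = (M + 1) * |x| := mul_comm _ _
    · dsimp only
      rw [(hYd i x hx).deriv]
      have := hYh i x (abs_lt.2 hx).le
      simp only [hh] at this ⊢
      rw [this]
      ring
  · have hlip : ∀ μ ν, dist (Y μ) (Y ν) ≤ |μ - ν| := by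
      intro μ ν
      have h1 := hdist μ ν (Y μ) (Y ν)
      rw [hY, hY] at h1
      rcases le_total |μ - ν| (dist (Y μ) (Y ν)) with h | h
      · rw [max_eq_right h] at h1
        have := dist_nonneg (x := Y μ) (y := Y ν)
        have h2 : dist (Y μ) (Y ν) = 0 := by linarith
        rw [h2]; positivity
      · exact h
    refine Continuous.continuousOn (LipschitzWith.continuous (K := 1)
      (LipschitzWith.of_dist_le_mul fun μ ν => ?_))
    rw [NNReal.coe_one, one_mul, Real.dist_eq]
    exact (BoundedContinuousFunction.dist_coe_le_dist x).trans (hlip μ ν)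

end EYM

/-! ### The family of solutions near the center, uniformly in `lam` -/

namespace EYM

/-- The nonlinearity of the Fuchsian form of the equations at the origin. With `r = μ x`,
`1/A = B = 1 + x Y₀`, `w = 1 - μ x² β`, `β = (1 - μ)/2 + Y₁` and `w' = -x γ`, `γ = 2 β + x Y₂`. -/
noncomputable def originRHS (Λ : ℝ) (p : ℝ × ℝ × (Fin 3 → ℝ)) : Fin 3 → ℝ :=
  let μ := p.1
  let x := p.2.1
  let Y := p.2.2
  let B := 1 + x * Y 0
  let β := (1 - μ) / 2 + Y 1
  let γ := 2 * β + x * Y 2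
  let P := β ^ 2 * (2 - μ * x ^ 2 * β) ^ 2 + Λ * μ ^ 2
  ![-Y 0 ^ 2 + B ^ 2 * P + 2 * B * γ ^ 2, Y 2,
    -Y 0 * Y 2 + B * (-3 * μ * β ^ 2 + μ ^ 2 * x ^ 2 * β ^ 3) + γ * B * P]

theorem contDiff_originRHS (Λ : ℝ) : ContDiff ℝ ∞ (originRHS Λ) := by
  have h0 : ContDiff ℝ ∞ fun p : ℝ × ℝ × (Fin 3 → ℝ) => p.2.2 0 := by fun_prop
  have h1 : ContDiff ℝ ∞ fun p : ℝ × ℝ × (Fin 3 → ℝ) => p.2.2 1 := by fun_prop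
  have h2 : ContDiff ℝ ∞ fun p : ℝ × ℝ × (Fin 3 → ℝ) => p.2.2 2 := by fun_prop
  rw [contDiff_pi]
  intro i
  fin_cases i <;> simp [originRHS] <;> fun_prop

/-- A family of solutions near the origin, parametrised by `lam ≥ 0`, with quantitative information at
`r = a / (1 + lam)`. -/
structure LocalFamily (Λ a : ℝ) (A w : ℝ → ℝ → ℝ) : Prop where
  a_pos : 0 < a
  a_le : a ≤ 1 / 100
  smooth_A : ∀ lam, 0 ≤ lam → ∀ r, |r| < 2 * a / (1 + lam) → ContDiffAt ℝ ∞ (A lam) r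
  smooth_w : ∀ lam, 0 ≤ lam → ∀ r, |r| < 2 * a / (1 + lam) → ContDiffAt ℝ ∞ (w lam) r
  A_pos : ∀ lam, 0 ≤ lam → ∀ r, |r| < 2 * a / (1 + lam) → 0 < A lam r
  w_pos : ∀ lam, 0 ≤ lam → ∀ r, |r| < 2 * a / (1 + lam) → 0 < w lam r
  A_eq : ∀ lam, 0 ≤ lam → ∀ r, 0 < r → r < 2 * a / (1 + lam) →
    r * deriv (A lam) r + 2 * A lam r * deriv (w lam) r ^ 2 = Phi Λ (A lam) (w lam) r
  w_eq : ∀ lam, 0 ≤ lam → ∀ r, 0 < r → r < 2 * a / (1 + lam) →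
    r ^ 2 * A lam r * deriv (deriv (w lam)) r + r * deriv (w lam) r * Phi Λ (A lam) (w lam) r
      + w lam r * (1 - w lam r ^ 2) = 0
  A_zero : ∀ lam, 0 ≤ lam → A lam 0 = 1
  w_zero : ∀ lam, 0 ≤ lam → w lam 0 = 1
  dw_zero : ∀ lam, 0 ≤ lam → deriv (w lam) 0 = 0
  ddw_zero : ∀ lam, 0 ≤ lam → deriv (deriv (w lam)) 0 = -lam
  cont_A : ContinuousOn (fun lam => A lam (a / (1 + lam))) (Ici 0)
  cont_w : ContinuousOn (fun lam => w lam (a / (1 + lam))) (Ici 0)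
  cont_dw : ContinuousOn (fun lam => deriv (w lam) (a / (1 + lam))) (Ici 0)
  A_near : ∀ lam, 0 ≤ lam → |A lam (a / (1 + lam)) - 1| ≤ 1 / 100
  dw_near : ∀ lam, 0 ≤ lam → |deriv (w lam) (a / (1 + lam))| ≤ 1 / 50
  z_near : ∀ lam, 0 ≤ lam → |(1 - w lam (a / (1 + lam)) ^ 2) / (a / (1 + lam))| ≤ 1 / 50
  z_large : ∀ lam, 9 ≤ lam → a / 2 ≤ (1 - w lam (a / (1 + lam)) ^ 2) / (a / (1 + lam))
  q_large : ∀ lam, 9 ≤ lam →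
    -2 * w lam (a / (1 + lam)) * deriv (w lam) (a / (1 + lam)) /
      ((1 - w lam (a / (1 + lam)) ^ 2) / (a / (1 + lam))) ∈ Icc (3 / 2) (5 / 2)

-- The rescaling `x = (1 + lam) r`, `μ = 1 / (1 + lam)` compactifies the parameter: all `lam ≥ 0`
-- correspond to `μ ∈ (0, 1]`, and the Fuchsian system extends to `μ = 0`. Its interval of existence
-- in `x` and its bounds are therefore uniform, and `r = a / (1 + lam)` is simply `x = a`. The value
-- `β(0) = (1 - μ) / 2` encodes `w''(0) = -lam`.
set_option maxHeartbeats 400000 in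
theorem exists_localFamily (Λ : ℝ) : ∃ a A w, LocalFamily Λ a A w := by
  obtain ⟨M, hM, a₀, ha₀, Y, hY, hYc⟩ := exists_fuchs_solution ![2, 0, 4] (contDiff_originRHS Λ)
  obtain ⟨a, ha, haa, ha1, haM⟩ : ∃ a > 0, 2 * a ≤ a₀ ∧ a ≤ 1 / 100 ∧ M * (2 * a) ≤ 1 / 100 := by
    refine ⟨min (a₀ / 2) (min (1 / 100) (1 / (200 * M))), by positivity, ?_, ?_, ?_⟩
    · linarith [min_le_left (a₀ / 2) (min (1 / 100) (1 / (200 * M)))]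
    · exact (min_le_right _ _).trans (min_le_left _ _)
    · have h : min (a₀ / 2) (min (1 / 100) (1 / (200 * M))) ≤ 1 / (200 * M) :=
        (min_le_right _ _).trans (min_le_right _ _)
      rw [le_div_iff₀ (by positivity)] at h
      linarith
  set B : ℝ → ℝ → ℝ := fun μ x => 1 + x * Y μ x 0 with hB
  set β : ℝ → ℝ → ℝ := fun μ x => (1 - μ) / 2 + Y μ x 1 with hβ
  set γ : ℝ → ℝ → ℝ := fun μ x => 2 * β μ x + x * Y μ x 2 with hγ
  have hYi : ∀ μ x i, |Y μ x i| ≤ ‖Y μ x‖ := fun μ x i => norm_le_pi_norm (Y μ x) i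
  have hY1 : ∀ μ ∈ Icc (0 : ℝ) 1, ∀ x, |x| < 2 * a → ∀ i, |Y μ x i| ≤ 1 / 100 := by
    intro μ hμ x hx i
    refine (hYi μ x i).trans (((hY μ hμ).2.1 x).trans ?_)
    calc M * |x| ≤ M * (2 * a) := by gcongr
      _ ≤ _ := haM
  have hxY : ∀ μ ∈ Icc (0 : ℝ) 1, ∀ x, |x| < 2 * a → ∀ i, |x * Y μ x i| ≤ 1 / 5000 := by
    intro μ hμ x hx i
    rw [abs_mul]
    calc |x| * |Y μ x i| ≤ (1 / 50) * (1 / 100) :=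
          mul_le_mul (by linarith) (hY1 μ hμ x hx i) (abs_nonneg _) (by norm_num)
      _ = _ := by norm_num
  have hBpos : ∀ μ ∈ Icc (0 : ℝ) 1, ∀ x, |x| < 2 * a → 0 < B μ x := by
    intro μ hμ x hx
    have := abs_le.1 (hxY μ hμ x hx 0)
    simp only [hB]; linarith
  -- smoothness and the differential equations in the variable `x`
  have hYs : ∀ μ ∈ Icc (0 : ℝ) 1, ∀ x, |x| < 2 * a → ∀ i, ContDiffAt ℝ ∞ (fun x => Y μ x i) x := by
    intro μ hμ x hx i
    have hx' : x ∈ Ioo (-a₀) a₀ := abs_lt.1 (hx.trans_le haa)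
    exact contDiffAt_pi.1 ((hY μ hμ).1.contDiffAt (isOpen_Ioo.mem_nhds hx')) i
  have hYd : ∀ μ ∈ Icc (0 : ℝ) 1, ∀ x, |x| < 2 * a → ∀ i,
      HasDerivAt (fun x => Y μ x i) (deriv (fun x => Y μ x i) x) x := fun μ hμ x hx i =>
    ((hYs μ hμ x hx i).differentiableAt (by simp)).hasDerivAt
  have hYe : ∀ μ ∈ Icc (0 : ℝ) 1, ∀ x, |x| < 2 * a → ∀ i, x * deriv (fun x => Y μ x i) x =
      -((![2, 0, 4] : Fin 3 → ℕ) i) * Y μ x i + x * originRHS Λ (μ, x, Y μ x) i := by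
    intro μ hμ x hx i
    exact (hY μ hμ).2.2 x (abs_lt.1 (hx.trans_le haa)) i
  set A : ℝ → ℝ → ℝ := fun lam r => 1 / B (1 / (1 + lam)) (r * (1 + lam)) with hA
  set w : ℝ → ℝ → ℝ := fun lam r =>
    1 - r ^ 2 * (1 + lam) * β (1 / (1 + lam)) (r * (1 + lam)) with hw
  have hmu : ∀ lam : ℝ, 0 ≤ lam → 1 / (1 + lam) ∈ Icc (0 : ℝ) 1 := by
    intro lam hl
    exact ⟨by positivity, by rw [div_le_one (by positivity)]; linarith⟩
  have hrx : ∀ lam : ℝ, 0 ≤ lam → ∀ r, |r| < 2 * a / (1 + lam) → |r * (1 + lam)| < 2 * a := by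
    intro lam hl r hr
    rw [lt_div_iff₀ (by positivity)] at hr
    rwa [abs_mul, abs_of_pos (by positivity : 0 < 1 + lam)]
  have hinner : ∀ lam r : ℝ, HasDerivAt (fun r : ℝ => r * (1 + lam)) (1 + lam) r := fun lam r => by
    simpa using (hasDerivAt_id r).mul_const (1 + lam)
  have hYr : ∀ lam : ℝ, 0 ≤ lam → ∀ r, |r| < 2 * a / (1 + lam) → ∀ i,
      ContDiffAt ℝ ∞ (fun r => Y (1 / (1 + lam)) (r * (1 + lam)) i) r := by
    intro lam hl r hr i
    exact ContDiffAt.comp (g := fun x => Y (1 / (1 + lam)) x i) r (hYs _ (hmu lam hl) _ (hrx lam hl r hr) i)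
      (by fun_prop)
  have hYrd : ∀ lam : ℝ, 0 ≤ lam → ∀ r, |r| < 2 * a / (1 + lam) → ∀ i,
      HasDerivAt (fun r => Y (1 / (1 + lam)) (r * (1 + lam)) i)
        (deriv (fun x => Y (1 / (1 + lam)) x i) (r * (1 + lam)) * (1 + lam)) r := by
    intro lam hl r hr i
    exact HasDerivAt.comp (h₂ := fun x => Y (1 / (1 + lam)) x i) r
      (hYd _ (hmu lam hl) _ (hrx lam hl r hr) i) (hinner lam r)
  have hdw : ∀ lam : ℝ, 0 ≤ lam → ∀ r, |r| < 2 * a / (1 + lam) →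
      HasDerivAt (w lam) (-(r * (1 + lam)) * γ (1 / (1 + lam)) (r * (1 + lam))) r := by
    intro lam hl r hr
    have h1 := (hYrd lam hl r hr 1).const_add ((1 - 1 / (1 + lam)) / 2)
    have h2 := ((((hasDerivAt_pow 2 r).mul_const (1 + lam)).mul h1).const_sub 1)
    refine h2.congr_deriv ?_
    have he := hYe _ (hmu lam hl) _ (hrx lam hl r hr) 1
    simp only [originRHS, Matrix.cons_val_one, Matrix.cons_val_zero, Nat.cast_zero, neg_zero, zero_mul,
      zero_add] at he
    simp only [hγ, hβ]
    push_cast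
    linear_combination (-r * (1 + lam)) * he
  have hddw : ∀ lam : ℝ, 0 ≤ lam → ∀ r, |r| < 2 * a / (1 + lam) →
      HasDerivAt (deriv (w lam)) (-(1 + lam) * (2 * β (1 / (1 + lam)) (r * (1 + lam)) +
        (r * (1 + lam)) ^ 2 *
          originRHS Λ (1 / (1 + lam), r * (1 + lam), Y (1 / (1 + lam)) (r * (1 + lam))) 2)) r := by
    intro lam hl r hr
    have hev : deriv (w lam) =ᶠ[𝓝 r] fun r => -(r * (1 + lam)) * γ (1 / (1 + lam)) (r * (1 + lam)) := by
      filter_upwards [continuous_abs.continuousAt.eventually_lt_const hr] with s hs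
      exact (hdw lam hl s hs).deriv
    have h1 := (hYrd lam hl r hr 1).const_add ((1 - 1 / (1 + lam)) / 2)
    have h2 := hYrd lam hl r hr 2
    have h3 := (hinner lam r).neg.mul ((h1.const_mul 2).add ((hinner lam r).mul h2))
    refine (h3.congr_of_eventuallyEq hev).congr_deriv ?_
    have he := hYe _ (hmu lam hl) _ (hrx lam hl r hr) 1
    have he2 := hYe _ (hmu lam hl) _ (hrx lam hl r hr) 2
    have he1' : originRHS Λ (1 / (1 + lam), r * (1 + lam), Y (1 / (1 + lam)) (r * (1 + lam))) 1 =
      Y (1 / (1 + lam)) (r * (1 + lam)) 2 := by simp [originRHS]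
    rw [he1'] at he
    simp only [Matrix.cons_val_one, Matrix.cons_val_zero, Matrix.cons_val, Nat.cast_zero, neg_zero,
      zero_mul, zero_add, Nat.cast_ofNat] at he he2
    simp only [hβ]
    simp only [Pi.neg_apply, Pi.mul_apply, Pi.add_apply]
    linear_combination (-2 * (1 + lam)) * he - (1 + lam) * (r * (1 + lam)) * he2
  have hBr : ∀ lam : ℝ, 0 ≤ lam → ∀ r, |r| < 2 * a / (1 + lam) →
      HasDerivAt (fun r => B (1 / (1 + lam)) (r * (1 + lam))) ((1 + lam) *
        (-Y (1 / (1 + lam)) (r * (1 + lam)) 0 + (r * (1 + lam)) *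
          originRHS Λ (1 / (1 + lam), r * (1 + lam), Y (1 / (1 + lam)) (r * (1 + lam))) 0)) r := by
    intro lam hl r hr
    have h2 := hYrd lam hl r hr 0
    refine (((hinner lam r).mul h2).const_add 1).congr_deriv ?_
    have he := hYe _ (hmu lam hl) _ (hrx lam hl r hr) 0
    simp only [Matrix.cons_val_zero, Nat.cast_ofNat] at he
    linear_combination (1 + lam) * he
  have hdA : ∀ lam : ℝ, 0 ≤ lam → ∀ r, |r| < 2 * a / (1 + lam) →
      HasDerivAt (A lam) (-((1 + lam) *
        (-Y (1 / (1 + lam)) (r * (1 + lam)) 0 + (r * (1 + lam)) *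
          originRHS Λ (1 / (1 + lam), r * (1 + lam), Y (1 / (1 + lam)) (r * (1 + lam))) 0)) /
          B (1 / (1 + lam)) (r * (1 + lam)) ^ 2) r := by
    intro lam hl r hr
    have h := (hBr lam hl r hr).inv (hBpos _ (hmu lam hl) _ (hrx lam hl r hr)).ne'
    simp only [hA, one_div]
    simp only [one_div] at h
    exact h
  have hr1 : ∀ lam : ℝ, 0 ≤ lam → |a / (1 + lam)| < 2 * a / (1 + lam) := by
    intro lam hl
    rw [abs_of_pos (by positivity)]
    gcongr
    linarith
  have hrl : ∀ lam : ℝ, 0 ≤ lam → a / (1 + lam) * (1 + lam) = a := by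
    intro lam hl
    field_simp
  have haa' : |a| < 2 * a := by rw [abs_of_pos ha]; linarith
  have hcmu : ContinuousOn (fun lam : ℝ => 1 / (1 + lam)) (Ici 0) := by
    refine continuousOn_const.div (by fun_prop) fun lam hl => ?_
    have : (0 : ℝ) ≤ lam := hl
    positivity
  have hYcl : ∀ i, ContinuousOn (fun lam : ℝ => Y (1 / (1 + lam)) a i) (Ici 0) := by
    intro i
    have h1 : ContinuousOn (fun μ => Y μ a i) (Icc 0 1) := (continuous_apply i).comp_continuousOn (hYc a)
    exact h1.comp hcmu fun lam hl => hmu lam hl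
  have hw1 : ∀ lam : ℝ, 0 ≤ lam → w lam (a / (1 + lam)) =
      1 - a ^ 2 * (1 / (1 + lam)) * β (1 / (1 + lam)) a := by
    intro lam hl
    simp only [hw, hrl lam hl]
    field_simp
  have hdw1 : ∀ lam : ℝ, 0 ≤ lam → deriv (w lam) (a / (1 + lam)) = -a * γ (1 / (1 + lam)) a := by
    intro lam hl
    rw [(hdw lam hl _ (hr1 lam hl)).deriv, hrl lam hl]
  have hz1 : ∀ lam : ℝ, 0 ≤ lam → (1 - w lam (a / (1 + lam)) ^ 2) / (a / (1 + lam)) =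
      a * β (1 / (1 + lam)) a * (2 - a ^ 2 * (1 / (1 + lam)) * β (1 / (1 + lam)) a) := by
    intro lam hl
    rw [hw1 lam hl]
    field_simp
    ring
  have hβ1 : ∀ lam : ℝ, 0 ≤ lam → |β (1 / (1 + lam)) a| ≤ 51 / 100 := by
    intro lam hl
    have h1 := abs_le.1 (hY1 _ (hmu lam hl) a haa' 1)
    have h2 := hmu lam hl
    simp only [hβ]
    rw [abs_le]; constructor <;> linarith [h1.1, h1.2, h2.1, h2.2]
  have hs : ∀ lam : ℝ, 0 ≤ lam → |a ^ 2 * (1 / (1 + lam)) * β (1 / (1 + lam)) a| ≤ 1 / 10000 := by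
    intro lam hl
    rw [abs_mul, abs_of_nonneg (mul_nonneg (sq_nonneg a) (hmu lam hl).1)]
    have h1 : a ^ 2 ≤ (1 / 100) ^ 2 := by gcongr
    calc a ^ 2 * (1 / (1 + lam)) * |β (1 / (1 + lam)) a| ≤ (1 / 100) ^ 2 * 1 * (51 / 100) := by
          gcongr
          · exact (hmu lam hl).2
          · exact hβ1 lam hl
      _ ≤ _ := by norm_num
  refine ⟨a, A, w, ha, ha1, ?_, ?_, ?_, ?_, ?_, ?_, ?_, ?_, ?_, ?_, ?_, ?_, ?_, ?_, ?_, ?_, ?_, ?_⟩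
  · intro lam hl r hr
    have h0 := hYr lam hl r hr 0
    have hne := (hBpos _ (hmu lam hl) _ (hrx lam hl r hr)).ne'
    simp only [hA, hB] at hne ⊢
    refine contDiffAt_const.div (contDiffAt_const.add (ContDiffAt.mul (by fun_prop) h0)) hne
  · intro lam hl r hr
    have h0 := hYr lam hl r hr 1
    simp only [hw, hβ]
    refine contDiffAt_const.sub (ContDiffAt.mul (by fun_prop) (contDiffAt_const.add h0))
  · intro lam hl r hr
    exact one_div_pos.2 (hBpos _ (hmu lam hl) _ (hrx lam hl r hr))
  · intro lam hl r hr
    have h1 := abs_le.1 (hY1 _ (hmu lam hl) _ (hrx lam hl r hr) 1)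
    have h2 := hmu lam hl
    have h3 : β (1 / (1 + lam)) (r * (1 + lam)) ≤ 1 := by
      simp only [hβ]; linarith [h1.2, h2.1]
    have h4 : r ^ 2 * (1 + lam) ≤ 1 / 100 := by
      have hlp : 0 < 1 + lam := by linarith
      have h5 : |r| * (1 + lam) < 2 * a := (lt_div_iff₀ hlp).1 hr
      have h6 : |r| ≤ 1 / 50 := by nlinarith [abs_nonneg r]
      rw [← sq_abs]
      nlinarith [abs_nonneg r]
    have h7 : 0 ≤ r ^ 2 * (1 + lam) := by positivity
    simp only [hw]
    nlinarith
  · intro lam hl r hr0 hr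
    have hr' : |r| < 2 * a / (1 + lam) := by rwa [abs_of_pos hr0]
    rw [(hdA lam hl r hr').deriv, (hdw lam hl r hr').deriv]
    have hBp := (hBpos _ (hmu lam hl) _ (hrx lam hl r hr')).ne'
    simp only [Phi, hA, hw, originRHS, Matrix.cons_val_zero, hγ]
    simp only [hB, hβ] at hBp ⊢
    generalize Y (1 / (1 + lam)) (r * (1 + lam)) 0 = y0 at *
    generalize Y (1 / (1 + lam)) (r * (1 + lam)) 1 = y1 at *
    generalize Y (1 / (1 + lam)) (r * (1 + lam)) 2 = y2 at *
    have hl1 : 1 + lam ≠ 0 := by positivity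
    have hr0' := hr0.ne'
    field_simp
    ring
  · intro lam hl r hr0 hr
    have hr' : |r| < 2 * a / (1 + lam) := by rwa [abs_of_pos hr0]
    rw [(hddw lam hl r hr').deriv, (hdw lam hl r hr').deriv]
    have hBp := (hBpos _ (hmu lam hl) _ (hrx lam hl r hr')).ne'
    simp only [Phi, hA, hw, originRHS, Matrix.cons_val, hγ]
    simp only [hB, hβ] at hBp ⊢
    generalize Y (1 / (1 + lam)) (r * (1 + lam)) 0 = y0 at *
    generalize Y (1 / (1 + lam)) (r * (1 + lam)) 1 = y1 at *
    generalize Y (1 / (1 + lam)) (r * (1 + lam)) 2 = y2 at *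
    have hl1 : 1 + lam ≠ 0 := by positivity
    have hr0' := hr0.ne'
    field_simp
    ring
  · intro lam hl; simp [hA, hB]
  · intro lam hl; simp [hw]
  · intro lam hl
    rw [(hdw lam hl 0 (by rw [abs_zero]; positivity)).deriv]; simp
  · intro lam hl
    rw [(hddw lam hl 0 (by rw [abs_zero]; positivity)).deriv]
    have h0 : Y (1 / (1 + lam)) 0 = 0 := by
      have := (hY _ (hmu lam hl)).2.1 0
      rw [abs_zero, mul_zero] at this
      exact norm_le_zero_iff.1 this
    have hl1 : 1 + lam ≠ 0 := by positivity
    simp only [hβ, zero_mul, h0, Pi.zero_apply]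
    field_simp
    ring
  · have : ContinuousOn (fun lam : ℝ => 1 / (1 + a * Y (1 / (1 + lam)) a 0)) (Ici 0) := by
      refine continuousOn_const.div (continuousOn_const.add (continuousOn_const.mul (hYcl 0))) ?_
      intro lam hl
      exact (hBpos _ (hmu lam hl) a haa').ne'
    exact this.congr fun lam hl => by simp only [hA, hB, hrl lam hl]
  · have : ContinuousOn (fun lam : ℝ => 1 - a ^ 2 * (1 / (1 + lam)) *
        ((1 - 1 / (1 + lam)) / 2 + Y (1 / (1 + lam)) a 1)) (Ici 0) :=
      continuousOn_const.sub ((continuousOn_const.mul hcmu).mul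
        (((continuousOn_const.sub hcmu).div_const 2).add (hYcl 1)))
    exact this.congr fun lam hl => hw1 lam hl
  · have : ContinuousOn (fun lam : ℝ => -a * (2 * ((1 - 1 / (1 + lam)) / 2 + Y (1 / (1 + lam)) a 1) +
        a * Y (1 / (1 + lam)) a 2)) (Ici 0) :=
      continuousOn_const.mul ((continuousOn_const.mul
        (((continuousOn_const.sub hcmu).div_const 2).add (hYcl 1))).add
        (continuousOn_const.mul (hYcl 2)))
    exact this.congr fun lam hl => hdw1 lam hl
  · intro lam hl
    simp only [hA, hB, hrl lam hl]
    have h1 := abs_le.1 (hxY _ (hmu lam hl) a haa' 0)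
    generalize a * Y (1 / (1 + lam)) a 0 = y at h1
    have hp : 0 < 1 + y := by linarith
    rw [abs_le]
    constructor
    · rw [neg_le_sub_iff_le_add, ← sub_le_iff_le_add, le_div_iff₀ hp]; linarith
    · rw [sub_le_iff_le_add, div_le_iff₀ hp]; linarith
  · intro lam hl
    rw [hdw1 lam hl, abs_mul, abs_neg, abs_of_pos ha]
    have h1 := abs_le.1 (hβ1 lam hl)
    have h2 := abs_le.1 (hxY _ (hmu lam hl) a haa' 2)
    have h3 : |γ (1 / (1 + lam)) a| ≤ 2 := by
      simp only [hγ]; rw [abs_le]; constructor <;> linarith [h1.1, h1.2, h2.1, h2.2]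
    calc a * |γ (1 / (1 + lam)) a| ≤ (1 / 100) * 2 := by gcongr
      _ = _ := by norm_num
  · intro lam hl
    rw [hz1 lam hl, abs_mul, abs_mul, abs_of_pos ha]
    have h1 := abs_le.1 (hs lam hl)
    have h3 : |2 - a ^ 2 * (1 / (1 + lam)) * β (1 / (1 + lam)) a| ≤ 3 := by
      rw [abs_le]; constructor <;> linarith [h1.1, h1.2]
    calc a * |β (1 / (1 + lam)) a| * |2 - a ^ 2 * (1 / (1 + lam)) * β (1 / (1 + lam)) a|
        ≤ (1 / 100) * (51 / 100) * 3 := by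
          gcongr
          exact hβ1 lam hl
      _ ≤ _ := by norm_num
  all_goals
    intro lam hl9
    have hl : 0 ≤ lam := by linarith
    have h1 := abs_le.1 (hs lam hl)
    have h2 := abs_le.1 (hY1 _ (hmu lam hl) a haa' 1)
    have h3 := abs_le.1 (hxY _ (hmu lam hl) a haa' 2)
    -- For `lam ≥ 9` the parameter `μ` is at most `1 / 10`, so `β` is close to `1 / 2`. Then `(1 -
    -- w²) / r` is about `2 a β`, and the quotient in `q_large` is close to `2`.
    have h4 : 1 / (1 + lam) ≤ 1 / 10 := by gcongr; linarith
    have h5 : 44 / 100 ≤ β (1 / (1 + lam)) a := by simp only [hβ]; linarith [h2.1]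
    have h6 := (abs_le.1 (hβ1 lam hl)).2
  · rw [hz1 lam hl]
    have h7 : (44 / 100) * (19 / 10) ≤ β (1 / (1 + lam)) a *
        (2 - a ^ 2 * (1 / (1 + lam)) * β (1 / (1 + lam)) a) := by
      gcongr
      linarith [h1.2]
    nlinarith
  · rw [hz1 lam hl, hdw1 lam hl, hw1 lam hl]
    have h8 : γ (1 / (1 + lam)) a = 2 * β (1 / (1 + lam)) a + a * Y (1 / (1 + lam)) a 2 := rfl
    rw [h8]
    generalize a * Y (1 / (1 + lam)) a 2 = y at h3
    generalize a ^ 2 * (1 / (1 + lam)) * β (1 / (1 + lam)) a = s at h1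
    generalize β (1 / (1 + lam)) a = b at h5 h6
    have hb : 0 < b := by linarith
    have hs2 : 0 < 2 - s := by linarith [h1.2]
    have hden : 0 < a * b * (2 - s) := by positivity
    have hbs : 0 < b * (1 - s) := mul_pos hb (by linarith [h1.2])
    rw [show -2 * (1 - s) * (-a * (2 * b + y)) / (a * b * (2 - s)) =
      (2 * (1 - s) * (2 * b + y)) / (b * (2 - s)) by field_simp]
    rw [mem_Icc, le_div_iff₀ (by positivity), div_le_iff₀ (by positivity)]
    have hys : |s * y| ≤ 1 / 1000 := by
      rw [abs_mul]
      calc |s| * |y| ≤ (1 / 10000) * (1 / 5000) := by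
            gcongr
            · exact abs_le.2 h1
            · exact abs_le.2 h3
        _ ≤ _ := by norm_num
    have hbs' : |b * s| ≤ 1 / 1000 := by
      rw [abs_mul, abs_of_pos hb]
      calc b * |s| ≤ (51 / 100) * (1 / 10000) := by
            gcongr
            exact abs_le.2 h1
        _ ≤ _ := by norm_num
    have := abs_le.1 hys
    have := abs_le.1 hbs'
    constructor <;> nlinarith

end EYM

/-! ### Uniqueness of the smooth solution and identification of the crash radius -/

namespace EYM

variable {Λ lam : ℝ}

theorem IsRegularSolution.of_contDiffAt {R : ℝ} {A w : ℝ → ℝ} (hR : 0 < R)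
    (hA : ∀ r ∈ Ico 0 R, ContDiffAt ℝ ∞ A r) (hw : ∀ r ∈ Ico 0 R, ContDiffAt ℝ ∞ w r)
    (hA0 : ∀ r ∈ Ico 0 R, 0 < A r)
    (hAe : ∀ r ∈ Ioo 0 R, r * deriv A r + 2 * A r * deriv w r ^ 2 = Phi Λ A w r)
    (hwe : ∀ r ∈ Ioo 0 R,
      r ^ 2 * A r * deriv (deriv w) r + r * deriv w r * Phi Λ A w r + w r * (1 - w r ^ 2) = 0)
    (h1 : A 0 = 1) (h2 : w 0 = 1) (h3 : deriv w 0 = 0) (h4 : deriv (deriv w) 0 = -lam) :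
    IsRegularSolution Λ lam R A w := by
  have hu : UniqueDiffOn ℝ (Ico 0 R) := uniqueDiffOn_Ico 0 R
  have h0 : (0 : ℝ) ∈ Ico 0 R := ⟨le_rfl, hR⟩
  refine ⟨hR, fun r hr => (hA r hr).contDiffWithinAt, fun r hr => (hw r hr).contDiffWithinAt, hA0, hAe,
    hwe, h1, h2, ?_, ?_⟩
  · rw [((hw 0 h0).differentiableAt (by simp)).derivWithin (hu 0 h0), h3]
  · rw [iteratedDerivWithin_eq_iteratedDeriv hu (contDiffAt_infty.1 (hw 0 h0) 2) h0,
      iteratedDeriv_succ, iteratedDeriv_one, h4]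

section Regular

variable {R : ℝ} {A w : ℝ → ℝ}

theorem IsRegularSolution.contDiffAt_A (h : IsRegularSolution Λ lam R A w) {r : ℝ} (hr : r ∈ Ioo 0 R) :
    ContDiffAt ℝ ∞ A r :=
  (h.smooth_A.mono Ioo_subset_Ico_self).contDiffAt (isOpen_Ioo.mem_nhds hr)

theorem IsRegularSolution.contDiffAt_w (h : IsRegularSolution Λ lam R A w) {r : ℝ} (hr : r ∈ Ioo 0 R) :
    ContDiffAt ℝ ∞ w r :=
  (h.smooth_w.mono Ioo_subset_Ico_self).contDiffAt (isOpen_Ioo.mem_nhds hr)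

theorem IsRegularSolution.hasDerivAt_A (h : IsRegularSolution Λ lam R A w) {r : ℝ} (hr : r ∈ Ioo 0 R) :
    HasDerivAt A (deriv A r) r := ((h.contDiffAt_A hr).differentiableAt (by simp)).hasDerivAt

theorem IsRegularSolution.hasDerivAt_w (h : IsRegularSolution Λ lam R A w) {r : ℝ} (hr : r ∈ Ioo 0 R) :
    HasDerivAt w (deriv w r) r := ((h.contDiffAt_w hr).differentiableAt (by simp)).hasDerivAt

theorem IsRegularSolution.hasDerivAt_dw (h : IsRegularSolution Λ lam R A w) {r : ℝ} (hr : r ∈ Ioo 0 R) :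
    HasDerivAt (deriv w) (deriv (deriv w) r) r := by
  have h1 := ((contDiffOn_infty_iff_deriv_of_isOpen isOpen_Ioo).1
    (h.smooth_w.mono Ioo_subset_Ico_self)).2
  exact ((h1.contDiffAt (isOpen_Ioo.mem_nhds hr)).differentiableAt (by simp)).hasDerivAt

/-- The Fuchsian variables at the origin. -/
noncomputable def originVars (lam : ℝ) (A w : ℝ → ℝ) (r : ℝ) : Fin 3 → ℝ :=
  ![(1 / A r - 1) / r, (1 - w r) / r ^ 2 - lam / 2,
    (-deriv w r / r - 2 * ((1 - w r) / r ^ 2)) / r]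

/-- The right-hand side of the system satisfied by `originVars`. -/
noncomputable def originSys (Λ lam : ℝ) (p : ℝ × (Fin 3 → ℝ)) : Fin 3 → ℝ :=
  let r := p.1
  let Y := p.2
  let B := 1 + r * Y 0
  let β := lam / 2 + Y 1
  let γ := 2 * β + r * Y 2
  let P := β ^ 2 * (2 - r ^ 2 * β) ^ 2 + Λ
  ![-Y 0 ^ 2 + B ^ 2 * P + 2 * B * γ ^ 2, Y 2,
    -Y 0 * Y 2 + B * (-3 * β ^ 2 + r ^ 2 * β ^ 3) + γ * B * P]

theorem contDiff_originSys (Λ lam : ℝ) : ContDiff ℝ ∞ (originSys Λ lam) := by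
  have h0 : ContDiff ℝ ∞ fun p : ℝ × (Fin 3 → ℝ) => p.2 0 := by fun_prop
  have h1 : ContDiff ℝ ∞ fun p : ℝ × (Fin 3 → ℝ) => p.2 1 := by fun_prop
  have h2 : ContDiff ℝ ∞ fun p : ℝ × (Fin 3 → ℝ) => p.2 2 := by fun_prop
  rw [contDiff_pi]
  intro i
  fin_cases i <;> simp [originSys] <;> fun_prop

/-- The exponents of the Fuchsian system at the origin. -/
def originExp : Fin 3 → ℕ := ![2, 0, 4]

theorem IsRegularSolution.hasDerivAt_originVars (h : IsRegularSolution Λ lam R A w) {r : ℝ}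
    (hr : r ∈ Ioo 0 R) (i : Fin 3) :
    HasDerivAt (fun r => originVars lam A w r i) (-(originExp i) * originVars lam A w r i / r +
      originSys Λ lam (r, originVars lam A w r) i) r := by
  have hA := h.hasDerivAt_A hr
  have hw := h.hasDerivAt_w hr
  have hdw := h.hasDerivAt_dw hr
  have hA0 : A r ≠ 0 := (h.A_pos r (Ioo_subset_Ico_self hr)).ne'
  have hr0 : r ≠ 0 := hr.1.ne'
  have hAe := h.A_eq r hr
  have hwe := h.w_eq r hr
  have hid := hasDerivAt_id r
  have eA : deriv A r = (Phi Λ A w r - 2 * A r * deriv w r ^ 2) / r := by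
    field_simp; linear_combination hAe
  have ew : deriv (deriv w) r =
      -(r * deriv w r * Phi Λ A w r + w r * (1 - w r ^ 2)) / (r ^ 2 * A r) := by
    field_simp; linear_combination hwe
  have d1 : HasDerivAt (fun r => (1 - w r) / r ^ 2)
      ((-deriv w r * r ^ 2 - (1 - w r) * (2 * r)) / (r ^ 2) ^ 2) r := by
    have := (hw.const_sub 1).div (hasDerivAt_pow 2 r) (pow_ne_zero 2 hr0)
    exact this.congr_deriv (by push_cast; ring)
  fin_cases i
  · have hd : HasDerivAt (fun r => (1 / A r - 1) / r)
        (((-deriv A r / A r ^ 2) * r - (1 / A r - 1) * 1) / r ^ 2) r := by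
      simp only [one_div]
      exact (((hA.inv hA0).sub_const 1).div hid hr0)
    refine (hd.congr_of_eventuallyEq (Eventually.of_forall fun s => ?_)).congr_deriv ?_
    · simp [originVars]
    · rw [eA]
      simp [originVars, originSys, originExp, Phi]
      field_simp
      ring
  · refine ((d1.sub_const (lam / 2)).congr_of_eventuallyEq (Eventually.of_forall fun s => ?_)).congr_deriv ?_
    · simp [originVars]
    · simp [originVars, originSys, originExp]
      field_simp
  · have hd : HasDerivAt (fun r => (-deriv w r / r - 2 * ((1 - w r) / r ^ 2)) / r)
        ((((-deriv (deriv w) r * r - -deriv w r * 1) / r ^ 2 -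
          2 * ((-deriv w r * r ^ 2 - (1 - w r) * (2 * r)) / (r ^ 2) ^ 2)) * r -
          (-deriv w r / r - 2 * ((1 - w r) / r ^ 2)) * 1) / r ^ 2) r :=
      ((hdw.neg.div hid hr0).sub (d1.const_mul 2)).div hid hr0
    refine (hd.congr_of_eventuallyEq (Eventually.of_forall fun s => ?_)).congr_deriv ?_
    · simp [originVars]
    · rw [ew]
      simp [originVars, originSys, originExp, Phi]
      field_simp
      ring

theorem abs_sub_le_of_deriv_le {F F' : ℝ → ℝ} {δ C : ℝ} (n : ℕ) (hC : 0 ≤ C)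
    (hF : ContinuousOn F (Icc 0 δ)) (hd : ∀ r ∈ Ioo 0 δ, HasDerivAt F (F' r) r)
    (hb : ∀ r ∈ Ioo 0 δ, |F' r| ≤ C * r ^ n) : ∀ r ∈ Ioo 0 δ, |F r - F 0| ≤ C * r ^ (n + 1) := by
  intro r hr
  have hsub : Icc 0 r ⊆ Icc 0 δ := Icc_subset_Icc_right hr.2.le
  obtain ⟨ξ, hξ, hξ'⟩ := exists_hasDerivAt_eq_slope F F' hr.1 (hF.mono hsub)
    (fun x hx => hd x ⟨hx.1, hx.2.trans hr.2⟩)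
  rw [sub_zero, eq_div_iff hr.1.ne'] at hξ'
  rw [← hξ', abs_mul, abs_of_pos hr.1, pow_succ, ← mul_assoc]
  have h1 := hb ξ ⟨hξ.1, hξ.2.trans hr.2⟩
  have h2 : ξ ^ n ≤ r ^ n := pow_le_pow_left₀ hξ.1.le hξ.2.le n
  have hr0 := hr.1.le
  gcongr
  exact h1.trans (by gcongr)

theorem exists_abs_sub_le {F : ℝ → ℝ} {R : ℝ} (hR : 0 < R)
    (hF : DifferentiableWithinAt ℝ F (Ico 0 R) 0) :
    ∃ δ > 0, δ < R ∧ ∃ C, 0 ≤ C ∧ ∀ r ∈ Icc 0 δ, |F r - F 0| ≤ C * r := by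
  obtain ⟨C, hC⟩ := hF.isBigO_sub.bound
  rw [nhdsWithin_Ico_eq_nhdsGE hR] at hC
  obtain ⟨δ, hδ, h⟩ := mem_nhdsGE_iff_exists_Icc_subset.1 hC
  refine ⟨min δ (R / 2), lt_min hδ (by linarith), (min_le_right _ _).trans_lt (by linarith), max C 0,
    le_max_right _ _, fun r hr => ?_⟩
  have := h ⟨hr.1, hr.2.trans (min_le_left _ _)⟩
  simp only [mem_ofPred_eq, sub_zero, Real.norm_eq_abs, abs_of_nonneg hr.1] at this
  exact this.trans (by gcongr; exacts [hr.1, le_max_left _ _])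

/-- Integrating `w'' + lam = O(r)` twice gives `w = 1 - lam r² / 2 + O(r³)`, and likewise `A = 1 +
O(r)`; this bounds the Fuchsian variables. The variable with exponent `0` gets no decay from its
equation, so its `O(r)` bound has to come from the Taylor expansion. -/
theorem IsRegularSolution.originVars_near (h : IsRegularSolution Λ lam R A w) :
    ∃ δ > 0, δ < R ∧ ∃ C, 0 ≤ C ∧ (∀ r ∈ Ioo 0 δ, ∀ i, |originVars lam A w r i| ≤ C) ∧
      ∀ r ∈ Ioo 0 δ, |originVars lam A w r 1| ≤ C * r := by
  have hR := h.R_pos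
  have hu : UniqueDiffOn ℝ (Ico 0 R) := uniqueDiffOn_Ico 0 R
  have h0 : (0 : ℝ) ∈ Ico 0 R := ⟨le_rfl, hR⟩
  set p := derivWithin w (Ico 0 R) with hp
  set q := derivWithin p (Ico 0 R) with hq
  have hps : ContDiffOn ℝ ∞ p (Ico 0 R) := ((contDiffOn_infty_iff_derivWithin hu).1 h.smooth_w).2
  have hqs : ContDiffOn ℝ ∞ q (Ico 0 R) := ((contDiffOn_infty_iff_derivWithin hu).1 hps).2
  have hq0 : q 0 = -lam := by
    have := h.ddw_zero
    rwa [iteratedDerivWithin_succ, iteratedDerivWithin_one] at this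
  have hpe : ∀ r ∈ Ioo 0 R, p r = deriv w r := fun r hr => by
    exact derivWithin_of_mem_nhds (Ico_mem_nhds hr.1 hr.2)
  have hpd : ∀ r ∈ Ioo 0 R, HasDerivAt p (q r) r := fun r hr =>
    ((hps.differentiableOn (by simp) r (Ioo_subset_Ico_self hr)).hasDerivWithinAt).hasDerivAt
      (Ico_mem_nhds hr.1 hr.2)
  have hwd : ∀ r ∈ Ioo 0 R, HasDerivAt w (p r) r := fun r hr => by
    rw [hpe r hr]; exact h.hasDerivAt_w hr
  obtain ⟨δ₁, hδ₁, hδ₁R, C₁, hC₁, hA1⟩ := exists_abs_sub_le hR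
    (h.smooth_A.differentiableOn (by simp) 0 h0)
  obtain ⟨δ₂, hδ₂, hδ₂R, C₂, hC₂, hq1⟩ := exists_abs_sub_le hR (hqs.differentiableOn (by simp) 0 h0)
  rw [hq0] at hq1
  rw [h.A_zero] at hA1
  have hs2 : Icc 0 δ₂ ⊆ Ico 0 R := fun x hx => ⟨hx.1, hx.2.trans_lt hδ₂R⟩
  have hs2' : Ioo 0 δ₂ ⊆ Ioo 0 R := fun x hx => ⟨hx.1, hx.2.trans hδ₂R⟩
  have hp2 : ∀ r ∈ Ioo 0 δ₂, |p r + lam * r| ≤ C₂ * r ^ 2 := by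
    have := abs_sub_le_of_deriv_le (F := fun r => p r + lam * r) (F' := fun r => q r + lam) 1 hC₂
      ((hps.continuousOn.mono hs2).add (by fun_prop))
      (fun r hr => (hpd r (hs2' hr)).add (by simpa using (hasDerivAt_id r).const_mul lam))
      (fun r hr => by simpa using hq1 r (Ioo_subset_Icc_self hr))
    intro r hr
    have h1 := this r hr
    rw [show p 0 = 0 from h.dw_zero] at h1
    simpa using h1
  have hw2 : ∀ r ∈ Ioo 0 δ₂, |w r - 1 + lam * r ^ 2 / 2| ≤ C₂ * r ^ 3 := by
    have := abs_sub_le_of_deriv_le (F := fun r => w r + lam * r ^ 2 / 2)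
      (F' := fun r => p r + lam * r) 2 hC₂
      ((h.smooth_w.continuousOn.mono hs2).add (by fun_prop))
      (fun r hr => (hwd r (hs2' hr)).add
        ((((hasDerivAt_pow 2 r).const_mul lam).div_const 2).congr_deriv (by push_cast; ring))) hp2
    intro r hr
    have h1 := this r hr
    rw [h.w_zero] at h1
    convert h1 using 2
    ring
  set δ := min (min δ₁ δ₂) (1 / (2 * (C₁ + 1))) with hδ
  have hδ1 : δ ≤ δ₁ := (min_le_left _ _).trans (min_le_left _ _)
  have hδ2 : δ ≤ δ₂ := (min_le_left _ _).trans (min_le_right _ _)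
  have key1 : ∀ r ∈ Ioo 0 δ, |originVars lam A w r 1| ≤ C₂ * r := by
    intro r hr
    have h1 := hw2 r ⟨hr.1, hr.2.trans_le hδ2⟩
    have hr0 := hr.1
    have : originVars lam A w r 1 = -(w r - 1 + lam * r ^ 2 / 2) / r ^ 2 := by
      simp [originVars]; field_simp; ring
    rw [this, abs_div, abs_neg, abs_of_pos (by positivity : 0 < r ^ 2), div_le_iff₀ (by positivity)]
    linarith
  refine ⟨δ, by positivity, hδ1.trans_lt hδ₁R, max (2 * C₁) (3 * C₂ + C₂ * δ), by positivity, ?_, ?_⟩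
  · intro r hr i
    have hr0 := hr.1
    have hrδ := hr.2.le
    fin_cases i
    · refine le_max_of_le_left ?_
      have h1 := hA1 r ⟨hr.1.le, hr.2.le.trans hδ1⟩
      have h2 : C₁ * r ≤ 1 / 2 := by
        have h3 : r ≤ 1 / (2 * (C₁ + 1)) := hr.2.le.trans (min_le_right _ _)
        rw [le_div_iff₀ (by positivity)] at h3
        nlinarith
      have h3 := abs_le.1 h1
      have hAp : 1 / 2 ≤ A r := by linarith
      have h4 : originVars lam A w r 0 = -(A r - 1) / (r * A r) := by
        have : A r ≠ 0 := by linarith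
        simp [originVars]; field_simp
      show |originVars lam A w r 0| ≤ _
      rw [h4, abs_div, abs_neg, abs_of_pos (by positivity : 0 < r * A r), div_le_iff₀ (by positivity)]
      have : C₁ * r * (1 / 2) ≤ C₁ * r * A r := by gcongr
      linarith
    · refine le_max_of_le_right ((key1 r hr).trans ?_)
      have : C₂ * r ≤ C₂ * δ := by gcongr
      linarith
    · refine le_max_of_le_right ?_
      have h1 := hw2 r ⟨hr.1, hr.2.trans_le hδ2⟩
      have h2 := hp2 r ⟨hr.1, hr.2.trans_le hδ2⟩
      rw [hpe r ⟨hr.1, hr.2.trans_le (hδ1.trans hδ₁R.le)⟩] at h2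
      have h4 : originVars lam A w r 2 =
          (-(deriv w r + lam * r) * r + 2 * (w r - 1 + lam * r ^ 2 / 2)) / r ^ 3 := by
        simp [originVars]; field_simp; ring
      show |originVars lam A w r 2| ≤ _
      rw [h4, abs_div, abs_of_pos (by positivity : 0 < r ^ 3), div_le_iff₀ (by positivity)]
      have h5 : |(-(deriv w r + lam * r) * r + 2 * (w r - 1 + lam * r ^ 2 / 2))| ≤
          C₂ * r ^ 2 * r + 2 * (C₂ * r ^ 3) := by
        refine (abs_add_le _ _).trans ?_
        rw [abs_mul, abs_neg, abs_of_pos hr0, abs_mul, abs_two]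
        gcongr
      have h6 : 0 ≤ C₂ * δ * r ^ 3 := by positivity
      linarith
  · intro r hr
    refine (key1 r hr).trans ?_
    have hr0 := hr.1
    gcongr
    refine le_max_of_le_right ?_
    have : 0 ≤ C₂ * δ := by positivity
    linarith

/-- A bounded solution of `r h' = -m h + r g` with bounded `g` and `m ≥ 1` is `O(r)`. -/
theorem abs_le_of_fuchs {h g : ℝ → ℝ} {R C D : ℝ} {m : ℕ} (hm : m ≠ 0)
    (hd : ∀ r ∈ Ioo 0 R, HasDerivAt h (-m * h r / r + g r) r) (hg : ∀ r ∈ Ioo 0 R, |g r| ≤ C)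
    (hb : ∀ r ∈ Ioo 0 R, |h r| ≤ D) : ∀ r ∈ Ioo 0 R, |h r| ≤ C * r := by
  intro r hr
  have hC : 0 ≤ C := (abs_nonneg _).trans (hg r hr)
  have hbd : ∀ s ∈ Ioc 0 r, |s ^ m * h s| ≤ s ^ m * D := fun s hs => by
    rw [abs_mul, abs_of_nonneg (pow_nonneg hs.1.le m)]
    exact mul_le_mul_of_nonneg_left (hb s ⟨hs.1, hs.2.trans_lt hr.2⟩) (pow_nonneg hs.1.le m)
  obtain ⟨k, rfl⟩ := Nat.exists_eq_succ_of_ne_zero hm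
  have hF : ContinuousOn (fun s => s ^ (k + 1) * h s) (Icc 0 r) := by
    intro s hs
    rcases hs.1.eq_or_lt with rfl | h0
    · have : Tendsto (fun s => s ^ (k + 1) * D) (𝓝[Icc 0 r] 0) (𝓝 0) := by
        have hc : Continuous fun s : ℝ => s ^ (k + 1) * D := by fun_prop
        simpa using (hc.tendsto 0).mono_left (nhdsWithin_le_nhds (s := Icc 0 r))
      rw [ContinuousWithinAt]
      simp only [ne_eq, Nat.add_eq_zero_iff, one_ne_zero, and_false, not_false_eq_true, zero_pow, zero_mul]
      refine squeeze_zero_norm' ?_ this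
      filter_upwards [self_mem_nhdsWithin] with s hs
      rcases hs.1.eq_or_lt with rfl | h0
      · simp
      · exact hbd s ⟨h0, hs.2⟩
    · exact ((hasDerivAt_pow _ s).mul (hd s ⟨h0, hs.2.trans_lt hr.2⟩)).continuousAt.continuousWithinAt
  have hdF : ∀ s ∈ Ioo 0 r, HasDerivAt (fun s => s ^ (k + 1) * h s) (s ^ (k + 1) * g s) s := by
    intro s hs
    refine ((hasDerivAt_pow _ s).mul (hd s ⟨hs.1, hs.2.trans hr.2⟩)).congr_deriv ?_
    have := hs.1.ne'
    simp only [Nat.add_sub_cancel, Nat.succ_eq_add_one]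
    field_simp
    push_cast
    ring
  obtain ⟨ξ, hξ, hξ'⟩ := exists_hasDerivAt_eq_slope _ _ hr.1 hF hdF
  rw [sub_zero, eq_div_iff hr.1.ne', zero_pow (by omega), zero_mul, sub_zero] at hξ'
  have h1 : |r ^ (k + 1) * h r| ≤ r ^ (k + 1) * (C * r) := by
    rw [← hξ', abs_mul, abs_mul, abs_of_pos hr.1, abs_of_pos (pow_pos hξ.1 _), ← mul_assoc]
    have hr0 := hr.1.le
    have := hg ξ ⟨hξ.1, hξ.2.trans hr.2⟩
    have h2 := pow_le_pow_left₀ hξ.1.le hξ.2.le (k + 1)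
    gcongr
  rw [abs_mul, abs_of_pos (pow_pos hr.1 _)] at h1
  exact le_of_mul_le_mul_left h1 (pow_pos hr.1 _)

theorem IsRegularSolution.originVars_bounded (h : IsRegularSolution Λ lam R A w) {R' : ℝ}
    (hR' : R' < R) : ∃ C, 0 ≤ C ∧ ∀ r ∈ Ioc 0 R', ‖originVars lam A w r‖ ≤ C := by
  obtain ⟨δ, hδ, hδR, C, hC, hb, -⟩ := h.originVars_near
  have hc : ContinuousOn (originVars lam A w) (Icc (δ / 2) R') := by
    rw [continuousOn_pi]
    intro i
    exact HasDerivAt.continuousOn fun r hr =>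
      h.hasDerivAt_originVars ⟨by linarith [hr.1], hr.2.trans_lt hR'⟩ i
  obtain ⟨C', hC'⟩ := isCompact_Icc.exists_bound_of_continuousOn hc
  refine ⟨max C C', le_max_of_le_left hC, fun r hr => ?_⟩
  rcases lt_or_ge r δ with hlt | hge
  · refine le_max_of_le_left ((pi_norm_le_iff_of_nonneg hC).2 fun i => hb r ⟨hr.1, hlt⟩ i)
  · exact le_max_of_le_right (hC' r ⟨by linarith, hr.2⟩)

/-- The smooth solution with a given parameter is unique. -/
theorem IsRegularSolution.unique (h : IsRegularSolution Λ lam R A w) {R₂ : ℝ} {A₂ w₂ : ℝ → ℝ}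
    (h₂ : IsRegularSolution Λ lam R₂ A₂ w₂) {r : ℝ} (hr0 : 0 ≤ r) (hr : r < R) (hr₂ : r < R₂) :
    A r = A₂ r ∧ w r = w₂ r := by
  rcases hr0.eq_or_lt with rfl | hr0
  · exact ⟨by rw [h.A_zero, h₂.A_zero], by rw [h.w_zero, h₂.w_zero]⟩
  obtain ⟨C₁, hC₁, hb₁⟩ := h.originVars_bounded hr
  obtain ⟨C₂, hC₂, hb₂⟩ := h₂.originVars_bounded hr₂
  set Y := originVars lam A w with hY
  set Z := originVars lam A₂ w₂ with hZ
  have hYd : ∀ s ∈ Ioc 0 r, ∀ i, HasDerivAt (fun s => Y s i)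
      (-(originExp i) * Y s i / s + originSys Λ lam (s, Y s) i) s := fun s hs i =>
    h.hasDerivAt_originVars ⟨hs.1, hs.2.trans_lt hr⟩ i
  have hZd : ∀ s ∈ Ioc 0 r, ∀ i, HasDerivAt (fun s => Z s i)
      (-(originExp i) * Z s i / s + originSys Λ lam (s, Z s) i) s := fun s hs i =>
    h₂.hasDerivAt_originVars ⟨hs.1, hs.2.trans_lt hr₂⟩ i
  set K : Set (ℝ × (Fin 3 → ℝ)) := Icc 0 r ×ˢ Metric.closedBall 0 (max C₁ C₂) with hK
  obtain ⟨L, hL⟩ := ((contDiff_originSys Λ lam).contDiffOn (s := K)).exists_lipschitzOnWith (by simp)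
    ((convex_Icc _ _).prod (convex_closedBall _ _)) (isCompact_Icc.prod (isCompact_closedBall _ _))
  have hYK : ∀ s ∈ Ioc 0 r, (s, Y s) ∈ K := fun s hs => ⟨Ioc_subset_Icc_self hs,
    mem_closedBall_zero_iff.2 ((hb₁ s hs).trans (le_max_left _ _))⟩
  have hZK : ∀ s ∈ Ioc 0 r, (s, Z s) ∈ K := fun s hs => ⟨Ioc_subset_Icc_self hs,
    mem_closedBall_zero_iff.2 ((hb₂ s hs).trans (le_max_right _ _))⟩
  have hlip : ∀ s ∈ Ioc 0 r, ∀ i, |originSys Λ lam (s, Y s) i - originSys Λ lam (s, Z s) i| ≤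
      L * ‖Y s - Z s‖ := by
    intro s hs i
    calc |originSys Λ lam (s, Y s) i - originSys Λ lam (s, Z s) i|
        ≤ dist (originSys Λ lam (s, Y s)) (originSys Λ lam (s, Z s)) := by
          rw [← Real.dist_eq]; exact dist_le_pi_dist _ _ i
      _ ≤ L * dist (s, Y s) (s, Z s) := hL.dist_le_mul _ (hYK s hs) _ (hZK s hs)
      _ = L * ‖Y s - Z s‖ := by
          rw [Prod.dist_eq, dist_self, max_eq_right dist_nonneg, dist_eq_norm]
  set d : Fin 3 → ℝ → ℝ := fun i s => Y s i - Z s i with hd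
  set g : Fin 3 → ℝ → ℝ := fun i s => originSys Λ lam (s, Y s) i - originSys Λ lam (s, Z s) i with hg
  have hdd : ∀ s ∈ Ioc 0 r, ∀ i, HasDerivAt (d i) (-(originExp i) * d i s / s + g i s) s := by
    intro s hs i
    exact ((hYd s hs i).sub (hZd s hs i)).congr_deriv (by simp only [hd, hg]; ring)
  have hnorm : ∀ s ∈ Ioc 0 r, ‖Y s - Z s‖ ≤ C₁ + C₂ := fun s hs =>
    (norm_sub_le _ _).trans (add_le_add (hb₁ s hs) (hb₂ s hs))
  have hdb : ∀ s ∈ Ioc 0 r, ∀ i, |d i s| ≤ C₁ + C₂ := fun s hs i =>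
    (norm_le_pi_norm (Y s - Z s) i).trans (hnorm s hs)
  have hgb : ∀ s ∈ Ioc 0 r, ∀ i, |g i s| ≤ L * (C₁ + C₂) := fun s hs i =>
    (hlip s hs i).trans (by gcongr; exact hnorm s hs)
  have hIoo : ∀ s ∈ Ioo 0 r, s ∈ Ioc 0 r := fun s hs => Ioo_subset_Ioc_self hs
  obtain ⟨δ₁, hδ₁, -, D₁, hD₁, -, hn₁⟩ := h.originVars_near
  obtain ⟨δ₂, hδ₂, -, D₂, hD₂, -, hn₂⟩ := h₂.originVars_near
  -- all differences are `O(r)` at the origin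
  obtain ⟨D, hD, δ, hδ, hδr, hsmall⟩ : ∃ D, 0 ≤ D ∧ ∃ δ > 0, δ < r ∧
      ∀ s ∈ Ioo 0 δ, ∀ i, |d i s| ≤ D * s := by
    refine ⟨max (L * (C₁ + C₂)) (D₁ + D₂), by positivity, min (r / 2) (min δ₁ δ₂), by positivity,
      (min_le_left _ _).trans_lt (by linarith), fun s hs i => ?_⟩
    have hs0 := hs.1.le
    have hsr : s ∈ Ioo 0 r := ⟨hs.1, hs.2.trans ((min_le_left _ _).trans_lt (by linarith))⟩
    by_cases hi : originExp i = 0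
    · have hi1 : i = 1 := by
        fin_cases i <;> simp [originExp] at hi ⊢
      subst hi1
      have e1 := hn₁ s ⟨hs.1, hs.2.trans_le ((min_le_right _ _).trans (min_le_left _ _))⟩
      have e2 := hn₂ s ⟨hs.1, hs.2.trans_le ((min_le_right _ _).trans (min_le_right _ _))⟩
      calc |d 1 s| ≤ |Y s 1| + |Z s 1| := abs_sub _ _
        _ ≤ (D₁ + D₂) * s := by linarith
        _ ≤ _ := by gcongr; exact le_max_right _ _
    · calc |d i s| ≤ L * (C₁ + C₂) * s :=
            abs_le_of_fuchs hi (fun s hs => hdd s (hIoo s hs) i) (fun s hs => hgb s (hIoo s hs) i)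
              (fun s hs => hdb s (hIoo s hs) i) s hsr
        _ ≤ _ := by gcongr; exact le_max_left _ _
  set Q : ℝ → ℝ := fun s => d 0 s ^ 2 + d 1 s ^ 2 + d 2 s ^ 2 with hQ
  have hn2 : ∀ s, ‖Y s - Z s‖ ^ 2 ≤ Q s := by
    intro s
    have hQ0 : 0 ≤ Q s := by positivity
    rw [← Real.sqrt_le_sqrt_iff hQ0, Real.sqrt_sq (norm_nonneg _),
      pi_norm_le_iff_of_nonneg (Real.sqrt_nonneg _)]
    intro i
    rw [Real.norm_eq_abs]
    refine Real.abs_le_sqrt ?_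
    have e0 := sq_nonneg (d 0 s)
    have e1 := sq_nonneg (d 1 s)
    have e2 := sq_nonneg (d 2 s)
    fin_cases i
    · show d 0 s ^ 2 ≤ d 0 s ^ 2 + d 1 s ^ 2 + d 2 s ^ 2; linarith
    · show d 1 s ^ 2 ≤ d 0 s ^ 2 + d 1 s ^ 2 + d 2 s ^ 2; linarith
    · show d 2 s ^ 2 ≤ d 0 s ^ 2 + d 1 s ^ 2 + d 2 s ^ 2; linarith
  have hQd : ∀ s ∈ Ioc 0 r, HasDerivAt Q (∑ i, 2 * d i s * (-(originExp i) * d i s / s + g i s)) s := by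
    intro s hs
    refine ((((hdd s hs 0).pow 2).add ((hdd s hs 1).pow 2)).add ((hdd s hs 2).pow 2)).congr_deriv ?_
    rw [Fin.sum_univ_three]
    norm_num
  -- The singular terms contribute `-2 m d² / s ≤ 0` and can be dropped, leaving a regular Grönwall
  -- inequality. Together with `Q(s) = O(s²)` at the origin it forces `Q = 0`.
  have hQle : ∀ s ∈ Ioc 0 r, (∑ i, 2 * d i s * (-(originExp i) * d i s / s + g i s)) ≤ 6 * L * Q s := by
    intro s hs
    have hterm : ∀ i, 2 * d i s * (-(originExp i) * d i s / s + g i s) ≤ 2 * L * Q s := by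
      intro i
      have e1 : 0 ≤ (originExp i : ℝ) * d i s ^ 2 / s := by
        have := hs.1
        positivity
      have e2 : d i s * g i s ≤ L * Q s := by
        calc d i s * g i s ≤ |d i s * g i s| := le_abs_self _
          _ = |d i s| * |g i s| := abs_mul _ _
          _ ≤ ‖Y s - Z s‖ * (L * ‖Y s - Z s‖) := by
              gcongr
              · exact norm_le_pi_norm (Y s - Z s) i
              · exact hlip s hs i
          _ = L * ‖Y s - Z s‖ ^ 2 := by ring
          _ ≤ L * Q s := by gcongr; exact hn2 s
      have e3 : 2 * d i s * (-(originExp i) * d i s / s + g i s) =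
          -2 * ((originExp i : ℝ) * d i s ^ 2 / s) + 2 * (d i s * g i s) := by ring
      rw [e3]; linarith
    calc _ ≤ ∑ i : Fin 3, 2 * L * Q s := Finset.sum_le_sum fun i _ => hterm i
      _ = 6 * L * Q s := by simp; ring
  have hQr : Q r ≤ 0 := by
    have hanti : ∀ s ∈ Ioo 0 δ, Q r * Real.exp (-(6 * L) * r) ≤ 3 * D ^ 2 * s ^ 2 := by
      intro s hs
      have hsr : s ≤ r := (hs.2.trans hδr).le
      have hm := antitoneOn_Icc_of_hasDerivAt (a := s) (b := r)
        (f := fun s => Q s * Real.exp (-(6 * L) * s))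
        (f' := fun s => (∑ i, 2 * d i s * (-(originExp i) * d i s / s + g i s) - 6 * L * Q s) *
          Real.exp (-(6 * L) * s))
        (fun t ht => by
          have he : HasDerivAt (fun t => Real.exp (-(6 * L) * t))
              (Real.exp (-(6 * L) * t) * (-(6 * L) * 1)) t :=
            ((hasDerivAt_id t).const_mul (-(6 * (L : ℝ)))).exp
          exact ((hQd t ⟨hs.1.trans_le ht.1, ht.2⟩).mul he).congr_deriv (by ring))
        (fun t ht => mul_nonpos_of_nonpos_of_nonneg
          (by linarith [hQle t ⟨hs.1.trans_le ht.1, ht.2⟩]) (Real.exp_pos _).le)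
      have h1 := hm ⟨le_rfl, hsr⟩ ⟨hsr, le_rfl⟩ hsr
      have hs0 := hs.1
      have e : ∀ i, d i s ^ 2 ≤ (D * s) ^ 2 := fun i => by
        rw [sq_le_sq, abs_of_nonneg (by positivity : 0 ≤ D * s)]
        exact hsmall s hs i
      have hQs : Q s ≤ 3 * D ^ 2 * s ^ 2 := by
        have := e 0
        have := e 1
        have := e 2
        simp only [hQ]; nlinarith
      have hexp : Real.exp (-(6 * L) * s) ≤ 1 := Real.exp_le_one_iff.2 (by
        have : 0 ≤ 6 * (L : ℝ) * s := by positivity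
        linarith)
      calc Q r * Real.exp (-(6 * L) * r) ≤ Q s * Real.exp (-(6 * L) * s) := h1
        _ ≤ Q s * 1 := mul_le_mul_of_nonneg_left hexp (by positivity)
        _ ≤ _ := by linarith
    have hlim : Tendsto (fun s : ℝ => 3 * D ^ 2 * s ^ 2) (𝓝[>] 0) (𝓝 0) := by
      have hc : Continuous fun s : ℝ => 3 * D ^ 2 * s ^ 2 := by fun_prop
      simpa using (hc.tendsto 0).mono_left (nhdsWithin_le_nhds (s := Ioi 0))
    have h2 : Q r * Real.exp (-(6 * L) * r) ≤ 0 := by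
      refine ge_of_tendsto hlim ?_
      filter_upwards [Ioo_mem_nhdsGT hδ] with s hs
      exact hanti s hs
    have := Real.exp_pos (-(6 * L) * r)
    by_contra! hcon
    have := mul_pos hcon this
    linarith
  have hd0 : d 0 r = 0 := by
    have := sq_nonneg (d 1 r); have := sq_nonneg (d 2 r); have := sq_nonneg (d 0 r)
    have : d 0 r ^ 2 = 0 := by simp only [hQ] at hQr; linarith
    exact pow_eq_zero_iff (two_ne_zero) |>.1 this
  have hd1 : d 1 r = 0 := by
    have := sq_nonneg (d 1 r); have := sq_nonneg (d 2 r); have := sq_nonneg (d 0 r)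
    have : d 1 r ^ 2 = 0 := by simp only [hQ] at hQr; linarith
    exact pow_eq_zero_iff (two_ne_zero) |>.1 this
  have hAp := h.A_pos r ⟨hr0.le, hr⟩
  have hAp₂ := h₂.A_pos r ⟨hr0.le, hr₂⟩
  simp only [hd, hY, hZ, originVars, Matrix.cons_val_zero, Matrix.cons_val_one] at hd0 hd1
  have hr0' := hr0.ne'
  constructor
  · have : 1 / A r = 1 / A₂ r := by
      field_simp at hd0 ⊢
      linarith
    simpa using this
  · field_simp at hd1
    linarith

theorem IsRegularSolution.le_crashRadius (h : IsRegularSolution Λ lam R A w) :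
    ENNReal.ofReal R ≤ crashRadius Λ lam := le_sSup ⟨R, A, w, h, rfl⟩

/-- A solution reaching beyond `R` would coincide with this one below `R`, and so its positive value
`A(R)` would be the limit `0`. -/
theorem IsRegularSolution.crashRadius_eq (h : IsRegularSolution Λ lam R A w)
    (hA : Tendsto A (𝓝[<] R) (𝓝 0)) : crashRadius Λ lam = ENNReal.ofReal R := by
  refine le_antisymm (sSup_le ?_) h.le_crashRadius
  rintro _ ⟨R', A', w', h', rfl⟩
  refine ENNReal.ofReal_le_ofReal ?_
  by_contra! hlt
  have hR' : R ∈ Ioo 0 R' := ⟨h.R_pos, hlt⟩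
  have hc : Tendsto A' (𝓝[<] R) (𝓝 (A' R)) :=
    (h'.contDiffAt_A hR').continuousAt.tendsto.mono_left nhdsWithin_le_nhds
  have he : A =ᶠ[𝓝[<] R] A' := by
    filter_upwards [Ioo_mem_nhdsLT h.R_pos] with s hs
    exact (h.unique h' hs.1.le hs.2 (hs.2.trans hlt)).1
  have := tendsto_nhds_unique (hA.congr' he) hc
  linarith [h'.A_pos R ⟨h.R_pos.le, hlt⟩]

end Regular

end EYM

/-! ### Constants attached to `Λ` -/

namespace EYM

/-- The constants of the problem: `√s₁` is the radius of the fixed point, `√s₂ > √s₁` bounds the region in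
which we control solutions, and `k` is a lower bound for `κ` there. -/
structure Consts (Λ s₁ s₂ k : ℝ) : Prop where
  nonneg : 0 ≤ Λ
  one_le : 1 ≤ s₁
  lt : s₁ < s₂
  s₂_le : s₂ ≤ 3
  s₁_eq : s₁ - Λ * s₁ ^ 2 = 1
  small : 2 * Λ * s₂ + k ^ 2 < 1
  k_pos : 0 < k
  k_le : k ≤ 1 / 2

/-- With `θ = √(1 - 4Λ)`, the smaller root of `s - Λ s² = 1` is `2 / (1 + θ)`, a form that remains
valid at `Λ = 0`. Since `2 Λ s₁ = 1 - θ`, there is a gap of size `θ` below `1`, which pays for `s₂ =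
s₁ + θ` and `k = θ / 2`. -/
theorem exists_consts {Λ : ℝ} (h0 : 0 ≤ Λ) (h1 : Λ < 1 / 4) : ∃ s₁ s₂ k, Consts Λ s₁ s₂ k := by
  set θ := √(1 - 4 * Λ) with hθ
  have hθ2 : θ ^ 2 = 1 - 4 * Λ := Real.sq_sqrt (by linarith)
  have hθ0 : 0 < θ := Real.sqrt_pos.2 (by linarith)
  have hθ1 : θ ≤ 1 := by nlinarith
  have hΛ : Λ = (1 - θ ^ 2) / 4 := by linarith
  have hs : 2 / (1 + θ) ≤ 2 := by rw [div_le_iff₀ (by linarith)]; linarith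
  refine ⟨2 / (1 + θ), 2 / (1 + θ) + θ, θ / 2, h0, ?_, by linarith, by linarith, ?_, ?_, by linarith,
    by linarith⟩
  · rw [le_div_iff₀ (by linarith)]; linarith
  · rw [hΛ]; field_simp; ring
  · have h2 : 2 * Λ * (2 / (1 + θ)) = 1 - θ := by rw [hΛ]; field_simp; ring
    have h3 : 2 * Λ * (2 / (1 + θ) + θ) = 1 - θ + 2 * Λ * θ := by rw [mul_add, h2]
    rw [h3]
    nlinarith

namespace Consts

variable {Λ s₁ s₂ k : ℝ} (C : Consts Λ s₁ s₂ k)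
include C

theorem sub_eq (s : ℝ) : s - Λ * s ^ 2 - 1 = (s - s₁) * (1 - Λ * (s + s₁)) := by
  linear_combination C.s₁_eq

/-- `2 Λ s₂ < 1` places both `s` and `s₁` below the vertex of the parabola `s - Λ s²`. Hence the
sign of `s - Λ s² - 1` on this range is that of `s - s₁`. -/
theorem factor_pos {s : ℝ} (hs : s ≤ s₂) : 0 < 1 - Λ * (s + s₁) := by
  have h1 := C.lt
  have h2 := C.small
  have h3 : Λ * (s + s₁) ≤ Λ * (s₂ + s₂) := mul_le_mul_of_nonneg_left (by linarith) C.nonneg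
  nlinarith [sq_nonneg k]

theorem lt_one {s : ℝ} (hs : s < s₁) : s - Λ * s ^ 2 < 1 := by
  have := mul_neg_of_neg_of_pos (sub_neg.2 hs) (C.factor_pos (hs.le.trans C.lt.le))
  linarith [C.sub_eq s]

theorem one_lt {s : ℝ} (hs : s₁ < s) (hs2 : s ≤ s₂) : 1 < s - Λ * s ^ 2 := by
  have := mul_pos (sub_pos.2 hs) (C.factor_pos hs2)
  linarith [C.sub_eq s]

theorem eq_of_eq_one {s : ℝ} (hs : s ≤ s₂) (h : s - Λ * s ^ 2 = 1) : s = s₁ := by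
  rcases lt_trichotomy s s₁ with h1 | h1 | h1
  · linarith [C.lt_one h1]
  · exact h1
  · linarith [C.one_lt h1 hs]

theorem pos {s : ℝ} (hs0 : 0 < s) (hs : s ≤ s₂) : 0 < s - Λ * s ^ 2 := by
  have h3 : Λ * s ≤ Λ * s₂ := mul_le_mul_of_nonneg_left hs C.nonneg
  have : 0 < 1 - Λ * s := by nlinarith [C.small, sq_nonneg k, mul_nonneg C.nonneg hs0.le]
  nlinarith

theorem mul_le {s : ℝ} (hs : s ≤ s₂) : 2 * Λ * s + k ^ 2 < 1 := by
  have h3 : Λ * s ≤ Λ * s₂ := mul_le_mul_of_nonneg_left hs C.nonneg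
  linarith [C.small]

end Consts

/-! ### The system in `τ` as a vector field -/

/-- The phase space, with coordinates `(r, N, w, U, κ)`. -/
abbrev Phase : Type := ℝ × ℝ × ℝ × ℝ × ℝ

/-- The vector field of the system in `τ`. -/
noncomputable def tauField (Λ : ℝ) (p : Phase) : Phase :=
  (p.1 * p.2.1,
    (p.2.2.2.2 - p.2.1) * p.2.1 - 2 * p.2.2.2.1 ^ 2,
    p.1 * p.2.2.2.1,
    -(p.2.2.1 * (1 - p.2.2.1 ^ 2) / p.1) - (p.2.2.2.2 - p.2.1) * p.2.2.2.1,
    1 + 2 * p.2.2.2.1 ^ 2 - p.2.2.2.2 ^ 2 - 2 * Λ * p.1 ^ 2)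

/-- The domain `r > 0` of the vector field. -/
def tauDom : Set Phase := {p | 0 < p.1}

theorem isOpen_tauDom : IsOpen tauDom := isOpen_lt continuous_const continuous_fst

theorem contDiffOn_tauField (Λ : ℝ) : ContDiffOn ℝ 1 (tauField Λ) tauDom := by
  have h : ∀ p ∈ tauDom, p.1 ≠ 0 := fun p hp => (show 0 < p.1 from hp).ne'
  unfold tauField
  refine ContDiffOn.prodMk (by fun_prop) (ContDiffOn.prodMk (by fun_prop) (ContDiffOn.prodMk (by fun_prop)
    (ContDiffOn.prodMk ?_ (by fun_prop))))
  exact ((ContDiffOn.div (by fun_prop) (by fun_prop) h).neg).sub (by fun_prop)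

/-- The defect in the constraint. -/
noncomputable def defect (Λ : ℝ) (p : Phase) : ℝ :=
  2 * p.2.1 * p.2.2.2.2 - ((1 - p.2.1 ^ 2 - (1 - p.2.2.1 ^ 2) ^ 2 / p.1 ^ 2 - Λ * p.1 ^ 2) +
    2 * p.2.2.2.1 ^ 2 + 2 * p.2.1 ^ 2)

/-- Solutions of the system in `τ` with the constraint, as curves in phase space. -/
def TauSol (Λ : ℝ) (I : Set ℝ) (x : ℝ → Phase) : Prop :=
  IsTauSolution Λ I (fun t => (x t).1) (fun t => (x t).2.1) (fun t => (x t).2.2.1)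
    (fun t => (x t).2.2.2.1) (fun t => (x t).2.2.2.2)

section Tau

variable {Λ : ℝ} {I : Set ℝ}

theorem TauSol.isSolOn {x : ℝ → Phase} (h : TauSol Λ I x) : IsSolOn (tauField Λ) tauDom x I := fun t ht =>
  ⟨(h.r_eq t ht).prodMk ((h.N_eq t ht).prodMk ((h.w_eq t ht).prodMk ((h.U_eq t ht).prodMk (h.κ_eq t ht)))),
    h.r_pos t ht⟩

theorem TauSol.mono {x : ℝ → Phase} (h : TauSol Λ I x) {J : Set ℝ} (hJ : J ⊆ I) : TauSol Λ J x :=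
  ⟨fun t ht => h.r_pos t (hJ ht), fun t ht => h.r_eq t (hJ ht), fun t ht => h.w_eq t (hJ ht),
    fun t ht => h.N_eq t (hJ ht), fun t ht => h.U_eq t (hJ ht), fun t ht => h.κ_eq t (hJ ht),
    fun t ht => h.constraint t (hJ ht)⟩

/-- The constraint propagates because `r²` times its defect is constant along the flow of the
unconstrained system. -/
theorem IsSolOn.tauSol {x : ℝ → Phase} (h : IsSolOn (tauField Λ) tauDom x I) (hI : I.OrdConnected)
    {t₀ : ℝ} (ht₀ : t₀ ∈ I) (h0 : defect Λ (x t₀) = 0) : TauSol Λ I x := by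
  have h1 : ∀ t ∈ I, HasDerivAt x (tauField Λ (x t)) t := fun t ht => (h t ht).1
  have hr : ∀ t ∈ I, HasDerivAt (fun t => (x t).1) ((x t).1 * (x t).2.1) t := fun t ht => (h1 t ht).fst
  have hN : ∀ t ∈ I, HasDerivAt (fun t => (x t).2.1) (tauField Λ (x t)).2.1 t := fun t ht =>
    (h1 t ht).snd.fst
  have hw : ∀ t ∈ I, HasDerivAt (fun t => (x t).2.2.1) (tauField Λ (x t)).2.2.1 t := fun t ht =>
    (h1 t ht).snd.snd.fst
  have hU : ∀ t ∈ I, HasDerivAt (fun t => (x t).2.2.2.1) (tauField Λ (x t)).2.2.2.1 t := fun t ht =>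
    (h1 t ht).snd.snd.snd.fst
  have hκ : ∀ t ∈ I, HasDerivAt (fun t => (x t).2.2.2.2) (tauField Λ (x t)).2.2.2.2 t := fun t ht =>
    (h1 t ht).snd.snd.snd.snd
  have hpos : ∀ t ∈ I, 0 < (x t).1 := fun t ht => (h t ht).2
  have hd : ∀ t ∈ I, HasDerivAt (fun t => defect Λ (x t) * (x t).1 ^ 2) 0 t := by
    intro t ht
    have hr0 := (hpos t ht).ne'
    have hf : HasDerivAt (fun t => (1 - (x t).2.2.1 ^ 2) ^ 2) _ t := (((hw t ht).pow 2).const_sub 1).pow 2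
    have hc := ((((hN t ht).const_mul 2).mul (hκ t ht)).sub
      (((((((hN t ht).pow 2).const_sub 1).sub (hf.div ((hr t ht).pow 2) (pow_ne_zero 2 hr0))).sub
        (((hr t ht).pow 2).const_mul Λ)).add (((hU t ht).pow 2).const_mul 2)).add
        (((hN t ht).pow 2).const_mul 2))).mul ((hr t ht).pow 2)
    refine hc.congr_deriv ?_
    simp only [tauField, Pi.mul_apply, Pi.sub_apply, Pi.add_apply, Pi.pow_apply, Pi.div_apply]
    generalize (x t).1 = r at *
    generalize (x t).2.1 = N at *
    generalize (x t).2.2.1 = w at *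
    generalize (x t).2.2.2.1 = U at *
    generalize (x t).2.2.2.2 = κ at *
    push_cast
    field_simp
    ring
  have hconst : ∀ s ∈ I, ∀ t ∈ I, s ≤ t →
      defect Λ (x s) * (x s).1 ^ 2 = defect Λ (x t) * (x t).1 ^ 2 := by
    intro s hs t ht hst
    have hsub : Icc s t ⊆ I := hI.out hs ht
    exact le_antisymm
      (monotoneOn_Icc_of_hasDerivAt (fun u hu => hd u (hsub hu)) (fun _ _ => le_rfl) ⟨le_rfl, hst⟩
        ⟨hst, le_rfl⟩ hst)
      (antitoneOn_Icc_of_hasDerivAt (fun u hu => hd u (hsub hu)) (fun _ _ => le_rfl) ⟨le_rfl, hst⟩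
        ⟨hst, le_rfl⟩ hst)
  refine ⟨hpos, hr, hw, hN, hU, hκ, fun t ht => ?_⟩
  have h5 : defect Λ (x t) * (x t).1 ^ 2 = 0 := by
    rcases le_total t₀ t with hle | hle
    · rw [← hconst t₀ ht₀ t ht hle, h0, zero_mul]
    · rw [hconst t ht t₀ ht₀ hle, h0, zero_mul]
  have h6 := (mul_eq_zero.1 h5).resolve_right (pow_ne_zero 2 (hpos t ht).ne')
  exact sub_eq_zero.1 h6

end Tau

/-! ### Consequences of the equations -/

section Estimates

variable {Λ : ℝ} {r N w U κ : ℝ → ℝ}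

theorem exists_last_zero {f : ℝ → ℝ} {a b : ℝ} (hab : a ≤ b) (hf : ContinuousOn f (Icc a b))
    (ha : f a ≤ 0) (hb : 0 < f b) : ∃ t ∈ Ico a b, f t = 0 ∧ ∀ s ∈ Ioc t b, 0 < f s := by
  obtain ⟨t, ht, ht0, h⟩ := exists_first_zero (f := fun t => -f (-t)) (a := -b) (b := -a)
    (neg_le_neg hab) ((hf.comp continuousOn_neg fun t ht =>
      ⟨by linarith [ht.2], by linarith [ht.1]⟩).neg) (by simpa using hb) (by simpa using ha)
  refine ⟨-t, ⟨by linarith [ht.2], by linarith [ht.1]⟩, neg_eq_zero.1 ht0, fun s hs => ?_⟩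
  have := h (-s) ⟨by linarith [hs.2], by linarith [hs.1]⟩
  simpa using this

variable {I : Set ℝ}

theorem IsTauSolution.f_sq (h : IsTauSolution Λ I r N w U κ) {t : ℝ} (ht : t ∈ I) :
    (1 - w t ^ 2) ^ 2 =
      r t ^ 2 * (1 + N t ^ 2 - Λ * r t ^ 2 + 2 * U t ^ 2 - 2 * N t * κ t) := by
  have hr := (h.r_pos t ht).ne'
  have := h.constraint t ht
  have h2 : (1 - w t ^ 2) ^ 2 = r t ^ 2 * ((1 - w t ^ 2) ^ 2 / r t ^ 2) := by field_simp
  rw [h2]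
  congr 1
  linarith

theorem IsTauSolution.f_sq_of_N_zero (h : IsTauSolution Λ I r N w U κ) {t : ℝ} (ht : t ∈ I)
    (hN : N t = 0) :
    (1 - w t ^ 2) ^ 2 = (r t ^ 2 - Λ * (r t ^ 2) ^ 2) + 2 * r t ^ 2 * U t ^ 2 := by
  rw [h.f_sq ht, hN]; ring

/-- `dN/dτ = -κN + 1 - Λr² - (1-w²)²/r²`. -/
theorem IsTauSolution.N_eq' (h : IsTauSolution Λ I r N w U κ) {t : ℝ} (ht : t ∈ I) :
    HasDerivAt N (-κ t * N t + (1 - Λ * r t ^ 2 - (1 - w t ^ 2) ^ 2 / r t ^ 2)) t := by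
  refine (h.N_eq t ht).congr_deriv ?_
  linear_combination (h.constraint t ht)

/-- The constraint trades `U²` for `(1 - w²)² / r²`, which is bounded a priori. In this form a large
`κ - N` visibly decreases `κ`. -/
theorem IsTauSolution.κ_eq' (h : IsTauSolution Λ I r N w U κ) {t : ℝ} (ht : t ∈ I) :
    HasDerivAt κ (-(κ t - N t) ^ 2 - Λ * r t ^ 2 + (1 - w t ^ 2) ^ 2 / r t ^ 2) t := by
  refine (h.κ_eq t ht).congr_deriv ?_
  linear_combination -(h.constraint t ht)

theorem f_sq_le_one {w : ℝ} (hw : w ^ 2 ≤ 3 / 2) : (1 - w ^ 2) ^ 2 ≤ 1 := by nlinarith [sq_nonneg w]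

theorem IsTauSolution.continuousOn_r (h : IsTauSolution Λ I r N w U κ) : ContinuousOn r I :=
  HasDerivAt.continuousOn h.r_eq
theorem IsTauSolution.continuousOn_N (h : IsTauSolution Λ I r N w U κ) : ContinuousOn N I :=
  HasDerivAt.continuousOn h.N_eq
theorem IsTauSolution.continuousOn_w (h : IsTauSolution Λ I r N w U κ) : ContinuousOn w I :=
  HasDerivAt.continuousOn h.w_eq
theorem IsTauSolution.continuousOn_κ (h : IsTauSolution Λ I r N w U κ) : ContinuousOn κ I :=
  HasDerivAt.continuousOn h.κ_eq

theorem IsTauSolution.r_monotoneOn {a b : ℝ} (h : IsTauSolution Λ (Icc a b) r N w U κ)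
    (hN : ∀ t ∈ Icc a b, 0 ≤ N t) : MonotoneOn r (Icc a b) :=
  monotoneOn_Icc_of_hasDerivAt h.r_eq fun t ht => mul_nonneg (h.r_pos t ht).le (hN t ht)

/-- Lower bound for `κ` in the region `r² ≤ s₂`. -/
theorem IsTauSolution.κ_ge {s₁ s₂ k a b : ℝ} (C : Consts Λ s₁ s₂ k)
    (h : IsTauSolution Λ (Icc a b) r N w U κ) (hκ : k ≤ κ a) (hr : ∀ t ∈ Icc a b, r t ^ 2 ≤ s₂) :
    ∀ t ∈ Icc a b, k ≤ κ t := by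
  refine ge_of_deriv_pos_of_eq h.κ_eq hκ fun t ht hκt => ?_
  have := C.mul_le (hr t (Ico_subset_Icc_self ht))
  rw [hκt]
  nlinarith [sq_nonneg (U t)]

/-- A priori bounds as long as `N ≥ 0`, `r² ≤ s₂`, `w² ≤ 3/2`. -/
theorem IsTauSolution.bounds {s₁ s₂ k T : ℝ} (C : Consts Λ s₁ s₂ k)
    (h : IsTauSolution Λ (Icc 0 T) r N w U κ) (hT : 0 ≤ T) (hκ0 : 1 / 2 ≤ κ 0) (hκ1 : κ 0 ≤ 2)
    (hN0 : N 0 ≤ 2) (hN : ∀ t ∈ Icc 0 T, 0 ≤ N t) (hr : ∀ t ∈ Icc 0 T, r t ^ 2 ≤ s₂)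
    (hw : ∀ t ∈ Icc 0 T, w t ^ 2 ≤ 3 / 2) :
    ∀ t ∈ Icc 0 T, r 0 ≤ r t ∧ k ≤ κ t ∧ N t ≤ 1 / k + 2 ∧ κ t ≤ 1 / k + 2 + (1 / r 0 + 2) ∧
      U t ^ 2 ≤ (1 / k + 2) * (1 / k + 2 + (1 / r 0 + 2)) + 1 / r 0 ^ 2 := by
  have h0 : (0 : ℝ) ∈ Icc 0 T := ⟨le_rfl, hT⟩
  have hr0 := h.r_pos 0 h0
  have hk := C.k_pos
  have hrm : ∀ t ∈ Icc 0 T, r 0 ≤ r t := fun t ht => h.r_monotoneOn hN h0 ht ht.1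
  have hκ : ∀ t ∈ Icc 0 T, k ≤ κ t := h.κ_ge C (C.k_le.trans hκ0) hr
  have hfr : ∀ t ∈ Icc 0 T, (1 - w t ^ 2) ^ 2 / r t ^ 2 ≤ 1 / r 0 ^ 2 := by
    intro t ht
    have := f_sq_le_one (hw t ht)
    have := hrm t ht
    gcongr
  -- At the level `1 / k + 2` the damping `κ N` is at least `1 + 2 k`, which beats the source term
  -- of `N'`, at most `1`.
  have hNb : ∀ t ∈ Icc 0 T, N t ≤ 1 / k + 2 := by
    refine le_of_deriv_neg_of_eq (fun t ht => h.N_eq' ht) (by have : 0 < 1 / k := by positivity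
                                                              linarith) fun t ht hNt => ?_
    have ht' := Ico_subset_Icc_self ht
    rw [hNt]
    have h1 : 0 ≤ Λ * r t ^ 2 := mul_nonneg C.nonneg (sq_nonneg _)
    have h2 : 0 ≤ (1 - w t ^ 2) ^ 2 / r t ^ 2 := by positivity
    have h3 : k * (1 / k + 2) ≤ κ t * (1 / k + 2) := by gcongr; exact hκ t ht'
    have h4 : k * (1 / k + 2) = 1 + 2 * k := by field_simp
    linarith
  -- At this level `κ - N ≥ 1 / r 0 + 2`, and its square dominates the source `(1 - w²)² / r² ≤ 1 /
  -- r 0 ^ 2`.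
  have hκb : ∀ t ∈ Icc 0 T, κ t ≤ 1 / k + 2 + (1 / r 0 + 2) := by
    refine le_of_deriv_neg_of_eq (fun t ht => h.κ_eq' ht) (by have : 0 < 1 / k := by positivity
                                                              have : 0 < 1 / r 0 := by positivity
                                                              linarith) fun t ht hκt => ?_
    have ht' := Ico_subset_Icc_self ht
    have h1 : 0 ≤ Λ * r t ^ 2 := mul_nonneg C.nonneg (sq_nonneg _)
    have h2 := hfr t ht'
    have h3 : 1 / r 0 + 2 ≤ κ t - N t := by linarith [hNb t ht']
    have h4 : 0 < 1 / r 0 := by positivity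
    have h5 : (1 / r 0 + 2) ^ 2 ≤ (κ t - N t) ^ 2 := by gcongr
    have h6 : 1 / r 0 ^ 2 = (1 / r 0) ^ 2 := by rw [one_div_pow]
    nlinarith
  intro t ht
  refine ⟨hrm t ht, hκ t ht, hNb t ht, hκb t ht, ?_⟩
  have h1 := h.constraint t ht
  have h2 := hfr t ht
  have h3 := C.mul_le (hr t ht)
  have h4 : N t * κ t ≤ (1 / k + 2) * (1 / k + 2 + (1 / r 0 + 2)) := by
    gcongr
    · exact hk.le.trans (hκ t ht)
    · exact hNb t ht
    · exact hκb t ht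
  have h5 : 0 < 1 / r 0 ^ 2 := by positivity
  nlinarith [sq_nonneg (N t), sq_nonneg k]

/-- The compact region of phase space given by the a priori bounds. -/
def box (k r₀ : ℝ) : Set Phase :=
  Icc r₀ 2 ×ˢ Icc 0 (1 / k + 2) ×ˢ Icc (-2) 2 ×ˢ
    Icc (-((1 / k + 2) * (1 / k + 2 + (1 / r₀ + 2)) + 1 / r₀ ^ 2 + 1))
      ((1 / k + 2) * (1 / k + 2 + (1 / r₀ + 2)) + 1 / r₀ ^ 2 + 1) ×ˢ
    Icc k (1 / k + 2 + (1 / r₀ + 2))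

theorem isCompact_box (k r₀ : ℝ) : IsCompact (box k r₀) :=
  isCompact_Icc.prod (isCompact_Icc.prod (isCompact_Icc.prod (isCompact_Icc.prod isCompact_Icc)))

theorem box_subset {k r₀ : ℝ} (h : 0 < r₀) : box k r₀ ⊆ tauDom := fun p hp =>
  (h.trans_le hp.1.1 : 0 < p.1)

theorem TauSol.mem_box {s₁ s₂ k T : ℝ} (C : Consts Λ s₁ s₂ k) {x : ℝ → Phase}
    (h : TauSol Λ (Icc 0 T) x) (hT : 0 ≤ T) (hκ0 : 1 / 2 ≤ (x 0).2.2.2.2) (hκ1 : (x 0).2.2.2.2 ≤ 2)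
    (hN0 : (x 0).2.1 ≤ 2) (hN : ∀ t ∈ Icc 0 T, 0 ≤ (x t).2.1) (hr : ∀ t ∈ Icc 0 T, (x t).1 ^ 2 ≤ s₂)
    (hw : ∀ t ∈ Icc 0 T, (x t).2.2.1 ^ 2 ≤ 3 / 2) : ∀ t ∈ Icc 0 T, x t ∈ box k (x 0).1 := by
  intro t ht
  obtain ⟨h1, h2, h3, h4, h5⟩ := IsTauSolution.bounds C h hT hκ0 hκ1 hN0 hN hr hw t ht
  have h6 := hr t ht
  have h7 := hw t ht
  have h8 := C.s₂_le
  refine ⟨⟨h1, by nlinarith⟩, ⟨hN t ht, h3⟩, ⟨by nlinarith, by nlinarith⟩, ⟨?_, ?_⟩, ⟨h2, h4⟩⟩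
  · nlinarith
  · nlinarith

/-- Once `N` reaches `0` away from a fixed point it becomes negative. -/
theorem IsTauSolution.N_neg_of_zero {a b : ℝ} (h : IsTauSolution Λ (Icc a b) r N w U κ)
    (hNa : N a = 0) (hne : U a ≠ 0 ∨ w a * (1 - w a ^ 2) ≠ 0) : ∀ t ∈ Ioc a b, N t < 0 := by
  intro t ht
  have hab : a ≤ b := ht.1.le.trans ht.2
  obtain ⟨M, hM⟩ := isCompact_Icc.exists_bound_of_continuousOn
    (h.continuousOn_κ.sub h.continuousOn_N)
  have hM' : ∀ s ∈ Icc a b, κ s - N s ≤ M ∧ -M ≤ κ s - N s := fun s hs =>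
    ⟨(abs_le.1 (hM s hs)).2, (abs_le.1 (hM s hs)).1⟩
  have hle : ∀ s ∈ Icc a b, N s ≤ 0 := by
    intro s hs
    by_contra! hpos
    obtain ⟨u, hu, hu0, hup⟩ := exists_last_zero hs.1
      (h.continuousOn_N.mono (Icc_subset_Icc_right hs.2)) hNa.le hpos
    have hsub : Icc u s ⊆ Icc a b := Icc_subset_Icc hu.1 hs.2
    have := eq_zero_of_deriv_le (C := M) hu.2.le (fun v hv => h.N_eq v (hsub hv)) hpos.le
      (fun v hv => by
        have h1 : 0 ≤ N v := by
          rcases hv.1.eq_or_lt with rfl | hlt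
          · exact hu0.ge
          · exact (hup v ⟨hlt, hv.2⟩).le
        nlinarith [(hM' v (hsub hv)).1, sq_nonneg (U v)]) hu0
    linarith
  refine lt_of_le_of_ne (hle t ⟨ht.1.le, ht.2⟩) fun hNt => ?_
  -- If `N` vanished again at `t`, backward Grönwall for `-N ≥ 0` would give `N = 0` on `[a, t]`.
  -- Its equation then forces `U = 0`, and the equation for `U` forces `w (1 - w²) = 0`, both
  -- carried to `a` by continuity.
  have hzero : ∀ s ∈ Icc a t, N s = 0 := by
    intro s hs
    have hsub : Icc s t ⊆ Icc a b := Icc_subset_Icc hs.1 ht.2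
    have := eq_zero_of_deriv_ge (Q := fun s => -N s) (C := M) hs.2
      (fun v hv => (h.N_eq v (hsub hv)).neg) (by have := hle s ⟨hs.1, hs.2.trans ht.2⟩; linarith)
      (fun v hv => by
        have := hle v (hsub hv)
        nlinarith [(hM' v (hsub hv)).2, sq_nonneg (U v)]) (by simp [hNt])
    simpa using this
  have hU0 : ∀ s ∈ Ioo a t, U s = 0 := by
    intro s hs
    have hev : N =ᶠ[𝓝 s] fun _ => 0 := by
      filter_upwards [isOpen_Ioo.mem_nhds hs] with v hv
      exact hzero v (Ioo_subset_Icc_self hv)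
    have h1 := (h.N_eq s ⟨hs.1.le, hs.2.le.trans ht.2⟩).unique
      ((hasDerivAt_const s (0 : ℝ)).congr_of_eventuallyEq hev)
    rw [hzero s (Ioo_subset_Icc_self hs)] at h1
    have : U s ^ 2 = 0 := by linarith
    exact pow_eq_zero_iff two_ne_zero |>.1 this
  have hw0 : ∀ s ∈ Ioo a t, w s * (1 - w s ^ 2) = 0 := by
    intro s hs
    have hs' : s ∈ Icc a b := ⟨hs.1.le, hs.2.le.trans ht.2⟩
    have hev : U =ᶠ[𝓝 s] fun _ => 0 := by
      filter_upwards [isOpen_Ioo.mem_nhds hs] with v hv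
      exact hU0 v hv
    have h1 := (h.U_eq s hs').unique ((hasDerivAt_const s (0 : ℝ)).congr_of_eventuallyEq hev)
    rw [hU0 s hs] at h1
    have hr := (h.r_pos s hs').ne'
    field_simp at h1
    linarith
  have ha : a ∈ Icc a b := ⟨le_rfl, hab⟩
  have hUa : U a = 0 := by
    refine tendsto_nhds_unique ((h.U_eq a ha).continuousAt.tendsto.mono_left
      (nhdsWithin_le_nhds (s := Ioi a))) (tendsto_const_nhds.congr' ?_)
    filter_upwards [Ioo_mem_nhdsGT ht.1] with s hs
    exact (hU0 s hs).symm
  have hwa : w a * (1 - w a ^ 2) = 0 := by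
    have hc : ContinuousAt (fun s => w s * (1 - w s ^ 2)) a := by
      have := (h.w_eq a ha).continuousAt
      fun_prop
    refine tendsto_nhds_unique (hc.tendsto.mono_left
      (nhdsWithin_le_nhds (s := Ioi a))) (tendsto_const_nhds.congr' ?_)
    filter_upwards [Ioo_mem_nhdsGT ht.1] with s hs
    exact (hw0 s hs).symm
  rcases hne with h1 | h1
  · exact h1 hUa
  · exact h1 hwa

/-- The set `N = U = w = 0` is invariant. -/
theorem IsTauSolution.N_zero_of_fixed {a b : ℝ} (hab : a ≤ b)
    (h : IsTauSolution Λ (Icc a b) r N w U κ) (hN : N b = 0) (hU : U b = 0) (hw : w b = 0) :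
    N a = 0 := by
  obtain ⟨M₁, h₁⟩ := isCompact_Icc.exists_bound_of_continuousOn (h.continuousOn_κ.sub h.continuousOn_N)
  obtain ⟨M₂, h₂⟩ := isCompact_Icc.exists_bound_of_continuousOn h.continuousOn_N
  obtain ⟨M₃, h₃⟩ := isCompact_Icc.exists_bound_of_continuousOn (f := fun t =>
    r t - (1 - w t ^ 2) / r t) (s := Icc a b) (by
      have := h.continuousOn_r
      have := h.continuousOn_w
      exact this.pow 2 |> fun hw2 => h.continuousOn_r.sub ((continuousOn_const.sub hw2).div
        h.continuousOn_r fun t ht => (h.r_pos t ht).ne'))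
  -- Every term of the derivative is quadratic in `(N, w, U)` with bounded coefficients, so backward
  -- Grönwall applies to the squared distance from the invariant set.
  have hQ : ∀ t ∈ Icc a b, HasDerivAt (fun t => N t ^ 2 + w t ^ 2 + U t ^ 2)
      (2 * (κ t - N t) * (N t ^ 2 - U t ^ 2) - 4 * N t * U t ^ 2 +
        2 * (r t - (1 - w t ^ 2) / r t) * (w t * U t)) t := by
    intro t ht
    refine ((((h.N_eq t ht).pow 2).add ((h.w_eq t ht).pow 2)).add ((h.U_eq t ht).pow 2)).congr_deriv ?_
    have := (h.r_pos t ht).ne'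
    push_cast
    field_simp
    ring
  have := eq_zero_of_deriv_ge (C := 2 * M₁ + 4 * M₂ + M₃) hab hQ (by positivity) (fun t ht => by
    have e1 : -M₁ ≤ κ t - N t ∧ κ t - N t ≤ M₁ := abs_le.1 (h₁ t ht)
    have e2 := abs_le.1 (h₂ t ht)
    have e3 := abs_le.1 (h₃ t ht)
    have f1 : -(M₁ * (N t ^ 2 + U t ^ 2)) ≤ (κ t - N t) * (N t ^ 2 - U t ^ 2) := by
      nlinarith [sq_nonneg (N t), sq_nonneg (U t)]
    have f2 : N t * U t ^ 2 ≤ M₂ * U t ^ 2 := mul_le_mul_of_nonneg_right e2.2 (sq_nonneg _)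
    have f3 : -(M₃ * (w t ^ 2 + U t ^ 2)) ≤ 2 * (r t - (1 - w t ^ 2) / r t) * (w t * U t) := by
      nlinarith [sq_nonneg (w t + U t), sq_nonneg (w t - U t)]
    have g1 : 0 ≤ M₁ * w t ^ 2 := mul_nonneg (by linarith) (sq_nonneg _)
    have g2 : 0 ≤ M₂ * (N t ^ 2 + w t ^ 2) := mul_nonneg (by linarith) (by positivity)
    have g3 : 0 ≤ M₃ * N t ^ 2 := mul_nonneg (by linarith) (sq_nonneg _)
    nlinarith) (by simp [hN, hU, hw])
  have h1 := sq_nonneg (N a)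
  have h2 := sq_nonneg (w a)
  have h3 := sq_nonneg (U a)
  have h4 : N a ^ 2 = 0 := by linarith
  exact pow_eq_zero_iff two_ne_zero |>.1 h4

end Estimates

end EYM

namespace EYM

variable {Λ : ℝ}

/-- Otherwise consider the minimum of `w` up to this radius. An interior minimum with `0 < w < 1`
has `w'' < 0` by the equation, hence is also a local maximum, so `w` would be locally constant with
`w'' = 0`. A minimum equal to `1` makes `w = 1` to the right of the center, contradicting `w''(0) =
-lam < 0`. The argument covers every `lam > 0`, also where no quantitative lower bound on `1 - w²`
is at hand. -/
theorem LocalFamily.w_lt_one {a : ℝ} {A w : ℝ → ℝ → ℝ} (F : LocalFamily Λ a A w) {lam : ℝ}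
    (hlam : 0 < lam) : w lam (a / (1 + lam)) < 1 := by
  have ha := F.a_pos
  have hR : 0 < a / (1 + lam) := by positivity
  have hRR : a / (1 + lam) < 2 * a / (1 + lam) := by gcongr; linarith
  have hsm := F.smooth_w lam hlam.le
  have hcont : ContinuousOn (w lam) (Icc 0 (a / (1 + lam))) := fun r hr =>
    (hsm r (by rw [abs_of_nonneg hr.1]; exact hr.2.trans_lt hRR)).continuousAt.continuousWithinAt
  obtain ⟨m, hm, hmin⟩ := isCompact_Icc.exists_isMinOn ⟨0, le_rfl, hR.le⟩ hcont
  by_contra! hge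
  have hmin' : ∀ r ∈ Icc 0 (a / (1 + lam)), w lam m ≤ w lam r := hmin
  have h0 : (0 : ℝ) ∈ Icc 0 (a / (1 + lam)) := ⟨le_rfl, hR.le⟩
  have hm1 : w lam m ≤ 1 := by rw [← F.w_zero lam hlam.le]; exact hmin' 0 h0
  rcases hm1.lt_or_eq with hlt | heq
  · have hm0 : m ≠ 0 := fun h => by rw [h, F.w_zero lam hlam.le] at hlt; exact lt_irrefl _ hlt
    have hmR : m ≠ a / (1 + lam) := fun h => by rw [h] at hlt; linarith
    have hmI : m ∈ Ioo 0 (a / (1 + lam)) :=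
      ⟨lt_of_le_of_ne hm.1 (Ne.symm hm0), lt_of_le_of_ne hm.2 hmR⟩
    have habs : |m| < 2 * a / (1 + lam) := by rw [abs_of_pos hmI.1]; exact hmI.2.trans hRR
    have hloc : IsLocalMin (w lam) m := hmin.isLocalMin (Icc_mem_nhds hmI.1 hmI.2)
    have hd := hloc.deriv_eq_zero
    have heq := F.w_eq lam hlam.le m hmI.1 (hmI.2.trans hRR)
    have hA := F.A_pos lam hlam.le m habs
    have hw := F.w_pos lam hlam.le m habs
    have hm2 : 0 < m ^ 2 := by have := hmI.1; positivity
    have hneg : deriv (deriv (w lam)) m < 0 := by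
      by_contra! hnn
      rw [hd] at heq
      have h1 : 0 < w lam m * (1 - w lam m ^ 2) := mul_pos hw (by nlinarith)
      have h2 : 0 ≤ m ^ 2 * A lam m * deriv (deriv (w lam)) m := by positivity
      linarith
    have hmax := isLocalMax_of_deriv_deriv_neg hneg hd (hsm m habs).continuousAt
    have hev : w lam =ᶠ[𝓝 m] fun _ => w lam m := by
      filter_upwards [hloc, hmax] with t h1 h2
      exact le_antisymm h2 h1
    have := hev.deriv.deriv_eq
    simp at this
    linarith
  · have hmax := isLocalMax_of_deriv_deriv_neg (f := w lam) (x₀ := 0)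
      (by rw [F.ddw_zero lam hlam.le]; linarith) (F.dw_zero lam hlam.le)
      (hsm 0 (by rw [abs_zero]; positivity)).continuousAt
    have hev : ∀ᶠ t in 𝓝[>] (0 : ℝ), w lam t = 1 := by
      filter_upwards [nhdsWithin_le_nhds hmax, Ioo_mem_nhdsGT hR] with t h1 h2
      refine le_antisymm (h1.trans (F.w_zero lam hlam.le).le) ?_
      rw [← heq]; exact hmin' t (Ioo_subset_Icc_self h2)
    obtain ⟨ε, hε, hsub⟩ := mem_nhdsGT_iff_exists_Ioo_subset.1 hev
    have hdd : ContinuousAt (deriv (deriv (w lam))) 0 := by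
      have h1 : ContDiffOn ℝ ∞ (w lam) (Ioo (-(2 * a / (1 + lam))) (2 * a / (1 + lam))) := fun r hr =>
        (hsm r (abs_lt.2 hr)).contDiffWithinAt
      have h2 := ((contDiffOn_infty_iff_deriv_of_isOpen isOpen_Ioo).1
        ((contDiffOn_infty_iff_deriv_of_isOpen isOpen_Ioo).1 h1).2).2
      have h3 : 0 < 2 * a / (1 + lam) := by positivity
      exact h2.continuousOn.continuousAt (Ioo_mem_nhds (neg_lt_zero.2 h3) h3)
    have hz : ∀ t ∈ Ioo 0 ε, deriv (deriv (w lam)) t = 0 := by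
      intro t ht
      have : w lam =ᶠ[𝓝 t] fun _ => 1 := by
        filter_upwards [isOpen_Ioo.mem_nhds ht] with s hs using hsub hs
      rw [this.deriv.deriv_eq]; simp
    have := tendsto_nhds_unique (hdd.tendsto.mono_left (nhdsWithin_le_nhds (s := Ioi 0)))
      (tendsto_const_nhds.congr' (by filter_upwards [Ioo_mem_nhdsGT hε] with t ht
                                     exact (hz t ht).symm))
    rw [F.ddw_zero lam hlam.le] at this
    linarith

/-! ### Solutions with `N > 0` for all time -/

/-- Initial data from which the a priori estimates start. -/
structure Admissible (Λ s₁ : ℝ) (p : Phase) : Prop where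
  r_pos : 0 < p.1
  r_lt : p.1 ^ 2 < s₁
  N_pos : 0 < p.2.1
  N_le : p.2.1 ≤ 2
  κ_ge : 1 / 2 ≤ p.2.2.2.2
  κ_le : p.2.2.2.2 ≤ 2
  defect_eq : defect Λ p = 0

/-- The radius is increasing and bounded, so it converges. Barbalat's lemma, applied to `r`, `N` and
`U` in turn, gives `N → 0`, `U → 0` and `w (1 - w²) → 0`. By the constraint `(1 - w²)²` tends to `R²
- Λ R⁴`; this is positive, which excludes `w² → 1` and leaves `w → 0`. The limit must then be `1`,
that is, `R² = s₁`. -/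
theorem TauSol.tendsto_fixed {s₁ s₂ k : ℝ} (C : Consts Λ s₁ s₂ k) {x : ℝ → Phase}
    (h : TauSol Λ (Ici 0) x) (h0 : Admissible Λ s₁ (x 0)) (hN : ∀ t, 0 ≤ t → 0 < (x t).2.1)
    (hr : ∀ t, 0 ≤ t → (x t).1 ^ 2 ≤ s₂) (hw : ∀ t, 0 ≤ t → (x t).2.2.1 ^ 2 ≤ 3 / 2) :
    Tendsto (fun t => (x t).1) atTop (𝓝 √s₁) ∧ Tendsto (fun t => (x t).2.1) atTop (𝓝 0) ∧
      Tendsto (fun t => (x t).2.2.1) atTop (𝓝 0) ∧ Tendsto (fun t => (x t).2.2.2.1) atTop (𝓝 0) ∧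
      (∀ t, 0 ≤ t → k ≤ (x t).2.2.2.2) := by
  have hbox : ∀ t, 0 ≤ t → x t ∈ box k (x 0).1 := fun t ht =>
    (h.mono Icc_subset_Ici_self).mem_box C ht h0.κ_ge h0.κ_le h0.N_le (fun s hs => (hN s hs.1).le)
      (fun s hs => hr s hs.1) (fun s hs => hw s hs.1) t ⟨ht, le_rfl⟩
  have hbar := fun (ℓ : Phase →L[ℝ] ℝ) (l : ℝ) (hl : Tendsto (fun t => ℓ (x t)) atTop (𝓝 l)) =>
    h.isSolOn.tendsto_deriv_zero isOpen_tauDom (contDiffOn_tauField Λ) (isCompact_box k (x 0).1)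
      (box_subset h0.r_pos) hbox ℓ hl
  have hrpos : ∀ t, 0 ≤ t → 0 < (x t).1 := fun t ht => h.r_pos t ht
  have hmono : ∀ s t, 0 ≤ s → s ≤ t → (x s).1 ≤ (x t).1 := fun s t hs hst =>
    IsTauSolution.r_monotoneOn (h.mono (J := Icc s t) fun u hu => hs.trans hu.1)
      (fun u hu => (hN u (hs.trans hu.1)).le) ⟨le_rfl, hst⟩ ⟨hst, le_rfl⟩ hst
  have hr2 : ∀ t, 0 ≤ t → (x t).1 ≤ 2 := fun t ht => (hbox t ht).1.2
  obtain ⟨R, hR⟩ : ∃ R, Tendsto (fun t => (x t).1) atTop (𝓝 R) := by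
    have hm : Monotone fun t => (x (max t 0)).1 := fun s t hst =>
      hmono _ _ (le_max_right _ _) (max_le_max_right 0 hst)
    refine ⟨_, (tendsto_atTop_ciSup hm ⟨2, ?_⟩).congr' ?_⟩
    · rintro _ ⟨t, rfl⟩; exact hr2 _ (le_max_right _ _)
    · filter_upwards [eventually_ge_atTop 0] with t ht
      rw [max_eq_left ht]
  have hR0 : (x 0).1 ≤ R := ge_of_tendsto hR (by
    filter_upwards [eventually_ge_atTop 0] with t ht using hmono 0 t le_rfl ht)
  have hRpos := h0.r_pos.trans_le hR0
  have hRs : R ^ 2 ≤ s₂ := le_of_tendsto (hR.pow 2) (by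
    filter_upwards [eventually_ge_atTop 0] with t ht using hr t ht)
  have hNlim : Tendsto (fun t => (x t).2.1) atTop (𝓝 0) := by
    have h1 := hbar (ContinuousLinearMap.fst ℝ _ _) R hR
    have h2 : Tendsto (fun t => (x t).1 * (x t).2.1) atTop (𝓝 0) := h1
    have h3 := h2.div hR hRpos.ne'
    rw [zero_div] at h3
    refine h3.congr' ?_
    filter_upwards [eventually_ge_atTop 0] with t ht
    simp only [Pi.div_apply]
    rw [mul_div_cancel_left₀ _ (hrpos t ht).ne']
  have hκb : ∃ M, ∀ᶠ t in atTop, |(x t).2.2.2.2| ≤ M :=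
    ⟨_, by filter_upwards [eventually_ge_atTop 0] with t ht
           rw [abs_of_pos (C.k_pos.trans_le (hbox t ht).2.2.2.2.1)]
           exact (hbox t ht).2.2.2.2.2⟩
  obtain ⟨M, hM⟩ := hκb
  have hκN : Tendsto (fun t => (x t).2.2.2.2 * (x t).2.1) atTop (𝓝 0) := by
    refine bdd_le_mul_tendsto_zero' M hM hNlim
  have hUlim : Tendsto (fun t => (x t).2.2.2.1) atTop (𝓝 0) := by
    have h1 : Tendsto (fun t => ((x t).2.2.2.2 - (x t).2.1) * (x t).2.1 - 2 * (x t).2.2.2.1 ^ 2)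
        atTop (𝓝 0) :=
      hbar ((ContinuousLinearMap.fst ℝ _ _).comp (ContinuousLinearMap.snd ℝ _ _)) 0 hNlim
    have h2 : Tendsto (fun t => (x t).2.2.2.1 ^ 2) atTop (𝓝 0) := by
      have := ((hκN.sub (hNlim.pow 2)).sub h1).div_const 2
      simp only [ne_eq, OfNat.ofNat_ne_zero, not_false_eq_true, zero_pow, sub_zero, zero_div] at this
      refine this.congr fun t => ?_
      ring
    have h3 := h2.sqrt
    rw [Real.sqrt_zero] at h3
    exact (tendsto_zero_iff_abs_tendsto_zero _).2 (h3.congr fun t => Real.sqrt_sq_eq_abs _)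
  have hf2 : Tendsto (fun t => (1 - (x t).2.2.1 ^ 2) ^ 2) atTop (𝓝 (R ^ 2 - Λ * (R ^ 2) ^ 2)) := by
    have h1 := (hR.pow 2).mul (((((hNlim.pow 2).const_add 1).sub ((hR.pow 2).const_mul Λ)).add
      ((hUlim.pow 2).const_mul 2)).sub (hκN.const_mul 2))
    have h2 : R ^ 2 - Λ * (R ^ 2) ^ 2 = R ^ 2 * (1 + 0 ^ 2 - Λ * R ^ 2 + 2 * 0 ^ 2 - 2 * 0) := by ring
    rw [h2]
    refine h1.congr' ?_
    filter_upwards [eventually_ge_atTop 0] with t ht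
    rw [IsTauSolution.f_sq h (mem_Ici.2 ht)]
    ring
  have hLpos : 0 < R ^ 2 - Λ * (R ^ 2) ^ 2 := C.pos (by positivity) hRs
  have hwf : Tendsto (fun t => (x t).2.2.1 * (1 - (x t).2.2.1 ^ 2)) atTop (𝓝 0) := by
    have h1 : Tendsto (fun t => -((x t).2.2.1 * (1 - (x t).2.2.1 ^ 2) / (x t).1) -
        ((x t).2.2.2.2 - (x t).2.1) * (x t).2.2.2.1) atTop (𝓝 0) :=
      hbar ((ContinuousLinearMap.fst ℝ _ _).comp ((ContinuousLinearMap.snd ℝ _ _).comp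
        ((ContinuousLinearMap.snd ℝ _ _).comp (ContinuousLinearMap.snd ℝ _ _)))) 0 hUlim
    have h2 : Tendsto (fun t => (x t).2.2.2.2 * (x t).2.2.2.1) atTop (𝓝 0) :=
      bdd_le_mul_tendsto_zero' M hM hUlim
    have h3 := ((h1.add (h2.sub (hNlim.mul hUlim))).mul hR).neg
    rw [show -((0 + (0 - 0 * 0)) * R) = 0 by ring] at h3
    refine h3.congr' ?_
    filter_upwards [eventually_ge_atTop 0] with t ht
    have := (hrpos t ht).ne'
    field_simp
    ring
  have hw2 : Tendsto (fun t => (x t).2.2.1 ^ 2) atTop (𝓝 0) := by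
    have h1 := (hwf.pow 2).div hf2 hLpos.ne'
    rw [show (0 : ℝ) ^ 2 / (R ^ 2 - Λ * (R ^ 2) ^ 2) = 0 by simp] at h1
    refine h1.congr' ?_
    filter_upwards [hf2.eventually (lt_mem_nhds hLpos)] with t ht
    simp only [Pi.div_apply]
    rw [mul_pow, mul_div_cancel_right₀ _ ht.ne']
  have hwlim : Tendsto (fun t => (x t).2.2.1) atTop (𝓝 0) := by
    have h3 := hw2.sqrt
    rw [Real.sqrt_zero] at h3
    exact (tendsto_zero_iff_abs_tendsto_zero _).2 (h3.congr fun t => Real.sqrt_sq_eq_abs _)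
  have hR1 : R ^ 2 = s₁ := by
    refine C.eq_of_eq_one hRs (tendsto_nhds_unique hf2 ?_)
    simpa using (hw2.const_sub 1).pow 2
  have : R = √s₁ := by rw [← hR1, Real.sqrt_sq hRpos.le]
  rw [this] at hR
  exact ⟨hR, hNlim, hwlim, hUlim, fun t ht => (hbox t ht).2.2.2.2.1⟩

/-- Once `U² ≤ 1 / 100`, `κ` decreases at rate at least `1 / 10` whenever `κ ≥ 11 / 10`; it must
fall below this level and cannot return. The bound keeps the damping of `w` subcritical, so that `w`
oscillates. -/
theorem TauSol.eventually_κ_le {x : ℝ → Phase} (hΛ : 0 ≤ Λ) (h : TauSol Λ (Ici 0) x)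
    (hU : Tendsto (fun t => (x t).2.2.2.1) atTop (𝓝 0)) :
    ∀ᶠ t in atTop, (x t).2.2.2.2 ≤ 11 / 10 := by
  have h1 : ∀ᶠ t in atTop, |(x t).2.2.2.1| < 1 / 10 := by
    have := hU.abs
    rw [abs_zero] at this
    exact this.eventually (gt_mem_nhds (by norm_num))
  obtain ⟨T, hT⟩ := eventually_atTop.1 (h1.and (eventually_ge_atTop 0))
  have hT0 : 0 ≤ T := (hT T le_rfl).2
  have hd : ∀ t, T ≤ t → 11 / 10 ≤ (x t).2.2.2.2 →
      1 + 2 * (x t).2.2.2.1 ^ 2 - (x t).2.2.2.2 ^ 2 - 2 * Λ * (x t).1 ^ 2 ≤ -(1 / 10) := by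
    intro t ht hk
    have h2 := (hT t ht).1
    have h3 : (x t).2.2.2.1 ^ 2 ≤ (1 / 10) ^ 2 := by rw [← sq_abs]; gcongr
    have h4 : 0 ≤ Λ * (x t).1 ^ 2 := mul_nonneg hΛ (sq_nonneg _)
    nlinarith
  have hex : ∃ t, T ≤ t ∧ (x t).2.2.2.2 ≤ 11 / 10 := by
    by_contra! hcon
    set b := T + 10 * |(x T).2.2.2.2| with hb
    have hTb : T ≤ b := by have := abs_nonneg (x T).2.2.2.2; linarith
    have hanti : AntitoneOn (fun t => (x t).2.2.2.2 + t / 10) (Icc T b) :=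
      antitoneOn_Icc_of_hasDerivAt (fun t ht => (h.κ_eq t (hT0.trans ht.1)).add
        ((hasDerivAt_id t).div_const 10)) fun t ht => by
          have := hd t ht.1 (hcon t ht.1).le
          linarith
    have h2 := hanti ⟨le_rfl, hTb⟩ ⟨hTb, le_rfl⟩ hTb
    have h3 := hcon b hTb
    have h4 := le_abs_self (x T).2.2.2.2
    simp only at h2
    linarith
  obtain ⟨t₀, ht₀, hk⟩ := hex
  filter_upwards [eventually_ge_atTop t₀] with t ht
  exact le_of_deriv_neg_of_eq (fun s hs => h.κ_eq s (hT0.trans (ht₀.trans hs.1))) hk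
    (fun s hs hs' => by
      have := hd s (ht₀.trans hs.1) hs'.ge
      linarith) t ⟨ht, le_rfl⟩

/-- Solutions tending to the fixed point oscillate. -/
theorem TauSol.exists_zero_of_tendsto {s₁ k : ℝ} (hΛ : 0 ≤ Λ) (hk : 0 < k) {x : ℝ → Phase}
    (h : TauSol Λ (Ici 0) x)
    (hlim : Tendsto (fun t => (x t).1) atTop (𝓝 √s₁) ∧ Tendsto (fun t => (x t).2.1) atTop (𝓝 0) ∧
      Tendsto (fun t => (x t).2.2.1) atTop (𝓝 0) ∧ Tendsto (fun t => (x t).2.2.2.1) atTop (𝓝 0) ∧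
      (∀ t, 0 ≤ t → k ≤ (x t).2.2.2.2)) (T : ℝ) : ∃ t, T ≤ t ∧ (x t).2.2.1 = 0 := by
  obtain ⟨hr, hN, hw, hU, hκ⟩ := hlim
  have hcd : ∀ᶠ t in atTop, 0 ≤ t ∧ T ≤ t ∧ |(x t).2.2.2.2 - 2 * (x t).2.1| ≤ 12 / 10 ∧
      (x t).2.2.1 ^ 2 ≤ 5 / 100 := by
    have h1 : ∀ᶠ t in atTop, |(x t).2.1| < 1 / 20 := by
      have := hN.abs
      rw [abs_zero] at this
      exact this.eventually (gt_mem_nhds (by norm_num))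
    have h2 : ∀ᶠ t in atTop, (x t).2.2.1 ^ 2 < 5 / 100 := by
      have := hw.pow 2
      rw [zero_pow two_ne_zero] at this
      exact this.eventually (gt_mem_nhds (by norm_num))
    filter_upwards [h1, h2, h.eventually_κ_le hΛ hU, eventually_ge_atTop 0, eventually_ge_atTop T]
      with t a1 a2 a3 a4 a5
    refine ⟨a4, a5, ?_, a2.le⟩
    have := abs_lt.1 a1
    have := hκ t a4
    rw [abs_le]
    constructor <;> linarith
  obtain ⟨T₁, hT₁⟩ := eventually_atTop.1 hcd
  by_contra! hne
  -- The quotient `p = r U / w` satisfies a Riccati equation `p' = -((1 - w²) + c p + p²)` with `c =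
  -- κ - 2 N`. For `|c| ≤ 6 / 5` and `w² ≤ 1 / 20` the right side is at most `-(35 / 100) (1 + p²)`.
  -- Hence `arctan p` loses `3.5 > π` over a time `10`, which is impossible unless `w` vanishes.
  have hder : ∀ t ∈ Icc T₁ (T₁ + 10), HasDerivAt
      (fun t => Real.arctan ((x t).1 * (x t).2.2.2.1 / (x t).2.2.1))
      (-((1 - (x t).2.2.1 ^ 2) + ((x t).2.2.2.2 - 2 * (x t).2.1) *
        ((x t).1 * (x t).2.2.2.1 / (x t).2.2.1) + ((x t).1 * (x t).2.2.2.1 / (x t).2.2.1) ^ 2) /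
        (1 + ((x t).1 * (x t).2.2.2.1 / (x t).2.2.1) ^ 2)) t := by
    intro t ht
    have ht0 := (hT₁ t ht.1).1
    have hwne := hne t (hT₁ t ht.1).2.1
    have hrne := (h.r_pos t ht0).ne'
    have := ((((h.r_eq t ht0).mul (h.U_eq t ht0)).div (h.w_eq t ht0) hwne)).arctan
    refine this.congr_deriv ?_
    simp only [Pi.mul_apply, Pi.div_apply]
    rw [one_div, ← div_eq_inv_mul]
    congr 1
    field_simp
    ring
  have hanti : AntitoneOn (fun t => Real.arctan ((x t).1 * (x t).2.2.2.1 / (x t).2.2.1) +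
      (35 / 100) * t) (Icc T₁ (T₁ + 10)) := by
    refine antitoneOn_Icc_of_hasDerivAt (fun t ht => (hder t ht).add
      ((hasDerivAt_id t).const_mul (35 / 100))) fun t ht => ?_
    obtain ⟨-, -, h1, h2⟩ := hT₁ t ht.1
    generalize (x t).1 * (x t).2.2.2.1 / (x t).2.2.1 = p
    generalize (x t).2.2.2.2 - 2 * (x t).2.1 = c at h1
    generalize (x t).2.2.1 ^ 2 = e at h2
    have h3 := abs_le.1 h1
    have hp : 0 < 1 + p ^ 2 := by positivity
    rw [mul_one, neg_div, neg_add_nonpos_iff, le_div_iff₀ hp]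
    nlinarith [sq_nonneg (p + 1), sq_nonneg (p - 1), sq_nonneg p]
  have h1 := hanti ⟨le_rfl, by linarith⟩ ⟨by linarith, le_rfl⟩ (by linarith : T₁ ≤ T₁ + 10)
  simp only at h1
  have h2 := Real.arctan_lt_pi_div_two ((x T₁).1 * (x T₁).2.2.2.1 / (x T₁).2.2.1)
  have h3 := Real.neg_pi_div_two_lt_arctan
    ((x (T₁ + 10)).1 * (x (T₁ + 10)).2.2.2.1 / (x (T₁ + 10)).2.2.1)
  have h4 := Real.pi_lt_d2
  linarith

end EYM

/-! ### The alternative between crash, escape and global existence -/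

namespace EYM

variable {Λ : ℝ}

/-- The solution through `p` reaches `N < 0` while `r² < s₁` and `w² < 1`. -/
def Crash (Λ s₁ : ℝ) (p : Phase) : Prop :=
  ∃ (T : ℝ) (x : ℝ → Phase), 0 ≤ T ∧ x 0 = p ∧ IsSolOn (tauField Λ) tauDom x (Icc 0 T) ∧
    (∀ t ∈ Icc 0 T, (x t).1 ^ 2 < s₁ ∧ (x t).2.2.1 ^ 2 < 1) ∧ (x T).2.1 < 0

/-- The solution through `p` leaves the region `r² ≤ s₁`, `w² ≤ 1` while `N > 0`. -/
def Escape (Λ s₁ : ℝ) (p : Phase) : Prop :=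
  ∃ (T : ℝ) (x : ℝ → Phase), 0 ≤ T ∧ x 0 = p ∧ IsSolOn (tauField Λ) tauDom x (Icc 0 T) ∧
    (∀ t ∈ Icc 0 T, 0 < (x t).2.1) ∧ (s₁ < (x T).1 ^ 2 ∨ 1 < (x T).2.2.1 ^ 2)

/-- An open condition along a compact piece of orbit, together with an open condition at its end,
persists under perturbation. Both `Crash` and `Escape` have this shape, and their openness is what
the shooting argument uses. -/
theorem IsSolOn.eventually_mem {x : ℝ → Phase} {T : ℝ} (hT : 0 ≤ T)
    (hx : IsSolOn (tauField Λ) tauDom x (Icc 0 T)) {O O' : Set Phase} (hO : IsOpen O) (hO' : IsOpen O')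
    (h : ∀ t ∈ Icc 0 T, x t ∈ O) (h' : x T ∈ O') :
    ∀ᶠ p in 𝓝 (x 0), ∃ y, y 0 = p ∧ IsSolOn (tauField Λ) tauDom y (Icc 0 T) ∧
      (∀ t ∈ Icc 0 T, y t ∈ O) ∧ y T ∈ O' := by
  have hc : IsCompact (x '' Icc 0 T) := isCompact_Icc.image_of_continuousOn hx.continuousOn
  obtain ⟨δ, hδ, hsub⟩ := hc.exists_cthickening_subset_open hO (by rintro _ ⟨t, ht, rfl⟩; exact h t ht)
  obtain ⟨δ', hδ', hsub'⟩ := Metric.nhds_basis_closedBall.mem_iff.1 (hO'.mem_nhds h')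
  filter_upwards [hx.dependence isOpen_tauDom (contDiffOn_tauField Λ) (lt_min hδ hδ')] with p hp
  obtain ⟨y, hy0, hy, hd⟩ := hp
  refine ⟨y, hy0, hy, fun t ht => hsub ?_, hsub' ?_⟩
  · exact Metric.mem_cthickening_of_dist_le _ (x t) _ _ (mem_image_of_mem x ht)
      ((hd t ht).trans (min_le_left _ _))
  · exact (hd T ⟨hT, le_rfl⟩).trans (min_le_right _ _)

theorem isOpen_region (s₁ : ℝ) : IsOpen {q : Phase | q.1 ^ 2 < s₁ ∧ q.2.2.1 ^ 2 < 1} := by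
  have h1 : IsOpen {q : Phase | q.1 ^ 2 < s₁} := isOpen_lt (by fun_prop) (by fun_prop)
  have h2 : IsOpen {q : Phase | q.2.2.1 ^ 2 < 1} := isOpen_lt (by fun_prop) (by fun_prop)
  exact h1.inter h2

theorem isOpen_exterior (s₁ : ℝ) : IsOpen {q : Phase | s₁ < q.1 ^ 2 ∨ 1 < q.2.2.1 ^ 2} := by
  have h1 : IsOpen {q : Phase | s₁ < q.1 ^ 2} := isOpen_lt (by fun_prop) (by fun_prop)
  have h2 : IsOpen {q : Phase | 1 < q.2.2.1 ^ 2} := isOpen_lt (by fun_prop) (by fun_prop)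
  exact h1.union h2

theorem isClosed_region (s₁ : ℝ) : IsClosed {q : Phase | q.1 ^ 2 ≤ s₁ ∧ q.2.2.1 ^ 2 ≤ 1} := by
  have h1 : IsClosed {q : Phase | q.1 ^ 2 ≤ s₁} := isClosed_le (by fun_prop) (by fun_prop)
  have h2 : IsClosed {q : Phase | q.2.2.1 ^ 2 ≤ 1} := isClosed_le (by fun_prop) (by fun_prop)
  exact h1.inter h2

theorem Crash.eventually {s₁ : ℝ} {p : Phase} (h : Crash Λ s₁ p) : ∀ᶠ q in 𝓝 p, Crash Λ s₁ q := by
  obtain ⟨T, x, hT, rfl, hx, hO, hN⟩ := h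
  have h1 : IsOpen {q : Phase | q.1 ^ 2 < s₁ ∧ q.2.2.1 ^ 2 < 1} :=
    isOpen_region s₁
  have h2 : IsOpen {q : Phase | q.2.1 < 0} := isOpen_lt (by fun_prop) (by fun_prop)
  filter_upwards [hx.eventually_mem hT h1 h2 hO hN] with q hq
  obtain ⟨y, hy0, hy, h3, h4⟩ := hq
  exact ⟨T, y, hT, hy0, hy, h3, h4⟩

theorem Escape.eventually {s₁ : ℝ} {p : Phase} (h : Escape Λ s₁ p) : ∀ᶠ q in 𝓝 p, Escape Λ s₁ q := by
  obtain ⟨T, x, hT, rfl, hx, hN, hO⟩ := h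
  have h1 : IsOpen {q : Phase | s₁ < q.1 ^ 2 ∨ 1 < q.2.2.1 ^ 2} :=
    isOpen_exterior s₁
  have h2 : IsOpen {q : Phase | 0 < q.2.1} := isOpen_lt (by fun_prop) (by fun_prop)
  filter_upwards [hx.eventually_mem hT h2 h1 hN hO] with q hq
  obtain ⟨y, hy0, hy, h3, h4⟩ := hq
  exact ⟨T, y, hT, hy0, hy, h3, h4⟩

/-- By uniqueness both witnesses follow the same orbit. If the crash comes first, `N < 0`
contradicts positivity of `N` up to the escape; in the other order, the exit point would lie inside
the region. -/
theorem Crash.not_escape {s₁ : ℝ} {p : Phase} (h : Crash Λ s₁ p) : ¬ Escape Λ s₁ p := by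
  rintro ⟨T', y, hT', hy0, hy, hN', hO'⟩
  obtain ⟨T, x, hT, hx0, hx, hO, hN⟩ := h
  have key : ∀ b, 0 ≤ b → b ≤ T → b ≤ T' → x b = y b := fun b h0 h1 h2 =>
    IsSolOn.eqOn isOpen_tauDom (contDiffOn_tauField Λ) (hx.mono (Icc_subset_Icc_right h1))
      (hy.mono (Icc_subset_Icc_right h2)) ⟨le_rfl, h0⟩ (hx0.trans hy0.symm) ⟨h0, le_rfl⟩
  rcases le_total T T' with hle | hle
  · have h1 := hN' T ⟨hT, hle⟩
    rw [← key T hT le_rfl hle] at h1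
    linarith
  · have h1 := hO T' ⟨hT', hle⟩
    rw [key T' hT' hle le_rfl] at h1
    rcases hO' with h2 | h2
    · linarith [h1.1]
    · linarith [h1.2]

/-- As long as `N > 0`, solutions which do not escape stay in the region `r² ≤ s₁`, `w² ≤ 1`. -/
theorem region_of_not_escape {s₁ T : ℝ} {x : ℝ → Phase} (hT : 0 < T)
    (hx : IsSolOn (tauField Λ) tauDom x (Icc 0 T)) (hne : ¬ Escape Λ s₁ (x 0))
    (hN : ∀ t ∈ Ico 0 T, 0 < (x t).2.1) :
    ∀ t ∈ Icc 0 T, (x t).1 ^ 2 ≤ s₁ ∧ (x t).2.2.1 ^ 2 ≤ 1 := by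
  have h1 : ∀ t ∈ Ico 0 T, (x t).1 ^ 2 ≤ s₁ ∧ (x t).2.2.1 ^ 2 ≤ 1 := by
    intro t ht
    by_contra hcon
    refine hne ⟨t, x, ht.1, rfl, hx.mono (Icc_subset_Icc_right ht.2.le),
      fun s hs => hN s ⟨hs.1, hs.2.trans_lt ht.2⟩, ?_⟩
    by_contra! h2
    exact hcon h2
  intro t ht
  rcases ht.2.lt_or_eq with hlt | rfl
  · exact h1 t ⟨ht.1, hlt⟩
  · have hc : Tendsto x (𝓝[<] t) (𝓝 (x t)) :=
      (hx t ⟨hT.le, le_rfl⟩).1.continuousAt.tendsto.mono_left nhdsWithin_le_nhds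
    have hcl : IsClosed {q : Phase | q.1 ^ 2 ≤ s₁ ∧ q.2.2.1 ^ 2 ≤ 1} :=
      isClosed_region s₁
    refine hcl.mem_of_tendsto hc ?_
    filter_upwards [Ioo_mem_nhdsLT hT] with s hs using h1 s ⟨hs.1.le, hs.2⟩

/-- The set `w² = 1`, `U = 0` is invariant. -/
theorem IsTauSolution.vacuum {r N w U κ : ℝ → ℝ} {a b : ℝ} (hab : a ≤ b)
    (h : IsTauSolution Λ (Icc a b) r N w U κ) (hw : w a ^ 2 = 1) (hU : U a = 0) :
    w b ^ 2 = 1 ∧ U b = 0 := by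
  obtain ⟨M₁, h₁⟩ := isCompact_Icc.exists_bound_of_continuousOn (h.continuousOn_κ.sub h.continuousOn_N)
  obtain ⟨M₂, h₂⟩ := isCompact_Icc.exists_bound_of_continuousOn (f := fun t =>
    w t * (2 * r t + 1 / r t)) (s := Icc a b)
    (h.continuousOn_w.mul ((continuousOn_const.mul h.continuousOn_r).add (continuousOn_const.div
      h.continuousOn_r fun t ht => (h.r_pos t ht).ne')))
  have hQ : ∀ t ∈ Icc a b, HasDerivAt (fun t => (1 - w t ^ 2) ^ 2 + U t ^ 2)
      (-2 * (w t * (2 * r t + 1 / r t)) * ((1 - w t ^ 2) * U t) - 2 * (κ t - N t) * U t ^ 2) t := by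
    intro t ht
    have := (h.r_pos t ht).ne'
    refine (((((h.w_eq t ht).pow 2).const_sub 1).pow 2).add ((h.U_eq t ht).pow 2)).congr_deriv ?_
    simp only [Pi.pow_apply]
    push_cast
    field_simp
    ring
  have := eq_zero_of_deriv_le (C := 2 * M₁ + M₂) hab hQ (by positivity) (fun t ht => by
    have e1 : -M₁ ≤ κ t - N t ∧ κ t - N t ≤ M₁ := abs_le.1 (h₁ t ht)
    have e2 : -M₂ ≤ w t * (2 * r t + 1 / r t) ∧ w t * (2 * r t + 1 / r t) ≤ M₂ := abs_le.1 (h₂ t ht)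
    have f1 : -(M₁ * U t ^ 2) ≤ (κ t - N t) * U t ^ 2 := by nlinarith [sq_nonneg (U t)]
    have f2 : -2 * (w t * (2 * r t + 1 / r t)) * ((1 - w t ^ 2) * U t) ≤
        M₂ * ((1 - w t ^ 2) ^ 2 + U t ^ 2) := by
      nlinarith [sq_nonneg (1 - w t ^ 2 + U t), sq_nonneg (1 - w t ^ 2 - U t)]
    have g1 : 0 ≤ M₁ * (1 - w t ^ 2) ^ 2 := mul_nonneg (by linarith) (sq_nonneg _)
    nlinarith) (by simp [hw, hU])
  have h1 := sq_nonneg (1 - w b ^ 2)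
  have h2 := sq_nonneg (U b)
  have h3 : (1 - w b ^ 2) ^ 2 = 0 := by linarith
  have h4 : U b ^ 2 = 0 := by linarith
  exact ⟨by have := pow_eq_zero_iff two_ne_zero |>.1 h3; linarith, pow_eq_zero_iff two_ne_zero |>.1 h4⟩

/-- A solution with `w² ≤ 1` does not touch `w² = 1`. -/
theorem TauSol.w_sq_lt {b : ℝ} {x : ℝ → Phase} (h : TauSol Λ (Icc 0 b) x)
    (hle : ∀ t ∈ Icc 0 b, (x t).2.2.1 ^ 2 ≤ 1) (h0 : (x 0).2.2.1 ^ 2 < 1) (hb : (x b).2.2.1 ^ 2 < 1) :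
    ∀ t ∈ Icc 0 b, (x t).2.2.1 ^ 2 < 1 := by
  intro s hs
  refine lt_of_le_of_ne (hle s hs) fun heq => ?_
  have hs0 : 0 < s := lt_of_le_of_ne hs.1 fun h => by rw [h] at h0; linarith
  have hsb : s < b := lt_of_le_of_ne hs.2 fun h => by rw [← h] at hb; linarith
  have hmax : IsLocalMax (fun u => (x u).2.2.1 ^ 2) s := by
    filter_upwards [Ioo_mem_nhds hs0 hsb] with u hu
    rw [heq]; exact hle u (Ioo_subset_Icc_self hu)
  have hd := hmax.hasDerivAt_eq_zero ((h.w_eq s hs).pow 2)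
  simp only [Nat.cast_ofNat, Nat.add_one_sub_one, pow_one] at hd
  have hwne : (x s).2.2.1 ≠ 0 := fun h => by rw [h] at heq; norm_num at heq
  have hrs : (x s).1 ≠ 0 := (IsTauSolution.r_pos h s hs).ne'
  have hU : (x s).2.2.2.1 = 0 := by
    by_contra hU
    exact (mul_ne_zero (mul_ne_zero two_ne_zero hwne) (mul_ne_zero hrs hU)) hd
  have := (IsTauSolution.vacuum hsb.le (h.mono (Icc_subset_Icc_left hs.1)) heq hU).1
  linarith

theorem Admissible.tauSol {s₁ T : ℝ} {x : ℝ → Phase} (h : Admissible Λ s₁ (x 0)) (hT : 0 ≤ T)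
    (hx : IsSolOn (tauField Λ) tauDom x (Icc 0 T)) : TauSol Λ (Icc 0 T) x :=
  hx.tauSol ordConnected_Icc ⟨le_rfl, hT⟩ h.defect_eq

/-- At the first zero of `N` of a solution that has not escaped, `f ≠ 0`. -/
theorem first_zero_of_not_escape {s₁ s₂ k T : ℝ} (C : Consts Λ s₁ s₂ k) {x : ℝ → Phase}
    (h0 : Admissible Λ s₁ (x 0)) (hT : 0 ≤ T) (hx : IsSolOn (tauField Λ) tauDom x (Icc 0 T))
    (hne : ¬ Escape Λ s₁ (x 0)) (hN : (x T).2.1 ≤ 0) :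
    ∃ t ∈ Ioc 0 T, (x t).2.1 = 0 ∧ (∀ s ∈ Ico 0 t, 0 < (x s).2.1) ∧
      (∀ s ∈ Icc 0 t, (x s).1 ^ 2 ≤ s₁ ∧ (x s).2.2.1 ^ 2 ≤ 1) ∧ (x t).2.2.1 ^ 2 < 1 := by
  have hts := h0.tauSol hT hx
  obtain ⟨t, ht, ht0, hlt⟩ := exists_first_zero (f := fun t => -(x t).2.1) hT
    (IsTauSolution.continuousOn_N hts).neg (neg_neg_of_pos h0.N_pos) (neg_nonneg.2 hN)
  have hN0 : (x t).2.1 = 0 := neg_eq_zero.1 ht0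
  have hpos : ∀ s ∈ Ico 0 t, 0 < (x s).2.1 := fun s hs => neg_lt_zero.1 (hlt s hs)
  have hreg := region_of_not_escape ht.1 (hx.mono (Icc_subset_Icc_right ht.2)) hne hpos
  refine ⟨t, ht, hN0, hpos, hreg, ?_⟩
  have htI : t ∈ Icc 0 T := ⟨ht.1.le, ht.2⟩
  have hf := IsTauSolution.f_sq_of_N_zero hts htI hN0
  have hrp : 0 < (x t).1 := IsTauSolution.r_pos hts t htI
  have hR := hreg t ⟨ht.1.le, le_rfl⟩
  have h1 := C.pos (s := (x t).1 ^ 2) (by positivity) (hR.1.trans C.lt.le)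
  refine lt_of_le_of_ne hR.2 fun heq => ?_
  simp only [heq] at hf
  have : 0 ≤ 2 * (x t).1 ^ 2 * (x t).2.2.2.1 ^ 2 := by positivity
  linarith

/-- At the first zero of `N` the constraint reads `(1 - w²)² = r² - Λ r⁴ + 2 r² U²`. If `r² = s₁`
there, it forces `w = U = 0`, an invariant set on which `N` would have vanished from the start. So
`r² < s₁` and `w² < 1` hold strictly, survive for a moment, and `N` turns negative at once. -/
theorem crash_of_N_nonpos {s₁ s₂ k T T' : ℝ} (C : Consts Λ s₁ s₂ k) {x : ℝ → Phase}
    (h0 : Admissible Λ s₁ (x 0)) (hw0 : (x 0).2.2.1 ^ 2 < 1) (hT : 0 ≤ T) (hTT' : T < T')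
    (hx : IsSolOn (tauField Λ) tauDom x (Icc 0 T')) (hne : ¬ Escape Λ s₁ (x 0))
    (hN : (x T).2.1 ≤ 0) : Crash Λ s₁ (x 0) := by
  have hxT := hx.mono (Icc_subset_Icc_right hTT'.le)
  have hts := h0.tauSol (hT.trans hTT'.le) hx
  obtain ⟨t, ht, hN0, hpos, hreg, hwt⟩ := first_zero_of_not_escape C h0 hT hxT hne hN
  have htT' : t < T' := ht.2.trans_lt hTT'
  have htI : t ∈ Icc 0 T' := ⟨ht.1.le, htT'.le⟩
  have hf := IsTauSolution.f_sq_of_N_zero hts htI hN0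
  have hrp : 0 < (x t).1 := IsTauSolution.r_pos hts t htI
  have hR := hreg t ⟨ht.1.le, le_rfl⟩
  have hrU : 0 ≤ 2 * (x t).1 ^ 2 * (x t).2.2.2.1 ^ 2 := by positivity
  have hrt : (x t).1 ^ 2 < s₁ := by
    refine lt_of_le_of_ne hR.1 fun heq => ?_
    have h1 : (x t).1 ^ 2 - Λ * ((x t).1 ^ 2) ^ 2 = 1 := by rw [heq]; exact C.s₁_eq
    have h2 : 0 ≤ (x t).2.2.1 ^ 2 := sq_nonneg _
    have h3 : (x t).2.2.1 ^ 2 = 0 := by nlinarith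
    have h4 : 2 * (x t).1 ^ 2 * (x t).2.2.2.1 ^ 2 = 0 := by rw [h3] at hf; linarith
    have h5 : (x t).2.2.2.1 = 0 := by
      have := mul_eq_zero.1 h4
      rcases this with h | h
      · have : (0 : ℝ) < 2 * (x t).1 ^ 2 := by positivity
        linarith
      · exact pow_eq_zero_iff two_ne_zero |>.1 h
    have := IsTauSolution.N_zero_of_fixed ht.1.le (hts.mono (Icc_subset_Icc_right htT'.le)) hN0 h5
      (pow_eq_zero_iff two_ne_zero |>.1 h3)
    exact h0.N_pos.ne' this
  have hmono : MonotoneOn (fun t => (x t).1) (Icc 0 t) :=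
    IsTauSolution.r_monotoneOn (hts.mono (Icc_subset_Icc_right htT'.le)) fun s hs => by
      rcases hs.2.lt_or_eq with h | h
      · exact (hpos s ⟨hs.1, h⟩).le
      · rw [h]; exact hN0.ge
  have hw := TauSol.w_sq_lt (hts.mono (Icc_subset_Icc_right htT'.le)) (fun s hs => (hreg s hs).2) hw0 hwt
  have hneg := IsTauSolution.N_neg_of_zero (hts.mono (Icc_subset_Icc_left ht.1.le)) hN0 (by
    by_contra! hcon
    obtain ⟨hU, hwf⟩ := hcon
    have h1 := C.lt_one hrt
    rw [hU] at hf
    rcases mul_eq_zero.1 hwf with h | h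
    · rw [h] at hf; linarith
    · linarith)
  have hev : ∀ᶠ s in 𝓝 t, (x s).1 ^ 2 < s₁ ∧ (x s).2.2.1 ^ 2 < 1 := by
    exact (hx t htI).1.continuousAt.eventually_mem ((isOpen_region s₁).mem_nhds ⟨hrt, hwt⟩)
  obtain ⟨δ, hδ, hball⟩ := Metric.eventually_nhds_iff_ball.1 hev
  obtain ⟨b, hb1, hb2⟩ : ∃ b, t < b ∧ b < min T' (t + δ) :=
    exists_between (lt_min htT' (by linarith))
  have hb3 : b < T' := hb2.trans_le (min_le_left _ _)
  have hb4 : b < t + δ := hb2.trans_le (min_le_right _ _)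
  refine ⟨b, x, ht.1.le.trans hb1.le, rfl, hx.mono (Icc_subset_Icc_right hb3.le), fun s hs => ?_,
    hneg b ⟨hb1, hb3.le⟩⟩
  rcases le_total s t with hst | hst
  · have h1 : (x s).1 ≤ (x t).1 := hmono ⟨hs.1, hst⟩ ⟨ht.1.le, le_rfl⟩ hst
    have h2 : 0 < (x s).1 := IsTauSolution.r_pos hts s ⟨hs.1, hst.trans htT'.le⟩
    exact ⟨by nlinarith, hw s ⟨hs.1, hst⟩⟩
  · exact hball s (by rw [Metric.mem_ball, Real.dist_eq, abs_of_nonneg (by linarith)]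
                      linarith [hs.2])

/-- While `N > 0`, the bounds on `r` and `w` confine the orbit to a fixed compact box inside `r >
0`. A maximal solution of finite life time would have to leave it. -/
theorem exists_global_of_region {s₁ s₂ k : ℝ} (C : Consts Λ s₁ s₂ k) {p : Phase}
    (h0 : Admissible Λ s₁ p)
    (hreg : ∀ T x, 0 ≤ T → x 0 = p → IsSolOn (tauField Λ) tauDom x (Icc 0 T) →
      (∀ t ∈ Icc 0 T, 0 < (x t).2.1) → (x T).1 ^ 2 ≤ s₂ ∧ (x T).2.2.1 ^ 2 ≤ 3 / 2)
    (hN : ∀ T T' x, 0 ≤ T → T < T' → x 0 = p → IsSolOn (tauField Λ) tauDom x (Icc 0 T') →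
      0 < (x T).2.1) :
    ∃ x, x 0 = p ∧ TauSol Λ (Ici 0) x ∧ ∀ t, 0 ≤ t → 0 < (x t).2.1 := by
  obtain ⟨x, rfl, hx | ⟨T, hT, hx, hK⟩⟩ := exists_maximal_solution isOpen_tauDom
    (contDiffOn_tauField Λ) (x₀ := p) h0.r_pos
  · exact ⟨x, rfl, hx.tauSol ordConnected_Ici (mem_Ici.2 le_rfl) h0.defect_eq, fun t ht =>
      hN t (t + 1) x ht (by linarith) rfl (hx.mono Icc_subset_Ici_self)⟩
  · exfalso
    have hsub : ∀ b < T, IsSolOn (tauField Λ) tauDom x (Icc 0 b) := fun b hb =>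
      hx.mono fun s hs => ⟨hs.1, hs.2.trans_lt hb⟩
    have hpos : ∀ t ∈ Ico 0 T, 0 < (x t).2.1 := by
      intro t ht
      obtain ⟨b, hb1, hb2⟩ := exists_between ht.2
      exact hN t b x ht.1 hb1 rfl (hsub b hb2)
    have hr : ∀ t ∈ Ico 0 T, (x t).1 ^ 2 ≤ s₂ ∧ (x t).2.2.1 ^ 2 ≤ 3 / 2 := fun t ht =>
      hreg t x ht.1 rfl (hsub t ht.2) fun s hs => hpos s ⟨hs.1, hs.2.trans_lt ht.2⟩
    obtain ⟨t, ht, -, hout⟩ := hK _ (isCompact_box k (x 0).1) (box_subset h0.r_pos) 0 hT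
    have hin : ∀ s ∈ Icc 0 t, s ∈ Ico 0 T := fun s hs => ⟨hs.1, hs.2.trans_lt ht.2⟩
    exact hout (TauSol.mem_box C (h0.tauSol ht.1 (hsub t ht.2)) ht.1 h0.κ_ge h0.κ_le h0.N_le
      (fun s hs => (hpos s (hin s hs)).le) (fun s hs => (hr s (hin s hs)).1)
      (fun s hs => (hr s (hin s hs)).2) t ⟨ht.1, le_rfl⟩)

theorem exists_global_of_N_pos {s₁ s₂ k : ℝ} (C : Consts Λ s₁ s₂ k) {p : Phase}
    (h0 : Admissible Λ s₁ p) (hne : ¬ Escape Λ s₁ p)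
    (hN : ∀ T T' x, 0 ≤ T → T < T' → x 0 = p → IsSolOn (tauField Λ) tauDom x (Icc 0 T') →
      0 < (x T).2.1) :
    ∃ x, x 0 = p ∧ TauSol Λ (Ici 0) x ∧
      ∀ t, 0 ≤ t → 0 < (x t).2.1 ∧ (x t).1 ^ 2 ≤ s₁ ∧ (x t).2.2.1 ^ 2 ≤ 1 := by
  have key : ∀ T x, 0 ≤ T → x 0 = p → IsSolOn (tauField Λ) tauDom x (Icc 0 T) →
      (∀ t ∈ Icc 0 T, 0 < (x t).2.1) → (x T).1 ^ 2 ≤ s₁ ∧ (x T).2.2.1 ^ 2 ≤ 1 := by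
    intro T x hT hx0 hx hpos
    by_contra hcon
    refine hne ⟨T, x, hT, hx0, hx, hpos, ?_⟩
    by_contra! h2
    exact hcon h2
  obtain ⟨x, hx0, hx, hpos⟩ := exists_global_of_region C h0 (fun T x hT hx0 hx hp =>
    ⟨(key T x hT hx0 hx hp).1.trans C.lt.le, by linarith [(key T x hT hx0 hx hp).2]⟩) hN
  exact ⟨x, hx0, hx, fun t ht => ⟨hpos t ht, key t x ht hx0
    (hx.isSolOn.mono Icc_subset_Ici_self) fun s hs => hpos s hs.1⟩⟩

/-- Solutions which neither crash nor escape exist for all time. -/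
theorem exists_global_of_not {s₁ s₂ k : ℝ} (C : Consts Λ s₁ s₂ k) {p : Phase}
    (h0 : Admissible Λ s₁ p) (hw0 : p.2.2.1 ^ 2 < 1) (hc : ¬ Crash Λ s₁ p) (hne : ¬ Escape Λ s₁ p) :
    ∃ x, x 0 = p ∧ TauSol Λ (Ici 0) x ∧
      ∀ t, 0 ≤ t → 0 < (x t).2.1 ∧ (x t).1 ^ 2 ≤ s₁ ∧ (x t).2.2.1 ^ 2 ≤ 1 :=
  exists_global_of_N_pos C h0 hne fun T T' x hT hTT' hx0 hx => by
    subst hx0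
    by_contra! hcon
    exact hc (crash_of_N_nonpos C h0 hw0 hT hTT' hx hne hcon)

/-- The vacuum solution escapes. -/
theorem escape_of_vacuum {s₁ s₂ k : ℝ} (C : Consts Λ s₁ s₂ k) {p : Phase}
    (h0 : Admissible Λ s₁ p) (hw : p.2.2.1 = 1) (hU : p.2.2.2.1 = 0) : Escape Λ s₁ p := by
  by_contra hne
  -- Along such an orbit `w² = 1` forever. If the orbit did not escape, a zero of `N` would require
  -- `w² < 1`; so `N > 0` for all time, and convergence to the fixed point would give `w → 0`.
  have hvac : ∀ T x, 0 ≤ T → x 0 = p → IsSolOn (tauField Λ) tauDom x (Icc 0 T) →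
      (x T).2.2.1 ^ 2 = 1 := by
    intro T x hT hx0 hx
    subst hx0
    exact (IsTauSolution.vacuum hT (h0.tauSol hT hx) (by simp [hw]) hU).1
  obtain ⟨x, hx0, hx, hreg⟩ := exists_global_of_N_pos C h0 hne fun T T' x hT hTT' hx0 hx => by
    by_contra! hcon
    subst hx0
    obtain ⟨t, ht, -, -, -, hwt⟩ := first_zero_of_not_escape C h0 hT
      (hx.mono (Icc_subset_Icc_right hTT'.le)) hne hcon
    have := hvac t x ht.1.le rfl (hx.mono (Icc_subset_Icc_right (ht.2.trans hTT'.le)))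
    linarith
  subst hx0
  have hlim := (hx.tendsto_fixed C h0 (fun t ht => (hreg t ht).1)
    (fun t ht => (hreg t ht).2.1.trans C.lt.le) (fun t ht => by linarith [(hreg t ht).2.2])).2.2.1
  have := tendsto_nhds_unique (hlim.pow 2) (tendsto_const_nhds.congr' (by
    filter_upwards [eventually_ge_atTop 0] with t ht
    exact (hvac t x ht rfl (hx.isSolOn.mono Icc_subset_Ici_self)).symm))
  norm_num at this

end EYM

/-! ### Passage between the radius and `τ` as independent variable -/

namespace EYM

variable {Λ : ℝ}

/-- The point of phase space belonging to a solution `(A, w)` at radius `r`. -/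
noncomputable def phaseOf (Λ : ℝ) (A w : ℝ → ℝ) (r : ℝ) : Phase :=
  (r, √(A r), w r, √(A r) * deriv w r,
    (1 + √(A r) ^ 2 - (1 - w r ^ 2) ^ 2 / r ^ 2 - Λ * r ^ 2 + 2 * (√(A r) * deriv w r) ^ 2) /
      (2 * √(A r)))

theorem defect_phaseOf {A w : ℝ → ℝ} {r : ℝ} (hA : 0 < A r) : defect Λ (phaseOf Λ A w r) = 0 := by
  have : √(A r) ≠ 0 := (Real.sqrt_pos.2 hA).ne'
  simp only [defect, phaseOf]
  field_simp
  ring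

theorem hasDerivAt_phaseOf {A w ρ : ℝ → ℝ} {t A' w'' : ℝ} (hA : HasDerivAt A A' (ρ t))
    (hw : HasDerivAt w (deriv w (ρ t)) (ρ t)) (hw' : HasDerivAt (deriv w) w'' (ρ t)) (hr : 0 < ρ t)
    (hApos : 0 < A (ρ t))
    (hAe : ρ t * A' + 2 * A (ρ t) * deriv w (ρ t) ^ 2 = Phi Λ A w (ρ t))
    (hwe : ρ t ^ 2 * A (ρ t) * w'' + ρ t * deriv w (ρ t) * Phi Λ A w (ρ t) +
      w (ρ t) * (1 - w (ρ t) ^ 2) = 0)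
    (hρ : HasDerivAt ρ (ρ t * √(A (ρ t))) t) :
    HasDerivAt (fun s => phaseOf Λ A w (ρ s)) (tauField Λ (phaseOf Λ A w (ρ t))) t := by
  have hn : 0 < √(A (ρ t)) := Real.sqrt_pos.2 hApos
  have hsq : A (ρ t) = √(A (ρ t)) ^ 2 := (Real.sq_sqrt hApos.le).symm
  have hN : HasDerivAt (fun s => √(A (ρ s)))
      ((1 - √(A (ρ t)) ^ 2 - (1 - w (ρ t) ^ 2) ^ 2 / ρ t ^ 2 - Λ * ρ t ^ 2) / 2 -
        (√(A (ρ t)) * deriv w (ρ t)) ^ 2) t := by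
    refine ((hA.comp t hρ).sqrt hApos.ne').congr_deriv ?_
    have h1 : ρ t * A' = (1 - √(A (ρ t)) ^ 2 - (1 - w (ρ t) ^ 2) ^ 2 / ρ t ^ 2 - Λ * ρ t ^ 2) -
        2 * √(A (ρ t)) ^ 2 * deriv w (ρ t) ^ 2 := by
      rw [← hsq]; rw [Phi] at hAe; linarith
    simp only [Function.comp_apply]
    rw [show A' * (ρ t * √(A (ρ t))) = (ρ t * A') * √(A (ρ t)) by ring, h1]
    field_simp
  have hW : HasDerivAt (fun s => w (ρ s)) (ρ t * (√(A (ρ t)) * deriv w (ρ t))) t :=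
    (hw.comp t hρ).congr_deriv (by ring)
  have hD : HasDerivAt (fun s => deriv w (ρ s))
      ((-(deriv w (ρ t) * (1 - √(A (ρ t)) ^ 2 - (1 - w (ρ t) ^ 2) ^ 2 / ρ t ^ 2 - Λ * ρ t ^ 2)) -
        w (ρ t) * (1 - w (ρ t) ^ 2) / ρ t) / √(A (ρ t))) t := by
    refine (hw'.comp t hρ).congr_deriv ?_
    rw [Phi, hsq] at hwe
    rw [eq_div_iff hn.ne']
    field_simp
    field_simp at hwe
    linear_combination hwe
  have hU := hN.mul hD
  have hK := (((((hN.pow 2).const_add 1).sub (((hW.pow 2).const_sub 1 |>.pow 2).div (hρ.pow 2)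
    (pow_ne_zero 2 hr.ne'))).sub ((hρ.pow 2).const_mul Λ)).add ((hU.pow 2).const_mul 2)).div
    (hN.const_mul 2) (by positivity)
  refine (hρ.prodMk (hN.prodMk (hW.prodMk (hU.prodMk hK)))).congr_deriv ?_
  simp only [tauField, phaseOf, Pi.mul_apply, Pi.add_apply, Pi.sub_apply, Pi.div_apply, Pi.pow_apply]
  generalize √(A (ρ t)) = n at *
  generalize deriv w (ρ t) = d at *
  generalize w (ρ t) = v at *
  generalize ρ t = r at *
  refine Prod.ext rfl (Prod.ext ?_ (Prod.ext rfl (Prod.ext ?_ ?_)))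
  · simp only
    field_simp
    ring
  · simp only
    field_simp
    ring
  · simp only
    push_cast
    field_simp
    ring

theorem LocalFamily.isRegularSolution {a : ℝ} {A w : ℝ → ℝ → ℝ} (F : LocalFamily Λ a A w) {lam : ℝ}
    (hlam : 0 ≤ lam) : IsRegularSolution Λ lam (2 * a / (1 + lam)) (A lam) (w lam) := by
  have ha := F.a_pos
  have habs : ∀ r ∈ Ico 0 (2 * a / (1 + lam)), |r| < 2 * a / (1 + lam) := fun r hr => by
    rw [abs_of_nonneg hr.1]; exact hr.2
  exact .of_contDiffAt (by positivity) (fun r hr => F.smooth_A lam hlam r (habs r hr))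
    (fun r hr => F.smooth_w lam hlam r (habs r hr)) (fun r hr => F.A_pos lam hlam r (habs r hr))
    (fun r hr => F.A_eq lam hlam r hr.1 hr.2) (fun r hr => F.w_eq lam hlam r hr.1 hr.2)
    (F.A_zero lam hlam) (F.w_zero lam hlam) (F.dw_zero lam hlam) (F.ddw_zero lam hlam)

/-- The radius as a function of `τ`, near the center. -/
theorem IsRegularSolution.exists_radius {lam R r₁ : ℝ} {A w : ℝ → ℝ} (h : IsRegularSolution Λ lam R A w)
    (hr₁ : 0 < r₁) (hr₁R : r₁ < R) (hA0 : ContDiffAt ℝ ∞ A 0) :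
    ∃ δ > 0, ∃ ρ : ℝ → ℝ, ρ 0 = r₁ ∧ (∀ t < δ, ρ t ∈ Ioo 0 R) ∧
      (∀ t < δ, HasDerivAt ρ (ρ t * √(A (ρ t))) t) ∧ Tendsto ρ atBot (𝓝 0) := by
  obtain ⟨c, hc1, hc2⟩ := exists_between hr₁R
  have hc0 : 0 < c := hr₁.trans hc1
  have hI : ∀ r ∈ Icc 0 c, r ∈ Ico 0 R := fun r hr => ⟨hr.1, hr.2.trans_lt hc2⟩
  have hgC : ContDiffOn ℝ 1 (fun r => √(A r)) (Icc 0 c) := fun r hr => by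
    have : ContDiffAt ℝ ∞ A r := by
      rcases hr.1.eq_or_lt with h0 | h0
      · rw [← h0]; exact hA0
      · exact h.contDiffAt_A ⟨h0, (hI r hr).2⟩
    exact ((this.of_le (by exact_mod_cast le_top)).sqrt (h.A_pos r (hI r hr)).ne').contDiffWithinAt
  obtain ⟨K, hK⟩ := hgC.exists_lipschitzOnWith one_ne_zero (convex_Icc 0 c) isCompact_Icc
  obtain ⟨M, hM⟩ := isCompact_Icc.exists_bound_of_continuousOn hgC.continuousOn
  obtain ⟨r₀, hr₀, hmin⟩ := isCompact_Icc.exists_isMinOn ⟨0, le_rfl, hc0.le⟩ hgC.continuousOn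
  set m := √(A r₀) with hm
  have hm0 : 0 < m := Real.sqrt_pos.2 (h.A_pos r₀ (hI r₀ hr₀))
  have hE : LipschitzOnWith c.toNNReal Real.exp (Iic (Real.log c)) := by
    refine Convex.lipschitzOnWith_of_nnnorm_deriv_le (𝕜 := ℝ) (fun x _ => Real.differentiableAt_exp)
      (fun x hx => ?_) (convex_Iic _)
    rw [← NNReal.coe_le_coe, coe_nnnorm, Real.coe_toNNReal c hc0.le, Real.deriv_exp, Real.norm_of_nonneg (Real.exp_pos _).le]
    exact (Real.le_log_iff_exp_le hc0).1 hx
  have hmem : ∀ s, s ≤ Real.log c → Real.exp s ∈ Icc 0 c := fun s hs =>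
    ⟨(Real.exp_pos s).le, (Real.le_log_iff_exp_le hc0).1 hs⟩
  -- In the variable `σ = log r` the equation is `σ' = √A`, with a Lipschitz right side bounded
  -- below by `m > 0`. So `σ` exists for all time and tends to `-∞` only as `τ → -∞`. The cap at
  -- `log c`, with `c > r₁`, is inactive for `t < δ`.
  set W : ℝ → ℝ := fun s => √(A (Real.exp (min s (Real.log c)))) with hW
  have hWL : LipschitzWith (K * (c.toNNReal * 1)) W := by
    rw [← lipschitzOnWith_univ]
    refine hK.comp (hE.comp (lipschitzOnWith_univ.2 (LipschitzWith.id.min_const (Real.log c)))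
      (fun s _ => mem_Iic.2 (min_le_right _ _))) fun s _ => hmem _ (min_le_right _ _)
  have hM0 : 0 ≤ M := (norm_nonneg _).trans (hM 0 ⟨le_rfl, hc0.le⟩)
  obtain ⟨σ, hσ0, hσ⟩ := exists_global_solution (M := ⟨M, hM0⟩) hWL
    (fun s => hM _ (hmem _ (min_le_right _ _))) (Real.log r₁)
  have hWm : ∀ s, m ≤ W s := fun s => hmin (hmem (min s (Real.log c)) (min_le_right _ _))
  have hd : ∀ t, HasDerivAt (fun t => σ t - m * t) (W (σ t) - m * 1) t := fun t =>
    (hσ t).sub ((hasDerivAt_id t).const_mul m)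
  have hmono : Monotone fun t => σ t - m * t := monotone_of_deriv_nonneg
    (fun t => (hd t).differentiableAt) fun t => by
      rw [(hd t).deriv]
      linarith [hWm (σ t)]
  have hlt : Real.log r₁ < Real.log c := Real.log_lt_log hr₁ hc1
  have hev : ∀ᶠ t in 𝓝 0, σ t < Real.log c :=
    (hσ 0).continuousAt.eventually_lt_const (by rw [hσ0]; exact hlt)
  obtain ⟨δ, hδ, hball⟩ := Metric.eventually_nhds_iff_ball.1 hev
  have hle : ∀ t ≤ 0, σ t ≤ Real.log r₁ + m * t := fun t ht => by
    have := hmono ht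
    simp only [hσ0, mul_zero, sub_zero] at this
    linarith
  have hσc : ∀ t < δ, σ t < Real.log c := by
    intro t ht
    rcases le_total t 0 with h0 | h0
    · have := hle t h0
      nlinarith
    · exact hball t (by rw [Metric.mem_ball, Real.dist_eq, sub_zero, abs_of_nonneg h0]; exact ht)
  refine ⟨δ, hδ, fun t => Real.exp (σ t), ?_, fun t ht => ⟨Real.exp_pos _, ?_⟩, fun t ht => ?_, ?_⟩
  · simp only [hσ0, Real.exp_log hr₁]
  · exact (hI _ (hmem _ (hσc t ht).le)).2
  · refine (hσ t).exp.congr_deriv ?_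
    rw [hW]; simp only [min_eq_left (hσc t ht).le]
  · refine Real.tendsto_exp_atBot.comp (tendsto_atBot_mono' atBot
      (f₁ := fun t => Real.log r₁ + m * t) ?_ ?_ : Tendsto σ atBot atBot)
    · filter_upwards [eventually_le_atBot 0] with t ht using hle t ht
    · exact tendsto_atBot_add_const_left _ _ (tendsto_id.const_mul_atBot hm0)

theorem contDiffOn_of_hasDerivAt {E : Type*} [NormedAddCommGroup E] [NormedSpace ℝ E] {G : E → E}
    {Ω : Set E} (hG : ContDiffOn ℝ ∞ G Ω) {J : Set ℝ} (hJ : IsOpen J) {y : ℝ → E}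
    (hy : ∀ t ∈ J, HasDerivAt y (G (y t)) t ∧ y t ∈ Ω) : ContDiffOn ℝ ∞ y J := by
  refine contDiffOn_infty.2 fun n => ?_
  induction n with
  | zero => exact contDiffOn_zero.2 (HasDerivAt.continuousOn fun t ht => (hy t ht).1)
  | succ n ih =>
    refine (contDiffOn_succ_iff_deriv_of_isOpen hJ).2
      ⟨fun t ht => (hy t ht).1.differentiableAt.differentiableWithinAt,
        fun h => absurd h (WithTop.coe_ne_top (a := (n : ℕ∞))), ?_⟩
    exact ((hG.of_le (by exact_mod_cast le_top)).comp ih fun t ht => (hy t ht).2).congr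
      fun t ht => (hy t ht).1.deriv

/-- Extension of a solution in `τ` to the left, up to the center. -/
theorem IsRegularSolution.exists_extension {lam R r₁ : ℝ} {A w : ℝ → ℝ}
    (h : IsRegularSolution Λ lam R A w) (hr₁ : 0 < r₁) (hr₁R : r₁ < R) (hA0 : ContDiffAt ℝ ∞ A 0)
    {x : ℝ → Phase} {J : Set ℝ} (hJ : J.OrdConnected) (hJ0 : J ⊆ Ici 0) (h0J : (0 : ℝ) ∈ J) {b : ℝ}
    (hb : 0 < b) (hbJ : b ∈ J) (hx : IsSolOn (tauField Λ) tauDom x J) (hx0 : x 0 = phaseOf Λ A w r₁) :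
    ∃ z : ℝ → Phase, IsSolOn (tauField Λ) tauDom z (Iic 0 ∪ J) ∧ EqOn z x J ∧
      (∀ t ≤ 0, (z t).1 < R ∧ z t = phaseOf Λ A w (z t).1) ∧
      Tendsto (fun t => (z t).1) atBot (𝓝 0) := by
  obtain ⟨δ, hδ, ρ, hρ0, hρI, hρ, hlim⟩ := h.exists_radius hr₁ hr₁R hA0
  have hy : IsSolOn (tauField Λ) tauDom (fun t => phaseOf Λ A w (ρ t)) (Iio δ) := fun t ht =>
    ⟨hasDerivAt_phaseOf (h.hasDerivAt_A (hρI t ht)) (h.hasDerivAt_w (hρI t ht))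
      (h.hasDerivAt_dw (hρI t ht)) (hρI t ht).1 (h.A_pos _ (Ioo_subset_Ico_self (hρI t ht)))
      (h.A_eq _ (hρI t ht)) (h.w_eq _ (hρI t ht)) (hρ t ht), (hρI t ht).1⟩
  set c := min δ b / 2 with hc
  have hmin : 0 < min δ b := lt_min hδ hb
  have hc0 : 0 < c := by positivity
  have hcδ : c + c ≤ δ := by rw [hc]; linarith [min_le_left δ b]
  have hcb : c + c ≤ b := by rw [hc]; linarith [min_le_right δ b]
  have hsubJ : Icc 0 (c + c) ⊆ J := (Icc_subset_Icc_right hcb).trans (hJ.out h0J hbJ)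
  have hagree : EqOn (fun t => phaseOf Λ A w (ρ t)) x (Icc 0 c) :=
    IsSolOn.eqOn isOpen_tauDom (contDiffOn_tauField Λ) (hy.mono fun t ht => by
      rw [mem_Iio]; linarith [ht.2]) (hx.mono ((Icc_subset_Icc_right (by linarith)).trans hsubJ))
      ⟨le_rfl, hc0.le⟩ (by simp only [hρ0, hx0])
  have hglue := hy.glue isOpen_tauDom (contDiffOn_tauField Λ) (c := c) (ε := c / 2) (by positivity) hx
    (hagree ⟨hc0.le, le_rfl⟩) (fun t ht => by rw [mem_Iio]; linarith [ht.2])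
    ((Icc_subset_Icc (by linarith) (by linarith)).trans hsubJ)
  have hneg : ∀ t ≤ 0, (if t ≤ c then phaseOf Λ A w (ρ t) else x t) = phaseOf Λ A w (ρ t) :=
    fun t ht => if_pos (ht.trans hc0.le)
  refine ⟨_, hglue.mono ?_, fun t ht => ?_, fun t ht => ?_, ?_⟩
  · rintro t (ht | ht)
    · exact Or.inl ⟨lt_of_le_of_lt ht hδ, le_trans ht hc0.le⟩
    · rcases le_total t c with h1 | h1
      · exact Or.inl ⟨by rw [mem_Iio]; linarith, h1⟩
      · exact Or.inr ⟨ht, h1⟩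
  · by_cases h1 : t ≤ c
    · simp only [if_pos h1]; exact hagree ⟨hJ0 ht, h1⟩
    · simp only [if_neg h1]
  · simp only [hneg t ht]; exact ⟨(hρI t (lt_of_le_of_lt ht hδ)).2, rfl⟩
  · refine hlim.congr' ?_
    filter_upwards [eventually_le_atBot 0] with t ht
    rw [hneg t ht]; rfl

/-- The solution as a function of the radius, from the solution as a function of `τ`. -/
theorem IsRegularSolution.of_tauSol {lam R₀ R : ℝ} {A w : ℝ → ℝ}
    (h : IsRegularSolution Λ lam R₀ A w) (hA0 : ContDiffAt ℝ ∞ A 0) (hw0 : ContDiffAt ℝ ∞ w 0)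
    (hdw0 : deriv w 0 = 0) (hddw0 : deriv (deriv w) 0 = -lam) {z : ℝ → Phase}
    {J : Set ℝ} (hJo : IsOpen J) (hJ : J.OrdConnected) (h0J : (0 : ℝ) ∈ J)
    (hz : TauSol Λ J z) (hN : ∀ t ∈ J, 0 < (z t).2.1) (himg : (fun t => (z t).1) '' J = Ioo 0 R)
    (hR₀ : (z 0).1 < R₀) (hleft : ∀ t ≤ 0, z t = phaseOf Λ A w (z t).1) :
    ∃ B W : ℝ → ℝ, IsRegularSolution Λ lam R B W ∧ ∀ t ∈ J, (z t).1 < R ∧ (z t).2.1 = √(B (z t).1) ∧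
      (z t).2.2.1 = W (z t).1 ∧ (z t).2.2.2.1 = √(B (z t).1) * deriv W (z t).1 := by
  have hmono : StrictMonoOn (fun t => (z t).1) J := by
    refine strictMonoOn_of_deriv_pos hJ.convex (IsTauSolution.continuousOn_r hz) fun t ht => ?_
    rw [(hz.r_eq t (interior_subset ht)).deriv]
    exact mul_pos (hz.r_pos t (interior_subset ht)) (hN t (interior_subset ht))
  -- `r` is strictly increasing in `τ` because `N > 0`. Composed with its inverse, the orbit is an
  -- integral curve of the field divided by `r N`, which is smooth where `r, N > 0`; this yields
  -- smoothness in `r`.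
  set g := Function.invFunOn (fun t => (z t).1) J with hg
  have hgJ : ∀ r ∈ Ioo 0 R, g r ∈ J := fun r hr => Function.invFunOn_mem (by
    rw [← himg] at hr; exact hr)
  have hgr : ∀ r ∈ Ioo 0 R, (z (g r)).1 = r := fun r hr => Function.invFunOn_eq (f := fun t => (z t).1)
    (by rw [← himg] at hr; exact hr)
  have hzI : ∀ t ∈ J, (z t).1 ∈ Ioo 0 R := fun t ht => by rw [← himg]; exact ⟨t, ht, rfl⟩
  have hgz : ∀ t ∈ J, g (z t).1 = t := fun t ht =>
    hmono.injOn (hgJ _ (hzI t ht)) ht (hgr _ (hzI t ht))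
  have hgmono : StrictMonoOn g (Ioo 0 R) := fun r hr s hs hrs => by
    rw [← hmono.lt_iff_lt (hgJ r hr) (hgJ s hs)]
    simpa only [hgr r hr, hgr s hs] using hrs
  have hgimg : g '' Ioo 0 R = J := by
    ext t
    exact ⟨by rintro ⟨r, hr, rfl⟩; exact hgJ r hr, fun ht => ⟨_, hzI t ht, hgz t ht⟩⟩
  have hgc : ∀ r ∈ Ioo 0 R, ContinuousAt g r := fun r hr =>
    hgmono.continuousAt_of_image_mem_nhds (isOpen_Ioo.mem_nhds hr)
      (by rw [hgimg]; exact hJo.mem_nhds (hgJ r hr))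
  set y : ℝ → Phase := fun r => z (g r) with hy
  have hyr : ∀ r ∈ Ioo 0 R, (y r).1 = r := hgr
  have hyN : ∀ r ∈ Ioo 0 R, 0 < (y r).2.1 := fun r hr => hN _ (hgJ r hr)
  have hgd : ∀ r ∈ Ioo 0 R, HasDerivAt g (r * (y r).2.1)⁻¹ r := fun r hr => by
    have h1 := hz.r_eq (g r) (hgJ r hr)
    simp only [hgr r hr] at h1
    refine HasDerivAt.of_local_left_inverse (hgc r hr) h1 (mul_pos hr.1 (hyN r hr)).ne' ?_
    filter_upwards [isOpen_Ioo.mem_nhds hr] with s hs using hgr s hs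
  set Ω : Set Phase := {p | 0 < p.1 ∧ 0 < p.2.1} with hΩ
  have hGs : ContDiffOn ℝ ∞ (fun p : Phase => (p.1 * p.2.1)⁻¹ • tauField Λ p) Ω := by
    have h1 : ContDiffOn ℝ ∞ (tauField Λ) Ω := by
      unfold tauField
      refine ContDiffOn.prodMk (by fun_prop) (ContDiffOn.prodMk (by fun_prop)
        (ContDiffOn.prodMk (by fun_prop) (ContDiffOn.prodMk ?_ (by fun_prop))))
      exact ((ContDiffOn.div (by fun_prop) (by fun_prop) fun p hp => hp.1.ne').neg).sub (by fun_prop)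
    exact (ContDiffOn.inv (by fun_prop) fun p hp => (mul_pos hp.1 hp.2).ne').smul h1
  have hyd : ∀ r ∈ Ioo 0 R, HasDerivAt y ((r * (y r).2.1)⁻¹ • tauField Λ (y r)) r := fun r hr =>
    (hz.isSolOn (g r) (hgJ r hr)).1.scomp r (hgd r hr)
  have hys : ContDiffOn ℝ ∞ y (Ioo 0 R) := contDiffOn_of_hasDerivAt hGs isOpen_Ioo fun r hr =>
    ⟨by simp only [hyr r hr]; exact hyd r hr, by rw [hΩ]; exact ⟨by rw [hyr r hr]; exact hr.1, hyN r hr⟩⟩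
  have hR1 : (z 0).1 ∈ Ioo 0 R := hzI 0 h0J
  have hysmall : ∀ r ∈ Ioc 0 (z 0).1, y r = phaseOf Λ A w r := by
    intro r hr
    have hrI : r ∈ Ioo 0 R := ⟨hr.1, hr.2.trans_lt hR1.2⟩
    have h1 : g r ≤ 0 := by
      have := hgmono.monotoneOn hrI hR1 hr.2
      rwa [hgz 0 h0J] at this
    have := hleft _ h1
    rwa [hgr r hrI] at this
  -- Below the starting radius, including `r ≤ 0`, the given local solution is kept. Smoothness and
  -- the initial values at the center are inherited from it, since the orbit in `τ` never reaches `r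
  -- = 0`.
  set B : ℝ → ℝ := fun r => if r < (z 0).1 then A r else (y r).2.1 ^ 2 with hB
  set W : ℝ → ℝ := fun r => if r < (z 0).1 then w r else (y r).2.2.1 with hW
  have hBy : ∀ r ∈ Ioo 0 R, B r = (y r).2.1 ^ 2 := by
    intro r hr
    by_cases h1 : r < (z 0).1
    · simp only [hB, if_pos h1, hysmall r ⟨hr.1, h1.le⟩, phaseOf]
      exact (Real.sq_sqrt (h.A_pos r ⟨hr.1.le, h1.trans hR₀⟩).le).symm
    · simp only [hB, if_neg h1]
  have hWy : ∀ r ∈ Ioo 0 R, W r = (y r).2.2.1 := by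
    intro r hr
    by_cases h1 : r < (z 0).1
    · simp only [hW, if_pos h1, hysmall r ⟨hr.1, h1.le⟩, phaseOf]
    · simp only [hW, if_neg h1]
  have hB0 : B =ᶠ[𝓝 0] A := by
    filter_upwards [gt_mem_nhds hR1.1] with r hr
    simp only [hB, if_pos hr]
  have hW0 : W =ᶠ[𝓝 0] w := by
    filter_upwards [gt_mem_nhds hR1.1] with r hr
    simp only [hW, if_pos hr]
  have hBs : ContDiffOn ℝ ∞ B (Ioo 0 R) := (hys.snd.fst.pow 2).congr hBy
  have hWs : ContDiffOn ℝ ∞ W (Ioo 0 R) := hys.snd.snd.fst.congr hWy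
  have hBd : ∀ r ∈ Ioo 0 R, deriv B r = 2 * (y r).2.1 *
      ((r * (y r).2.1)⁻¹ * (((y r).2.2.2.2 - (y r).2.1) * (y r).2.1 - 2 * (y r).2.2.2.1 ^ 2)) := by
    intro r hr
    have h1 : HasDerivAt (fun r => (y r).2.1) _ r := (hyd r hr).snd.fst
    have h2 : B =ᶠ[𝓝 r] fun r => (y r).2.1 ^ 2 := by
      filter_upwards [isOpen_Ioo.mem_nhds hr] with s hs using hBy s hs
    rw [h2.deriv_eq, (h1.fun_pow 2).deriv]
    simp [tauField]
  have hWd : ∀ r ∈ Ioo 0 R, deriv W r = (y r).2.2.2.1 / (y r).2.1 := by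
    intro r hr
    have h1 : HasDerivAt (fun r => (y r).2.2.1) _ r := (hyd r hr).snd.snd.fst
    have h2 : W =ᶠ[𝓝 r] fun r => (y r).2.2.1 := by
      filter_upwards [isOpen_Ioo.mem_nhds hr] with s hs using hWy s hs
    rw [h2.deriv_eq, h1.deriv]
    have h3 := (hyN r hr).ne'
    have h4 := hr.1.ne'
    simp only [tauField, Prod.smul_snd, Prod.smul_fst, smul_eq_mul, hyr r hr]
    field_simp
  have hWdd : ∀ r ∈ Ioo 0 R, deriv (deriv W) r = ((r * (y r).2.1)⁻¹ *
      (-((y r).2.2.1 * (1 - (y r).2.2.1 ^ 2) / r) - ((y r).2.2.2.2 - (y r).2.1) * (y r).2.2.2.1) *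
      (y r).2.1 - (y r).2.2.2.1 * ((r * (y r).2.1)⁻¹ *
        (((y r).2.2.2.2 - (y r).2.1) * (y r).2.1 - 2 * (y r).2.2.2.1 ^ 2))) / (y r).2.1 ^ 2 := by
    intro r hr
    have h1 : HasDerivAt (fun r => (y r).2.2.2.1) _ r := (hyd r hr).snd.snd.snd.fst
    have h1' : HasDerivAt (fun r => (y r).2.1) _ r := (hyd r hr).snd.fst
    have h2 : deriv W =ᶠ[𝓝 r] fun r => (y r).2.2.2.1 / (y r).2.1 := by
      filter_upwards [isOpen_Ioo.mem_nhds hr] with s hs using hWd s hs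
    rw [h2.deriv_eq, (h1.fun_div h1' (hyN r hr).ne').deriv]
    simp only [tauField, Prod.smul_snd, Prod.smul_fst, smul_eq_mul, hyr r hr]
  have hcon : ∀ r ∈ Ioo 0 R, 2 * (y r).2.1 * (y r).2.2.2.2 = (1 - (y r).2.1 ^ 2 -
      (1 - (y r).2.2.1 ^ 2) ^ 2 / r ^ 2 - Λ * r ^ 2) + 2 * (y r).2.2.2.1 ^ 2 + 2 * (y r).2.1 ^ 2 := by
    intro r hr
    have := hz.constraint _ (hgJ r hr)
    rwa [hgr r hr] at this
  have hRpos : 0 < R := hR1.1.trans hR1.2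
  refine ⟨B, W, .of_contDiffAt hRpos ?_ ?_ ?_ ?_ ?_ ?_ ?_ ?_ ?_, fun t ht => ?_⟩
  · intro r hr
    rcases hr.1.eq_or_lt with h0 | h0
    · rw [← h0]; exact hA0.congr_of_eventuallyEq hB0
    · exact hBs.contDiffAt (isOpen_Ioo.mem_nhds ⟨h0, hr.2⟩)
  · intro r hr
    rcases hr.1.eq_or_lt with h0 | h0
    · rw [← h0]; exact hw0.congr_of_eventuallyEq hW0
    · exact hWs.contDiffAt (isOpen_Ioo.mem_nhds ⟨h0, hr.2⟩)
  · intro r hr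
    rcases hr.1.eq_or_lt with h0 | h0
    · rw [← h0, hB0.eq_of_nhds, h.A_zero]; exact one_pos
    · rw [hBy r ⟨h0, hr.2⟩]; exact pow_pos (hyN r ⟨h0, hr.2⟩) 2
  · intro r hr
    have h1 := hcon r hr
    have h3 := (hyN r hr).ne'
    have h4 := hr.1.ne'
    rw [Phi, hBd r hr, hWd r hr, hBy r hr, hWy r hr]
    have h5 : (1 - (y r).2.2.1 ^ 2) ^ 2 / r ^ 2 = (1 - (y r).2.1 ^ 2 - Λ * r ^ 2) +
      2 * (y r).2.2.2.1 ^ 2 + 2 * (y r).2.1 ^ 2 - 2 * (y r).2.1 * (y r).2.2.2.2 := by linarith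
    rw [h5]
    field_simp
    ring
  · intro r hr
    have h1 := hcon r hr
    have h3 := (hyN r hr).ne'
    have h4 := hr.1.ne'
    rw [Phi, hWdd r hr, hWd r hr, hBy r hr, hWy r hr]
    have h5 : (1 - (y r).2.2.1 ^ 2) ^ 2 / r ^ 2 = (1 - (y r).2.1 ^ 2 - Λ * r ^ 2) +
      2 * (y r).2.2.2.1 ^ 2 + 2 * (y r).2.1 ^ 2 - 2 * (y r).2.1 * (y r).2.2.2.2 := by linarith
    rw [h5]
    field_simp
    ring
  · rw [hB0.eq_of_nhds, h.A_zero]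
  · rw [hW0.eq_of_nhds, h.w_zero]
  · rw [hW0.deriv_eq, hdw0]
  · rw [hW0.deriv.deriv_eq, hddw0]
  · have h1 := hzI t ht
    have h2 : y (z t).1 = z t := by simp only [hy, hgz t ht]
    have h3 : √(B (z t).1) = (z t).2.1 := by
      rw [hBy _ h1, h2, Real.sqrt_sq (hN t ht).le]
    refine ⟨h1.2, h3.symm, ?_, ?_⟩
    · rw [hWy _ h1, h2]
    · rw [h3, hWd _ h1, h2, mul_div_cancel₀ _ (hN t ht).ne']

end EYM

/-! ### Starting data, and oscillation of global solutions -/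

namespace EYM

variable {Λ a : ℝ} {A w : ℝ → ℝ → ℝ}

/-- The initial data at `r = a / (1 + lam)`. -/
noncomputable def startData (Λ a : ℝ) (A w : ℝ → ℝ → ℝ) (lam : ℝ) : Phase :=
  phaseOf Λ (A lam) (w lam) (a / (1 + lam))

section Start

variable (F : LocalFamily Λ a A w) {lam : ℝ}
include F

theorem LocalFamily.radius_mem (hlam : 0 ≤ lam) : 0 < a / (1 + lam) ∧ a / (1 + lam) ≤ 1 / 100 ∧
    a / (1 + lam) < 2 * a / (1 + lam) := by
  have ha := F.a_pos
  refine ⟨by positivity, ?_, by gcongr; linarith⟩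
  rw [div_le_iff₀ (by linarith)]
  linarith [F.a_le]

theorem LocalFamily.A_radius_pos (hlam : 0 ≤ lam) : 0 < A lam (a / (1 + lam)) := by
  obtain ⟨h1, -, h3⟩ := F.radius_mem hlam
  exact F.A_pos lam hlam _ (by rwa [abs_of_pos h1])

theorem LocalFamily.continuousOn_startData : ContinuousOn (startData Λ a A w) (Ici 0) := by
  have hr : ContinuousOn (fun lam : ℝ => a / (1 + lam)) (Ici 0) :=
    continuousOn_const.div (by fun_prop) fun lam (hlam : 0 ≤ lam) => by positivity
  have hN := F.cont_A.sqrt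
  have hU := hN.mul F.cont_dw
  refine hr.prodMk (hN.prodMk (F.cont_w.prodMk (hU.prodMk (ContinuousOn.div ?_
    (continuousOn_const.mul hN) fun lam (hlam : 0 ≤ lam) => ?_))))
  · exact ((((continuousOn_const.add (hN.pow 2)).sub (((continuousOn_const.sub (F.cont_w.pow 2)).pow
      2).div (hr.pow 2) fun lam (hlam : 0 ≤ lam) => pow_ne_zero 2 (F.radius_mem hlam).1.ne')).sub
      (continuousOn_const.mul (hr.pow 2))).add (continuousOn_const.mul (hU.pow 2)))
  · exact mul_ne_zero two_ne_zero (Real.sqrt_pos.2 (F.A_radius_pos hlam)).ne'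

theorem LocalFamily.startData_bounds (hΛ0 : 0 ≤ Λ) (hΛ : Λ < 1 / 4) (hlam : 0 ≤ lam) :
    99 / 100 ≤ (startData Λ a A w lam).2.1 ∧ (startData Λ a A w lam).2.1 ≤ 101 / 100 ∧
      19 / 20 ≤ (startData Λ a A w lam).2.2.2.2 ∧ (startData Λ a A w lam).2.2.2.2 ≤ 21 / 20 := by
  have hA := abs_le.1 (F.A_near lam hlam)
  have hd := F.dw_near lam hlam
  have hz := F.z_near lam hlam
  obtain ⟨hr0, hr1, -⟩ := F.radius_mem hlam
  have hApos := F.A_radius_pos hlam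
  simp only [startData, phaseOf]
  generalize a / (1 + lam) = r at *
  have hsq := Real.sq_sqrt hApos.le
  have hn := Real.sqrt_pos.2 hApos
  have hz2 : (1 - w lam r ^ 2) ^ 2 / r ^ 2 ≤ (1 / 50) ^ 2 := by
    rw [← div_pow, ← sq_abs]; gcongr
  have hz0 : 0 ≤ (1 - w lam r ^ 2) ^ 2 / r ^ 2 := by positivity
  have hd2 : deriv (w lam) r ^ 2 ≤ (1 / 50) ^ 2 := by rw [← sq_abs]; gcongr
  have hl : Λ * r ^ 2 ≤ 1 / 4 * (1 / 100) ^ 2 := by gcongr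
  have hl0 : 0 ≤ Λ * r ^ 2 := by positivity
  generalize √(A lam r) = n at *
  have h1 : 99 / 100 ≤ n := by nlinarith
  have h2 : n ≤ 101 / 100 := by nlinarith
  have hU : (n * deriv (w lam) r) ^ 2 ≤ (101 / 100) ^ 2 * (1 / 50) ^ 2 := by
    rw [mul_pow]; gcongr
  have hU0 := sq_nonneg (n * deriv (w lam) r)
  refine ⟨h1, h2, ?_, ?_⟩
  · rw [le_div_iff₀ (by positivity)]; nlinarith
  · rw [div_le_iff₀ (by positivity)]; nlinarith

theorem LocalFamily.admissible {s₁ s₂ k : ℝ} (C : Consts Λ s₁ s₂ k) (hΛ : Λ < 1 / 4) (hlam : 0 ≤ lam) :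
    Admissible Λ s₁ (startData Λ a A w lam) := by
  obtain ⟨h1, h2, h3, h4⟩ := F.startData_bounds C.nonneg hΛ hlam
  obtain ⟨hr0, hr1, -⟩ := F.radius_mem hlam
  refine ⟨hr0, ?_, by linarith, by linarith, by linarith, by linarith,
    defect_phaseOf (F.A_radius_pos hlam)⟩
  have := C.one_le
  simp only [startData, phaseOf]
  nlinarith

theorem LocalFamily.w_sq_lt (hlam : 0 < lam) : (startData Λ a A w lam).2.2.1 ^ 2 < 1 := by
  have h1 := F.w_lt_one hlam
  obtain ⟨h2, -, h3⟩ := F.radius_mem hlam.le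
  have h4 := F.w_pos lam hlam.le _ (by rwa [abs_of_pos h2])
  simp only [startData, phaseOf]
  nlinarith

theorem LocalFamily.contDiffAt_zero (hlam : 0 ≤ lam) :
    ContDiffAt ℝ ∞ (A lam) 0 ∧ ContDiffAt ℝ ∞ (w lam) 0 := by
  have ha := F.a_pos
  exact ⟨F.smooth_A lam hlam 0 (by rw [abs_zero]; positivity),
    F.smooth_w lam hlam 0 (by rw [abs_zero]; positivity)⟩

/-- A solution of the system in `τ` with the initial data of the solution with parameter `lam`, extended to
the center. -/
theorem LocalFamily.exists_extension (hlam : 0 ≤ lam) {x : ℝ → Phase} {J : Set ℝ} (hJ : J.OrdConnected)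
    (hJ0 : J ⊆ Ici 0) (h0J : (0 : ℝ) ∈ J) {b : ℝ} (hb : 0 < b) (hbJ : b ∈ J)
    (hx : IsSolOn (tauField Λ) tauDom x J) (hx0 : x 0 = startData Λ a A w lam) :
    ∃ z : ℝ → Phase, TauSol Λ (Iic 0 ∪ J) z ∧ EqOn z x J ∧ (∀ t ≤ 0, 0 < (z t).2.1) ∧
      Tendsto (fun t => (z t).1) atBot (𝓝 0) ∧
      ∀ (I : Set ℝ) (R : ℝ), IsOpen I → I.OrdConnected → Iic 0 ⊆ I → I ⊆ Iic 0 ∪ J →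
        (∀ t ∈ I, 0 ≤ t → 0 < (z t).2.1) → (fun t => (z t).1) '' I = Ioo 0 R →
        ∃ B W : ℝ → ℝ, IsRegularSolution Λ lam R B W ∧ ∀ t ∈ I, (z t).1 < R ∧
          (z t).2.1 = √(B (z t).1) ∧ (z t).2.2.1 = W (z t).1 ∧
          (z t).2.2.2.1 = √(B (z t).1) * deriv W (z t).1 := by
  obtain ⟨hA0, hw0⟩ := F.contDiffAt_zero hlam
  obtain ⟨hr0, -, hrR⟩ := F.radius_mem hlam
  have hreg := F.isRegularSolution hlam
  obtain ⟨z, hz, hzx, hleft, hlim⟩ := hreg.exists_extension hr0 hrR hA0 hJ hJ0 h0J hb hbJ hx hx0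
  have hz0 : z 0 = startData Λ a A w lam := (hzx h0J).trans hx0
  have hOC : (Iic 0 ∪ J).OrdConnected := by
    refine ⟨fun s hs t ht u hu => ?_⟩
    rcases le_total u 0 with h | h
    · exact Or.inl h
    · rcases ht with ht | ht
      · exact Or.inl (hu.2.trans ht)
      · exact Or.inr (hJ.out h0J ht ⟨h, hu.2⟩)
  have hts : TauSol Λ (Iic 0 ∪ J) z := hz.tauSol hOC (Or.inr h0J)
    (by rw [hz0]; exact defect_phaseOf (F.A_radius_pos hlam))
  have hNneg : ∀ t ≤ 0, 0 < (z t).2.1 := by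
    intro t ht
    obtain ⟨h1, h2⟩ := hleft t ht
    rw [h2]
    exact Real.sqrt_pos.2 (hreg.A_pos _ ⟨(hts.r_pos t (Or.inl ht)).le, h1⟩)
  refine ⟨z, hts, hzx, hNneg, hlim, fun I R hIo hI hI0 hIJ hN himg => ?_⟩
  refine hreg.of_tauSol hA0 hw0 (F.dw_zero lam hlam) (F.ddw_zero lam hlam) hIo hI
    (hI0 (mem_Iic.2 le_rfl)) (hts.mono hIJ) (fun t ht => ?_) himg (hleft 0 le_rfl).1
    fun t ht => (hleft t ht).2
  rcases le_total t 0 with h | h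
  · exact hNneg t h
  · exact hN t ht h

/-- A solution with `N > 0` in the region `r² ≤ s₁`, `w² ≤ 1` for all time is oscillating. -/
theorem LocalFamily.isOscillating {s₁ s₂ k : ℝ} (C : Consts Λ s₁ s₂ k) (hΛ : Λ < 1 / 4) (hlam : 0 ≤ lam)
    {x : ℝ → Phase} (hx0 : x 0 = startData Λ a A w lam) (hx : TauSol Λ (Ici 0) x)
    (hreg : ∀ t, 0 ≤ t → 0 < (x t).2.1 ∧ (x t).1 ^ 2 ≤ s₁ ∧ (x t).2.2.1 ^ 2 ≤ 1) :
    IsOscillating Λ lam ∧ crashRadius Λ lam = ENNReal.ofReal √s₁ := by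
  have hadm : Admissible Λ s₁ (x 0) := hx0 ▸ F.admissible C hΛ hlam
  have hfix := hx.tendsto_fixed C hadm (fun t ht => (hreg t ht).1)
    (fun t ht => (hreg t ht).2.1.trans C.lt.le) (fun t ht => by linarith [(hreg t ht).2.2])
  have hzeros := hx.exists_zero_of_tendsto C.nonneg C.k_pos hfix
  obtain ⟨hr, hN, hw, hU, -⟩ := hfix
  obtain ⟨z, hz, hzx, hNneg, hbot, hmain⟩ := F.exists_extension hlam ordConnected_Ici le_rfl
    (mem_Ici.2 le_rfl) one_pos (mem_Ici.2 zero_le_one) hx.isSolOn hx0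
  rw [Iic_union_Ici] at hz hmain
  have hNpos : ∀ t, 0 < (z t).2.1 := by
    intro t
    rcases le_total t 0 with h | h
    · exact hNneg t h
    · rw [hzx h]; exact (hreg t h).1
  have hmono : StrictMono fun t => (z t).1 := strictMono_of_deriv_pos fun t => by
    rw [(hz.r_eq t (mem_univ t)).deriv]
    exact mul_pos (hz.r_pos t (mem_univ t)) (hNpos t)
  have hcont : Continuous fun t => (z t).1 := continuousOn_univ.1 (IsTauSolution.continuousOn_r hz)
  have hev : z =ᶠ[atTop] x := by filter_upwards [eventually_ge_atTop 0] with t ht using hzx ht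
  have hr' : Tendsto (fun t => (z t).1) atTop (𝓝 √s₁) :=
    hr.congr' (by filter_upwards [hev] with t ht; rw [ht])
  have hlt : ∀ t, (z t).1 < √s₁ := fun t =>
    (hmono (lt_add_one t)).trans_le (hmono.monotone.ge_of_tendsto hr' _)
  have himg : (fun t => (z t).1) '' univ = Ioo 0 √s₁ := by
    rw [image_univ]
    refine Subset.antisymm (by rintro _ ⟨t, rfl⟩; exact ⟨hz.r_pos t (mem_univ t), hlt t⟩) fun r hr0 => ?_
    obtain ⟨t₁, h₁⟩ := (hbot.eventually (gt_mem_nhds hr0.1)).exists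
    obtain ⟨t₂, h₂⟩ := (hr'.eventually (lt_mem_nhds hr0.2)).exists
    exact mem_range_of_exists_le_of_exists_ge hcont ⟨t₁, h₁.le⟩ ⟨t₂, h₂.le⟩
  obtain ⟨B, W, hBW, hzBW⟩ := hmain univ √s₁ isOpen_univ ordConnected_univ (subset_univ _)
    (subset_univ _) (fun t _ _ => hNpos t) himg
  -- Every limit as `τ → ∞` becomes a limit as `r ↗ √s₁`, because `r` increases onto `(0, √s₁)`.
  have hmap : 𝓝[<] √s₁ ≤ map (fun t => (z t).1) atTop := by
    intro s hs
    obtain ⟨T, hT⟩ := mem_atTop_sets.1 (mem_map.1 hs)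
    filter_upwards [Ioo_mem_nhdsLT (hlt T)] with r hrI
    have h1 : r ∈ (fun t => (z t).1) '' univ := by
      rw [himg]; exact ⟨(hz.r_pos T (mem_univ T)).trans hrI.1, hrI.2⟩
    obtain ⟨t, -, rfl⟩ := h1
    exact hT t (hmono.lt_iff_lt.1 hrI.1).le
  have htrans : ∀ {f : ℝ → ℝ} {l : Filter ℝ}, Tendsto (fun t => f (z t).1) atTop l →
      Tendsto f (𝓝[<] √s₁) l := fun h => (tendsto_map'_iff.2 h).mono_left hmap
  have hNz : Tendsto (fun t => (z t).2.1) atTop (𝓝 0) :=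
    hN.congr' (by filter_upwards [hev] with t ht; rw [ht])
  have hwz : Tendsto (fun t => (z t).2.2.1) atTop (𝓝 0) :=
    hw.congr' (by filter_upwards [hev] with t ht; rw [ht])
  have hBz : ∀ t, B (z t).1 = (z t).2.1 ^ 2 := by
    intro t
    obtain ⟨h1, h2, -⟩ := hzBW t (mem_univ t)
    rw [h2, Real.sq_sqrt (hBW.A_pos _ ⟨(hz.r_pos t (mem_univ t)).le, h1⟩).le]
  have hBlim : Tendsto B (𝓝[<] √s₁) (𝓝 0) := htrans (by
    simp only [hBz]
    simpa using hNz.pow 2)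
  have hs0 : 0 < s₁ := one_pos.trans_le C.one_le
  have hsq : √s₁ ^ 2 = s₁ := Real.sq_sqrt hs0.le
  have hcr := hBW.crashRadius_eq hBlim
  refine ⟨⟨√s₁, B, W, hBW, hcr, hBlim, htrans ?_, htrans ?_, htrans ?_, ?_⟩, hcr⟩
  · obtain ⟨t₀, -, ht₀⟩ : √s₁ / 2 ∈ (fun t => (z t).1) '' univ := by
      rw [himg]
      have := Real.sqrt_pos.2 hs0
      exact ⟨by linarith, by linarith⟩
    -- Substituting `s = r(τ)` turns the integral of `1 / (s √B)` into elapsed `τ`, which diverges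
    -- since the orbit is global.
    have hint : ∀ t, t - t₀ = ∫ s in (√s₁ / 2)..(z t).1, 1 / (s * √(B s)) := by
      intro t
      have hBc : ContinuousOn (fun s => 1 / (s * √(B s))) (Ioo 0 √s₁) := by
        refine continuousOn_const.div (continuousOn_id.mul
          (hBW.smooth_A.continuousOn.mono Ioo_subset_Ico_self).sqrt) fun s hs => ?_
        exact (mul_pos hs.1 (Real.sqrt_pos.2 (hBW.A_pos s (Ioo_subset_Ico_self hs)))).ne'
      have h1 := intervalIntegral.integral_comp_mul_deriv' (a := t₀) (b := t)
        (f := fun t => (z t).1) (f' := fun t => (z t).1 * (z t).2.1) (g := fun s => 1 / (s * √(B s)))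
        (fun t _ => hz.r_eq t (mem_univ t))
        ((IsTauSolution.continuousOn_r hz).mul (IsTauSolution.continuousOn_N hz) |>.mono
          (subset_univ _)) (hBc.mono (by rintro _ ⟨s, -, rfl⟩; rw [← himg]; exact ⟨s, mem_univ s, rfl⟩))
      simp only [ht₀] at h1
      rw [← h1]
      have h2 : ∀ s, ((fun s => 1 / (s * √(B s))) ∘ fun t => (z t).1) s * ((z s).1 * (z s).2.1) = 1 := by
        intro s
        simp only [Function.comp_apply]
        rw [← (hzBW s (mem_univ s)).2.1, one_div_mul_cancel
          (mul_pos (hz.r_pos s (mem_univ s)) (hNpos s)).ne']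
      simp only [h2]
      simp
    simp only [← hint]
    exact tendsto_atTop_add_const_right _ _ tendsto_id
  · have h1 : Tendsto (fun t => 1 - (z t).2.1 ^ 2 - (1 - (z t).2.2.1 ^ 2) ^ 2 / (z t).1 ^ 2 -
        Λ * (z t).1 ^ 2) atTop (𝓝 (1 - 0 ^ 2 - (1 - 0 ^ 2) ^ 2 / √s₁ ^ 2 - Λ * √s₁ ^ 2)) :=
      (((hNz.pow 2).const_sub 1).sub ((((hwz.pow 2).const_sub 1).pow 2).div (hr'.pow 2)
        (by rw [hsq]; exact hs0.ne'))).sub ((hr'.pow 2).const_mul Λ)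
    have h2 : 1 - 0 ^ 2 - (1 - 0 ^ 2) ^ 2 / √s₁ ^ 2 - Λ * √s₁ ^ 2 = 0 := by
      rw [hsq]
      field_simp
      linarith [C.s₁_eq]
    rw [h2] at h1
    refine h1.congr fun t => ?_
    rw [Phi, hBz, ← (hzBW t (mem_univ t)).2.2.1]
  · exact hwz.congr fun t => (hzBW t (mem_univ t)).2.2.1
  · have hinf : {t | (z t).2.2.1 = 0}.Infinite := by
      refine infinite_of_not_bddAbove fun ⟨M, hM⟩ => ?_
      obtain ⟨t, ht, h0⟩ := hzeros (max 0 (M + 1))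
      have h1 : (z t).2.2.1 = 0 := by rw [hzx ((le_max_left _ _).trans ht)]; exact h0
      have := hM h1
      linarith [(le_max_right 0 (M + 1)).trans ht]
    refine (hinf.image hmono.injective.injOn).mono ?_
    rintro _ ⟨t, ht, rfl⟩
    exact ⟨⟨hz.r_pos t (mem_univ t), hlt t⟩, by rw [← (hzBW t (mem_univ t)).2.2.1]; exact ht⟩

end Start

end EYM

/-! ### Escape near the fixed point and the jump of the crash radius -/

namespace EYM

variable {Λ : ℝ}

theorem nonneg_of_hasDerivAt_of_le {f : ℝ → ℝ} {f' a t : ℝ} (h : HasDerivAt f f' t) (hat : a < t)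
    (hle : ∀ s ∈ Ico a t, f s ≤ f t) : 0 ≤ f' := by
  have h1 := (hasDerivWithinAt_iff_tendsto_slope' (s := Iio t) (by simp)).1 h.hasDerivWithinAt
  refine ge_of_tendsto h1 ?_
  filter_upwards [Ioo_mem_nhdsLT hat] with s hs
  rw [slope_def_field]
  exact div_nonneg_of_nonpos (by linarith [hle s ⟨hs.1.le, hs.2⟩]) (by linarith [hs.2])

theorem TauSol.image_Iio {z : ℝ → Phase} {T : ℝ} (hz : TauSol Λ (Iic T) z)
    (hN : ∀ t < T, 0 < (z t).2.1) (hlim : Tendsto (fun t => (z t).1) atBot (𝓝 0)) :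
    (fun t => (z t).1) '' Iio T = Ioo 0 (z T).1 := by
  have hcont := IsTauSolution.continuousOn_r hz
  have hmono : StrictMonoOn (fun t => (z t).1) (Iic T) := by
    refine strictMonoOn_of_deriv_pos (convex_Iic T) hcont fun t ht => ?_
    rw [interior_Iic] at ht
    rw [(hz.r_eq t (mem_Iic.2 (le_of_lt ht))).deriv]
    exact mul_pos (hz.r_pos t (mem_Iic.2 (le_of_lt ht))) (hN t ht)
  refine Subset.antisymm ?_ fun r hr => ?_
  · rintro _ ⟨t, ht, rfl⟩
    exact ⟨hz.r_pos t (mem_Iic.2 (le_of_lt ht)), hmono (mem_Iic.2 (le_of_lt ht)) (mem_Iic.2 le_rfl) ht⟩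
  · obtain ⟨t₁, h₁, ht₁⟩ := ((hlim.eventually (gt_mem_nhds hr.1)).and (eventually_lt_atBot T)).exists
    obtain ⟨t, ht, rfl⟩ := intermediate_value_Ioo ht₁.le (hcont.mono Icc_subset_Iic_self) ⟨h₁, hr.2⟩
    exact ⟨t, ht.2, rfl⟩

/-- A stretch of orbit with `N > 0` is a regular solution in `r` up to the radius attained; this is
how lower bounds on `r_c` arise. -/
theorem LocalFamily.le_crashRadius {a : ℝ} {A w : ℝ → ℝ → ℝ} (F : LocalFamily Λ a A w) {lam : ℝ}
    (hlam : 0 ≤ lam) {x : ℝ → Phase} {T : ℝ} (hT : 0 < T) (hx0 : x 0 = startData Λ a A w lam)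
    (hx : IsSolOn (tauField Λ) tauDom x (Icc 0 T)) (hN : ∀ t ∈ Icc 0 T, 0 < (x t).2.1) :
    ENNReal.ofReal (x T).1 ≤ crashRadius Λ lam := by
  obtain ⟨z, hz, hzx, hNneg, hbot, hmain⟩ := F.exists_extension hlam ordConnected_Icc
    Icc_subset_Ici_self ⟨le_rfl, hT.le⟩ hT ⟨hT.le, le_rfl⟩ hx hx0
  have hU : Iic 0 ∪ Icc 0 T = Iic T := Iic_union_Icc_eq_Iic hT.le
  rw [hU] at hz hmain
  have hNp : ∀ t, 0 ≤ t → t ≤ T → 0 < (z t).2.1 := fun t h0 h1 => by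
    rw [hzx ⟨h0, h1⟩]; exact hN t ⟨h0, h1⟩
  obtain ⟨B, W, hBW, -⟩ := hmain (Iio T) (z T).1 isOpen_Iio ordConnected_Iio
    (Iic_subset_Iio.2 hT) Iio_subset_Iic_self (fun t ht h0 => hNp t h0 ht.le)
    (hz.image_Iio (fun t ht => (le_total t 0).elim (hNneg t) fun h => hNp t h ht.le) hbot)
  rw [hzx ⟨hT.le, le_rfl⟩] at hBW
  exact hBW.le_crashRadius

theorem w_sq_le_of_energy {v w ℓ : ℝ} (hw : w ^ 2 < 1) (h : v ^ 2 + w ^ 2 - w ^ 4 / 2 ≤ ℓ) :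
    w ^ 2 ≤ 2 * ℓ := by nlinarith [sq_nonneg v, sq_nonneg w]

/-- `(rU)² + w² - w⁴/2` does not increase as long as `2 N ≤ κ`. -/
theorem TauSol.w_sq_le_energy {a c ℓ : ℝ} {x : ℝ → Phase} (hac : a ≤ c) (h : TauSol Λ (Icc a c) x)
    (hℓ : ℓ < 1 / 2) (hκN : ∀ t ∈ Icc a c, 0 ≤ (x t).2.2.2.2 - 2 * (x t).2.1)
    (hL : ((x a).1 * (x a).2.2.2.1) ^ 2 + (x a).2.2.1 ^ 2 - (x a).2.2.1 ^ 4 / 2 ≤ ℓ)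
    (hwa : (x a).2.2.1 ^ 2 < 1) : ∀ t ∈ Icc a c, (x t).2.2.1 ^ 2 ≤ 2 * ℓ := by
  have hanti : AntitoneOn (fun t => ((x t).1 * (x t).2.2.2.1) ^ 2 + (x t).2.2.1 ^ 2 -
      (x t).2.2.1 ^ 4 / 2) (Icc a c) := by
    refine antitoneOn_Icc_of_hasDerivAt (f' := fun t => -2 * ((x t).2.2.2.2 - 2 * (x t).2.1) *
      ((x t).1 * (x t).2.2.2.1) ^ 2) (fun t ht => ?_) fun t ht => ?_
    · have hrne := (h.r_pos t ht).ne'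
      refine (((((h.r_eq t ht).mul (h.U_eq t ht)).pow 2).add
        ((h.w_eq t ht).pow 2)).sub (((h.w_eq t ht).pow 4).div_const 2)).congr_deriv ?_
      simp only [Pi.mul_apply]
      push_cast
      field_simp
      ring
    · have := mul_nonneg (hκN t ht) (sq_nonneg ((x t).1 * (x t).2.2.2.1))
      linarith
  have hE : ∀ t ∈ Icc a c, ((x t).1 * (x t).2.2.2.1) ^ 2 + (x t).2.2.1 ^ 2 -
      (x t).2.2.1 ^ 4 / 2 ≤ ℓ := fun t ht => (hanti ⟨le_rfl, hac⟩ ht ht.1).trans hL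
  intro t ht
  refine w_sq_le_of_energy ?_ (hE t ht)
  -- At a first time with `w² = 1` the energy would be at least `1 - 1 / 2`, exceeding `ℓ`.
  by_contra! hcon
  obtain ⟨s, hs, hs0, -⟩ := exists_first_zero (f := fun t => (x t).2.2.1 ^ 2 - 1) ht.1
    (((IsTauSolution.continuousOn_w h).mono (Icc_subset_Icc_right ht.2)).pow 2 |>.sub
      continuousOn_const) (by linarith) (by linarith)
  have h1 := hE s ⟨hs.1.le, hs.2.trans ht.2⟩
  have h2 : (x s).2.2.1 ^ 2 = 1 := by linarith
  have h3 : (x s).2.2.1 ^ 4 = 1 := by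
    rw [show (4 : ℕ) = 2 * 2 from rfl, pow_mul, h2, one_pow]
  have := sq_nonneg ((x s).1 * (x s).2.2.2.1)
  rw [h2, h3] at h1
  linarith

/-- This controls the source in `N' = -κ N + (1 - Λ r² - (1 - w²)² / r²)`. At `N = k / 4` the
damping is at least `k² / 4`, so with `w` small and `r²` not far above `s₁` the function `N` cannot
grow through `k / 4`. -/
theorem Consts.force_lt {s₁ s₂ k s e : ℝ} (C : Consts Λ s₁ s₂ k) (hs : 1 / 2 ≤ s) (hs2 : s ≤ s₂)
    (hsk : s ≤ s₁ + k ^ 2 / 16) (hek : e ≤ k ^ 2 / 64) :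
    1 - Λ * s - (1 - e) ^ 2 / s < k ^ 2 / 4 := by
  have hk := C.k_pos
  have hfac := C.factor_pos hs2
  have hfac1 : 1 - Λ * (s + s₁) ≤ 1 := by
    have : 0 ≤ Λ * (s + s₁) := mul_nonneg C.nonneg (by linarith [C.one_le])
    linarith
  have h1 : s - Λ * s ^ 2 - 1 ≤ k ^ 2 / 16 := by
    rw [C.sub_eq]
    rcases le_total s s₁ with h1 | h1
    · have := mul_nonneg (sub_nonneg.2 h1) hfac.le
      nlinarith [sq_nonneg k]
    · have := mul_le_mul_of_nonneg_left hfac1 (sub_nonneg.2 h1)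
      linarith
  have h2 : s * (1 - Λ * s - (1 - e) ^ 2 / s) = s - Λ * s ^ 2 - (1 - e) ^ 2 := by
    field_simp
  by_contra! hcon
  have h5 : 1 / 2 * (k ^ 2 / 4) ≤ s * (1 - Λ * s - (1 - e) ^ 2 / s) := by gcongr
  rw [h2] at h5
  nlinarith [sq_nonneg e, pow_pos hk 2]

/-- Close to the fixed point, `w` remains small as long as `N ≥ 0` and `r² ≤ s₁ + k²/16`. -/
theorem TauSol.w_small {s₁ s₂ k a b : ℝ} (C : Consts Λ s₁ s₂ k) {x : ℝ → Phase} (hab : a ≤ b)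
    (h : TauSol Λ (Icc a b) x) (hκ : k ≤ (x a).2.2.2.2) (hNa : (x a).2.1 < k / 4)
    (hL : ((x a).1 * (x a).2.2.2.1) ^ 2 + (x a).2.2.1 ^ 2 - (x a).2.2.1 ^ 4 / 2 ≤ k ^ 2 / 128)
    (hwa : (x a).2.2.1 ^ 2 < 1) (hra : 1 / 2 ≤ (x a).1 ^ 2) (hN : ∀ t ∈ Icc a b, 0 ≤ (x t).2.1)
    (hr : ∀ t ∈ Icc a b, (x t).1 ^ 2 ≤ min s₂ (s₁ + k ^ 2 / 16)) :
    ∀ t ∈ Icc a b, (x t).2.2.1 ^ 2 ≤ k ^ 2 / 64 := by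
  have hk := C.k_pos
  have hk1 := C.k_le
  have hκ' := IsTauSolution.κ_ge C h hκ fun t ht => (hr t ht).trans (min_le_left _ _)
  have hsmall : ∀ c ∈ Icc a b, (∀ t ∈ Icc a c, (x t).2.1 ≤ k / 4) →
      ∀ t ∈ Icc a c, (x t).2.2.1 ^ 2 ≤ k ^ 2 / 64 := fun c hc hNc t ht => by
    have := TauSol.w_sq_le_energy hc.1 (h.mono (Icc_subset_Icc_right hc.2)) (ℓ := k ^ 2 / 128)
      (by nlinarith) (fun t ht => by
        have h1 := hκ' t ⟨ht.1, ht.2.trans hc.2⟩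
        have h2 := hNc t ht
        linarith) hL hwa t ht
    linarith
  -- A continuity argument closes the loop: while `N ≤ k / 4` the damping `κ - 2 N` is positive, the
  -- energy bounds `w²`, and then the source is too weak for `N` to reach the level `k / 4`.
  refine hsmall b ⟨hab, le_rfl⟩ fun t ht => ?_
  by_contra! hcon
  obtain ⟨t₀, ht₀, hz, hlt⟩ := exists_first_zero (f := fun t => (x t).2.1 - k / 4) ht.1
    (((IsTauSolution.continuousOn_N h).mono (Icc_subset_Icc_right ht.2)).sub continuousOn_const)
    (by linarith) (by linarith)
  have ht₀I : t₀ ∈ Icc a b := ⟨ht₀.1.le, ht₀.2.trans ht.2⟩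
  have hNt : (x t₀).2.1 = k / 4 := by linarith
  have hw := hsmall t₀ ht₀I (fun s hs => by
    rcases hs.2.lt_or_eq with h1 | h1
    · linarith [hlt s ⟨hs.1, h1⟩]
    · rw [h1]; exact hNt.le) t₀ ⟨ht₀.1.le, le_rfl⟩
  have hder := nonneg_of_hasDerivAt_of_le (IsTauSolution.N_eq' h ht₀I) ht₀.1 fun s hs => by
    rw [hNt]; linarith [hlt s hs]
  have hrm : (x a).1 ≤ (x t₀).1 := IsTauSolution.r_monotoneOn h hN ⟨le_rfl, hab⟩ ht₀I ht₀I.1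
  have hrp : 0 < (x a).1 := h.r_pos a ⟨le_rfl, hab⟩
  have hr2 : 1 / 2 ≤ (x t₀).1 ^ 2 := by nlinarith
  have hR := hr t₀ ht₀I
  have hR1 := hR.trans (min_le_left _ _)
  have hR2 := hR.trans (min_le_right _ _)
  have hκt := hκ' t₀ ht₀I
  rw [hNt] at hder
  have := C.force_lt (by linarith : (1 : ℝ) / 2 ≤ (x t₀).1 ^ 2) hR1 hR2 hw
  nlinarith

/-- The open set of points from which escaping solutions go beyond `r² = s₁ + k²/16`. -/
def nearFixed (k : ℝ) : Set Phase :=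
  {p | p.2.1 < k / 4 ∧ (p.1 * p.2.2.2.1) ^ 2 + p.2.2.1 ^ 2 - p.2.2.1 ^ 4 / 2 < k ^ 2 / 128 ∧
    1 / 2 < p.1 ^ 2}

theorem isOpen_nearFixed (k : ℝ) : IsOpen (nearFixed k) := by
  have h1 : IsOpen {p : Phase | p.2.1 < k / 4} := isOpen_lt (by fun_prop) (by fun_prop)
  have h2 : IsOpen {p : Phase | (p.1 * p.2.2.2.1) ^ 2 + p.2.2.1 ^ 2 - p.2.2.1 ^ 4 / 2 < k ^ 2 / 128} :=
    isOpen_lt (by fun_prop) (by fun_prop)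
  have h3 : IsOpen {p : Phase | 1 / 2 < p.1 ^ 2} := isOpen_lt (by fun_prop) (by fun_prop)
  exact h1.inter (h2.inter h3)

/-- Suppose `r²` never exceeds the bound while `N > 0`. Since `w` stays small after the passage near
the fixed point, the escape must occur through `r² > s₁`. Beyond that radius `N` cannot vanish,
because at a zero of `N` the constraint would give `(1 - w²)² > 1` with `w² < 1`. The solution would
thus be global and converge to `r = √s₁`, although its increasing radius has already passed that
value. -/
theorem exists_large_radius {s₁ s₂ k T : ℝ} (C : Consts Λ s₁ s₂ k) {p : Phase}
    (h0 : Admissible Λ s₁ p) (hE : Escape Λ s₁ p) {y : ℝ → Phase} (hT : 0 ≤ T) (hy0 : y 0 = p)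
    (hy : IsSolOn (tauField Λ) tauDom y (Icc 0 T))
    (hreg : ∀ t ∈ Icc 0 T, 0 < (y t).2.1 ∧ (y t).1 ^ 2 < s₁ ∧ (y t).2.2.1 ^ 2 < 1)
    (hnear : y T ∈ nearFixed k) :
    ∃ t x, 0 ≤ t ∧ x 0 = p ∧ IsSolOn (tauField Λ) tauDom x (Icc 0 t) ∧ (∀ s ∈ Icc 0 t, 0 < (x s).2.1) ∧
      min s₂ (s₁ + k ^ 2 / 16) < (x t).1 ^ 2 := by
  by_contra! hcon
  have hk := C.k_pos
  have hk1 := C.k_le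
  have hs₁ : s₁ < min s₂ (s₁ + k ^ 2 / 16) := lt_min C.lt (by have := pow_pos hk 2; linarith)
  have agree : ∀ b x, 0 ≤ b → b ≤ T → x 0 = p → IsSolOn (tauField Λ) tauDom x (Icc 0 b) →
      x b = y b := fun b x h1 h2 h3 hx =>
    IsSolOn.eqOn isOpen_tauDom (contDiffOn_tauField Λ) hx (hy.mono (Icc_subset_Icc_right h2))
      ⟨le_rfl, h1⟩ (h3.trans hy0.symm) ⟨h1, le_rfl⟩
  have hwle : ∀ b x, 0 ≤ b → x 0 = p → IsSolOn (tauField Λ) tauDom x (Icc 0 b) →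
      (∀ t ∈ Ico 0 b, 0 < (x t).2.1) → 0 ≤ (x b).2.1 → (x b).1 ^ 2 ≤ min s₂ (s₁ + k ^ 2 / 16) →
      (x b).2.2.1 ^ 2 < 1 := by
    intro b x hb hx0 hx hpos hNb hrb
    rcases le_total b T with hbT | hbT
    · rw [agree b x hb hbT hx0 hx]; exact (hreg b ⟨hb, hbT⟩).2.2
    · have hxT : x T = y T := agree T x hT le_rfl hx0 (hx.mono (Icc_subset_Icc_right hbT))
      subst hx0
      have hts := h0.tauSol hb hx
      have hN : ∀ t ∈ Icc 0 b, 0 ≤ (x t).2.1 := fun t ht => by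
        rcases ht.2.lt_or_eq with h1 | h1
        · exact (hpos t ⟨ht.1, h1⟩).le
        · rw [h1]; exact hNb
      have hrm : MonotoneOn (fun t => (x t).1) (Icc 0 b) := IsTauSolution.r_monotoneOn hts hN
      have hr : ∀ t ∈ Icc 0 b, (x t).1 ^ 2 ≤ min s₂ (s₁ + k ^ 2 / 16) := fun t ht => by
        have h1 : (x t).1 ≤ (x b).1 := hrm ht ⟨hb, le_rfl⟩ ht.2
        have h2 : 0 < (x t).1 := hts.r_pos t ht
        nlinarith
      have hκ : k ≤ (x T).2.2.2.2 := IsTauSolution.κ_ge C hts (by linarith [h0.κ_ge])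
        (fun t ht => (hr t ht).trans (min_le_left _ _)) T ⟨hT, hbT⟩
      have hw1 := (hreg T ⟨hT, le_rfl⟩).2.2
      rw [← hxT] at hnear hw1
      have := TauSol.w_small C hbT (hts.mono (Icc_subset_Icc_left hT)) hκ hnear.1 hnear.2.1.le hw1
        hnear.2.2.le (fun t ht => hN t ⟨hT.trans ht.1, ht.2⟩) (fun t ht => hr t ⟨hT.trans ht.1, ht.2⟩)
        b ⟨hbT, le_rfl⟩
      nlinarith
  obtain ⟨τ, x', hτ, hx0', hx', hN', hout⟩ := hE
  have hr' : s₁ < (x' τ).1 ^ 2 := by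
    refine hout.resolve_right (not_lt.2 ?_)
    exact (hwle τ x' hτ hx0' hx' (fun t ht => hN' t (Ico_subset_Icc_self ht))
      (hN' τ ⟨hτ, le_rfl⟩).le (hcon τ x' hτ hx0' hx' hN')).le
  obtain ⟨x, hx0, hx, hpos⟩ := exists_global_of_region C h0 (fun T x hT hx0 hx hp => by
    have h1 := hcon T x hT hx0 hx hp
    have h2 := hwle T x hT hx0 hx (fun t ht => hp t (Ico_subset_Icc_self ht)) (hp T ⟨hT, le_rfl⟩).le h1
    exact ⟨h1.trans (min_le_left _ _), by linarith⟩) fun T T' x hT hTT' hx0 hx => by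
      by_contra! hNT
      subst hx0
      have hxT := hx.mono (Icc_subset_Icc_right hTT'.le)
      have hts := h0.tauSol hT hxT
      obtain ⟨t, ht, ht0, hlt⟩ := exists_first_zero (f := fun t => -(x t).2.1) hT
        (IsTauSolution.continuousOn_N hts).neg (neg_neg_of_pos h0.N_pos) (neg_nonneg.2 hNT)
      have hN0 : (x t).2.1 = 0 := neg_eq_zero.1 ht0
      have hpos : ∀ s ∈ Ico 0 t, 0 < (x s).2.1 := fun s hs => neg_lt_zero.1 (hlt s hs)
      have htI : t ∈ Icc 0 T := ⟨ht.1.le, ht.2⟩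
      have hsol : ∀ s ≤ t, IsSolOn (tauField Λ) tauDom x (Icc 0 s) := fun s hs =>
        hxT.mono (Icc_subset_Icc_right (hs.trans ht.2))
      have hrt : (x t).1 ^ 2 ≤ min s₂ (s₁ + k ^ 2 / 16) := by
        have hc : Tendsto (fun s => (x s).1 ^ 2) (𝓝[<] t) (𝓝 ((x t).1 ^ 2)) :=
          (((hts.r_eq t htI).continuousAt.pow 2).tendsto).mono_left nhdsWithin_le_nhds
        refine le_of_tendsto hc ?_
        filter_upwards [Ioo_mem_nhdsLT ht.1] with s hs
        exact hcon s x hs.1.le rfl (hsol s hs.2.le) fun u hu => hpos u ⟨hu.1, hu.2.trans_lt hs.2⟩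
      have hwt := hwle t x ht.1.le rfl (hsol t le_rfl) hpos hN0.ge hrt
      have hτt : τ < t := by
        by_contra! hle
        have h1 : x t = x' t := IsSolOn.eqOn isOpen_tauDom (contDiffOn_tauField Λ) (hsol t le_rfl)
          (hx'.mono (Icc_subset_Icc_right hle)) ⟨le_rfl, ht.1.le⟩ hx0'.symm ⟨ht.1.le, le_rfl⟩
        have h2 := hN' t ⟨ht.1.le, hle⟩
        rw [← h1, hN0] at h2
        exact lt_irrefl _ h2
      have h1 : x τ = x' τ := IsSolOn.eqOn isOpen_tauDom (contDiffOn_tauField Λ) (hsol τ hτt.le)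
        hx' ⟨le_rfl, hτ⟩ hx0'.symm ⟨hτ, le_rfl⟩
      have hmono : (x τ).1 ≤ (x t).1 := IsTauSolution.r_monotoneOn
        (hts.mono (Icc_subset_Icc_right ht.2)) (fun s hs => by
          rcases hs.2.lt_or_eq with h | h
          · exact (hpos s ⟨hs.1, h⟩).le
          · rw [h]; exact hN0.ge) ⟨hτ, hτt.le⟩ ⟨ht.1.le, le_rfl⟩ hτt.le
      have hrτ : 0 < (x τ).1 := hts.r_pos τ ⟨hτ, hτt.le.trans ht.2⟩
      rw [← h1] at hr'
      have h2 := C.one_lt (hr'.trans_le (by gcongr : (x τ).1 ^ 2 ≤ (x t).1 ^ 2))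
        (hrt.trans (min_le_left _ _))
      have h3 := IsTauSolution.f_sq_of_N_zero hts htI hN0
      have h4 : 0 ≤ 2 * (x t).1 ^ 2 * (x t).2.2.2.1 ^ 2 := by positivity
      nlinarith [sq_nonneg (x t).2.2.1]
  subst hx0
  have hsub : ∀ b, IsSolOn (tauField Λ) tauDom x (Icc 0 b) := fun b =>
    hx.isSolOn.mono Icc_subset_Ici_self
  have hr : ∀ t, 0 ≤ t → (x t).1 ^ 2 ≤ min s₂ (s₁ + k ^ 2 / 16) := fun t ht =>
    hcon t x ht rfl (hsub t) fun s hs => hpos s hs.1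
  have hlim := (hx.tendsto_fixed C h0 hpos (fun t ht => (hr t ht).trans (min_le_left _ _))
    fun t ht => by
      have := hwle t x ht rfl (hsub t) (fun s hs => hpos s hs.1) (hpos t ht).le (hr t ht)
      linarith).1
  have h1 : x τ = x' τ := IsSolOn.eqOn isOpen_tauDom (contDiffOn_tauField Λ) (hsub τ)
        hx' ⟨le_rfl, hτ⟩ hx0'.symm ⟨hτ, le_rfl⟩
  have h2 : (x τ).1 ≤ √s₁ := ge_of_tendsto hlim (by
    filter_upwards [eventually_ge_atTop τ] with t ht
    exact IsTauSolution.r_monotoneOn (hx.mono (J := Icc τ t) fun s hs => hτ.trans hs.1)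
      (fun s hs => (hpos s (hτ.trans hs.1)).le) ⟨le_rfl, ht⟩ ⟨ht, le_rfl⟩ ht)
  have h3 : √s₁ ^ 2 = s₁ := Real.sq_sqrt (by linarith [C.one_le])
  have h4 : 0 < (x τ).1 := hx.r_pos τ hτ
  rw [← h1] at hr'
  nlinarith

/-- The limit solution has `r_c = √s₁`. By continuous dependence, nearby parameters enter `nearFixed
k` before leaving the region. Those among them that escape have `r_c` at least `√(min s₂ (s₁ + k² /
16))`, whose distance from `√s₁` does not depend on the parameter. -/
theorem LocalFamily.not_continuousWithinAt {a s₁ s₂ k : ℝ} {A w : ℝ → ℝ → ℝ}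
    (F : LocalFamily Λ a A w) (C : Consts Λ s₁ s₂ k) (hΛ : Λ < 1 / 4) {lam : ℝ} (hlam : 0 < lam)
    {x : ℝ → Phase} (hx0 : x 0 = startData Λ a A w lam) (hx : TauSol Λ (Ici 0) x)
    (hreg : ∀ t, 0 ≤ t → 0 < (x t).2.1 ∧ (x t).1 ^ 2 ≤ s₁ ∧ (x t).2.2.1 ^ 2 ≤ 1)
    (hE : ∃ᶠ l in 𝓝[Ici 0] lam, Escape Λ s₁ (startData Λ a A w l)) :
    ¬ ContinuousWithinAt (crashRadius Λ) (Ici 0) lam := by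
  intro hcontr
  have hk := C.k_pos
  have hs₁ : s₁ < min s₂ (s₁ + k ^ 2 / 16) := lt_min C.lt (by have := pow_pos hk 2; linarith)
  have hcr := (F.isOscillating C hΛ hlam.le hx0 hx hreg).2
  have hadm : Admissible Λ s₁ (x 0) := hx0 ▸ F.admissible C hΛ hlam.le
  obtain ⟨hr, hN, hw, hU, -⟩ := hx.tendsto_fixed C hadm (fun t ht => (hreg t ht).1)
    (fun t ht => (hreg t ht).2.1.trans C.lt.le) (fun t ht => by linarith [(hreg t ht).2.2])
  have hsq : √s₁ ^ 2 = s₁ := Real.sq_sqrt (by linarith [C.one_le])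
  have hev : ∀ᶠ t in atTop, x t ∈ nearFixed k := by
    have h1 := hN.eventually (gt_mem_nhds (show 0 < k / 4 by linarith))
    have h2 := (((hr.mul hU).pow 2).add (hw.pow 2)).sub ((hw.pow 4).div_const 2)
    rw [show (√s₁ * 0) ^ 2 + 0 ^ 2 - 0 ^ 4 / 2 = (0 : ℝ) by ring] at h2
    have h3 := h2.eventually (gt_mem_nhds (show 0 < k ^ 2 / 128 by positivity))
    have h4 := (hr.pow 2).eventually (lt_mem_nhds (show 1 / 2 < √s₁ ^ 2 by
      rw [hsq]; linarith [C.one_le]))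
    filter_upwards [h1, h3, h4] with t a1 a2 a3 using ⟨a1, a2, a3⟩
  have hev2 : ∀ᶠ t in atTop, (x t).2.2.1 ^ 2 < 1 := by
    have := hw.pow 2
    rw [zero_pow two_ne_zero] at this
    exact this.eventually (gt_mem_nhds one_pos)
  obtain ⟨T, hnear, hwT, hT⟩ := (hev.and (hev2.and (eventually_ge_atTop 0))).exists
  have hxT : TauSol Λ (Icc 0 T) x := hx.mono Icc_subset_Ici_self
  have hw0 : (x 0).2.2.1 ^ 2 < 1 := hx0 ▸ F.w_sq_lt hlam
  have hwlt := hxT.w_sq_lt (fun t ht => (hreg t ht.1).2.2) hw0 hwT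
  have hrlt : ∀ t ∈ Icc 0 T, (x t).1 ^ 2 < s₁ := by
    intro t ht
    have hmono : StrictMonoOn (fun t => (x t).1) (Ici 0) := by
      refine strictMonoOn_of_deriv_pos (convex_Ici 0) (IsTauSolution.continuousOn_r hx) fun t ht => ?_
      have ht' : t ∈ Ici 0 := interior_subset ht
      rw [(hx.r_eq t ht').deriv]
      exact mul_pos (hx.r_pos t ht') (hreg t ht').1
    have h1 : (x t).1 < (x (t + 1)).1 := hmono ht.1 (by have := ht.1; rw [mem_Ici]; linarith) (by linarith)
    have h2 := (hreg (t + 1) (by linarith [ht.1])).2.1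
    have h3 : 0 < (x t).1 := hx.r_pos t ht.1
    nlinarith
  have hO : IsOpen {q : Phase | 0 < q.2.1 ∧ q.1 ^ 2 < s₁ ∧ q.2.2.1 ^ 2 < 1} := by
    have h1 : IsOpen {q : Phase | 0 < q.2.1} := isOpen_lt (by fun_prop) (by fun_prop)
    exact h1.inter (isOpen_region s₁)
  have hdep := hxT.isSolOn.eventually_mem hT hO (isOpen_nearFixed k)
    (fun t ht => ⟨(hreg t ht.1).1, hrlt t ht, hwlt t ht⟩) hnear
  rw [hx0] at hdep
  have hdep' := (F.continuousOn_startData lam hlam.le).eventually hdep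
  have hlt : crashRadius Λ lam < ENNReal.ofReal √(min s₂ (s₁ + k ^ 2 / 16)) := by
    rw [hcr]
    have : √s₁ < √(min s₂ (s₁ + k ^ 2 / 16)) := Real.sqrt_lt_sqrt (by linarith [C.one_le]) hs₁
    exact (ENNReal.ofReal_lt_ofReal_iff_of_nonneg (Real.sqrt_nonneg _)).2 this
  have hcev := hcontr.eventually (gt_mem_nhds hlt)
  obtain ⟨l, hEl, hyl, hcl, hl⟩ := (hE.and_eventually (hdep'.and (hcev.and self_mem_nhdsWithin))).exists
  obtain ⟨y, hy0, hy, hyreg, hynear⟩ := hyl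
  have hadml := F.admissible C hΛ hl
  obtain ⟨t, z, ht, hz0, hz, hzN, hzr⟩ := exists_large_radius C hadml hEl hT hy0 hy hyreg hynear
  have ht0 : 0 < t := by
    refine lt_of_le_of_ne ht fun h => ?_
    rw [← h, hz0] at hzr
    linarith [hadml.r_lt]
  have hle := F.le_crashRadius hl ht0 hz0 hz hzN
  have hzp : 0 < (z t).1 := (hz t ⟨ht, le_rfl⟩).2
  have h1 : √(min s₂ (s₁ + k ^ 2 / 16)) ≤ (z t).1 :=
    Real.sqrt_le_iff.2 ⟨hzp.le, hzr.le⟩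
  exact absurd hcl (not_lt.2 ((ENNReal.ofReal_le_ofReal h1).trans hle))

/-- The solution with `lam = 0` escapes. -/
theorem LocalFamily.escape_zero {a s₁ s₂ k : ℝ} {A w : ℝ → ℝ → ℝ}
    (F : LocalFamily Λ a A w) (C : Consts Λ s₁ s₂ k) (hΛ : Λ < 1 / 4) :
    Escape Λ s₁ (startData Λ a A w 0) := by
  have hΛ0 := C.nonneg
  have hreg := F.isRegularSolution le_rfl
  -- Uniqueness identifies the member with `lam = 0` with the explicit vacuum solution `w = 1`, `A =
  -- 1 - Λ r² / 3`.
  have hvac : IsRegularSolution Λ 0 1 (fun r => 1 - Λ * r ^ 2 / 3) (fun _ => 1) := by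
    refine .of_contDiffAt one_pos (fun r _ => by fun_prop) (fun r _ => by fun_prop) (fun r hr => ?_)
      (fun r hr => ?_) (fun r hr => ?_) (by simp) rfl (by simp) (by simp)
    · have : r ^ 2 ≤ 1 := by nlinarith [hr.1, hr.2]
      nlinarith
    · have h1 : HasDerivAt (fun r : ℝ => 1 - Λ * r ^ 2 / 3) (-(Λ * (2 * r) / 3)) r := by
        have := (((hasDerivAt_pow 2 r).const_mul Λ).div_const 3).const_sub 1
        simpa using this
      rw [h1.deriv, Phi]
      simp
      ring
    · simp
  obtain ⟨h1, h2, h3⟩ := F.radius_mem le_rfl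
  have hw1 : ∀ r ∈ Ioo 0 (2 * a / (1 + 0)), w 0 r = 1 := fun r hr =>
    (hreg.unique hvac hr.1.le hr.2 (by
      have := F.a_le
      have := hr.2
      rw [add_zero, div_one] at this
      linarith)).2
  have hd : deriv (w 0) (a / (1 + 0)) = 0 := by
    have : w 0 =ᶠ[𝓝 (a / (1 + 0))] fun _ => 1 := by
      filter_upwards [isOpen_Ioo.mem_nhds (show a / (1 + 0) ∈ Ioo 0 (2 * a / (1 + 0)) from ⟨h1, h3⟩)]
        with r hr using hw1 r hr
    rw [this.deriv_eq, deriv_const]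
  refine escape_of_vacuum C (F.admissible C hΛ le_rfl) ?_ ?_
  · exact hw1 _ ⟨h1, h3⟩
  · simp only [startData, phaseOf, hd, mul_zero]

/-- If some solution crashes, there is an oscillating solution at which `r_c` is discontinuous. -/
theorem LocalFamily.exists_oscillating {a s₁ s₂ k : ℝ} {A w : ℝ → ℝ → ℝ}
    (F : LocalFamily Λ a A w) (C : Consts Λ s₁ s₂ k) (hΛ : Λ < 1 / 4) {lam₀ : ℝ} (hlam₀ : 0 ≤ lam₀)
    (hcrash : Crash Λ s₁ (startData Λ a A w lam₀)) :
    ∃ lam, 0 ≤ lam ∧ IsOscillating Λ lam ∧ ¬ ContinuousWithinAt (crashRadius Λ) (Ici 0) lam := by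
  -- At the supremum of `S`, escape would spread to larger parameters by openness. A crash would
  -- spread to escaping parameters accumulating there and contradict exclusivity. So neither
  -- happens.
  set S : Set ℝ := {l | 0 ≤ l ∧ l ≤ lam₀ ∧ Escape Λ s₁ (startData Λ a A w l)} with hS
  have h0S : (0 : ℝ) ∈ S := ⟨le_rfl, hlam₀, F.escape_zero C hΛ⟩
  have hbdd : BddAbove S := ⟨lam₀, fun l hl => hl.2.1⟩
  set lam := sSup S with hlamdef
  have hlam0 : 0 ≤ lam := le_csSup hbdd h0S
  have hlamle : lam ≤ lam₀ := csSup_le ⟨0, h0S⟩ fun l hl => hl.2.1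
  have hcont := F.continuousOn_startData lam hlam0
  have hnE : ¬ Escape Λ s₁ (startData Λ a A w lam) := by
    intro hE
    have hlt : lam < lam₀ := lt_of_le_of_ne hlamle fun h => by
      rw [h] at hE; exact hcrash.not_escape hE
    have hev : ∀ᶠ l in 𝓝[>] lam, Escape Λ s₁ (startData Λ a A w l) :=
      nhdsWithin_mono lam (fun l hl => hlam0.trans (le_of_lt hl)) (hcont.eventually hE.eventually)
    obtain ⟨l, hl1, hl2⟩ := (hev.and (Ioo_mem_nhdsGT hlt)).exists
    exact absurd (le_csSup hbdd (show l ∈ S from ⟨hlam0.trans hl2.1.le, hl2.2.le, hl1⟩))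
      (not_le.2 hl2.1)
  have hfreq : ∃ᶠ l in 𝓝[Ici 0] lam, Escape Λ s₁ (startData Λ a A w l) := by
    have h1 : lam ∈ closure S := csSup_mem_closure ⟨0, h0S⟩ hbdd
    rw [mem_closure_iff_frequently] at h1
    rw [frequently_nhdsWithin_iff]
    exact h1.mono fun l hl => ⟨hl.2.2, hl.1⟩
  have hnC : ¬ Crash Λ s₁ (startData Λ a A w lam) := fun hc => by
    obtain ⟨l, h1, h2⟩ := (hfreq.and_eventually (hcont.eventually hc.eventually)).exists
    exact h2.not_escape h1
  have hpos : 0 < lam := lt_of_le_of_ne hlam0 fun h => hnE (h ▸ h0S.2.2)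
  obtain ⟨x, hx0, hx, hreg⟩ := exists_global_of_not C (F.admissible C hΛ hlam0) (F.w_sq_lt hpos) hnC hnE
  exact ⟨lam, hlam0, (F.isOscillating C hΛ hlam0 hx0 hx hreg).1,
    F.not_continuousWithinAt C hΛ hpos hx0 hx hreg hfreq⟩

end EYM

/-! ### Crash for large `lam` -/

namespace EYM

theorem eventually_nonpos_of_hasDerivAt {g : ℝ → ℝ} {g' t : ℝ} (h : HasDerivAt g g' t) (hle : g t ≤ 0)
    (hneg : g t = 0 → g' < 0) : ∀ᶠ s in 𝓝[>] t, g s ≤ 0 := by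
  rcases hle.lt_or_eq with hlt | heq
  · filter_upwards [nhdsWithin_le_nhds (h.continuousAt.eventually_lt_const hlt)] with s hs using hs.le
  · have h1 := (hasDerivWithinAt_iff_tendsto_slope' (s := Ioi t) (by simp)).1 h.hasDerivWithinAt
    filter_upwards [h1.eventually (gt_mem_nhds (hneg heq)), self_mem_nhdsWithin] with s hs hts
    rw [slope_def_field, heq, sub_zero] at hs
    have : 0 < s - t := sub_pos.2 hts
    by_contra! hcon
    exact absurd hs (not_lt.2 (div_nonneg hcon.le this.le))

/-- A finite system of barriers: if all `g i` start nonpositive, and none of them can cross `0` upwards while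
all are nonpositive, then they remain nonpositive. -/
theorem nonpos_of_barriers {ι : Type*} [Finite ι] {g g' : ι → ℝ → ℝ} {a b : ℝ}
    (hg : ∀ i, ∀ t ∈ Icc a b, HasDerivAt (g i) (g' i t) t) (ha : ∀ i, g i a ≤ 0)
    (h : ∀ t ∈ Ico a b, (∀ j, g j t ≤ 0) → ∀ i, g i t = 0 → g' i t < 0) :
    ∀ t ∈ Icc a b, ∀ i, g i t ≤ 0 := by
  have hcl : IsClosed ({t | ∀ i, g i t ≤ 0} ∩ Icc a b) := by
    have : {t | ∀ i, g i t ≤ 0} ∩ Icc a b = Icc a b ∩ ⋂ i, (Icc a b ∩ g i ⁻¹' Iic 0) := by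
      ext t
      simp only [mem_inter_iff, mem_ofPred_eq, mem_iInter, mem_preimage, mem_Iic]
      exact ⟨fun ht => ⟨ht.2, fun i => ⟨ht.2, ht.1 i⟩⟩, fun ht => ⟨fun i => (ht.2 i).2, ht.1⟩⟩
    rw [this]
    exact isClosed_Icc.inter (isClosed_iInter fun i =>
      (HasDerivAt.continuousOn (hg i)).preimage_isClosed_of_isClosed isClosed_Icc isClosed_Iic)
  refine hcl.Icc_subset_of_forall_mem_nhdsWithin ha fun t ht => ?_
  exact eventually_all.2 fun i => eventually_nonpos_of_hasDerivAt (hg i t (Ico_subset_Icc_self ht.2))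
    (ht.1 i) (h t ht.2 ht.1 i)

variable {Λ : ℝ}

/-- Lower and upper barrier conditions for `d = u/z - N`, in polynomial form. -/
theorem slope_deriv {Λ r N κ z W V c : ℝ} {u : ℝ} (hW : W = 1 - r * z) (hu : u = (N + c) * z)
    (hV : u ^ 2 = 4 * W * V) (hW0 : W ≠ 0) :
    (-2 * r * V + 2 * W * z - (κ - N) * u) - ((-κ * N + (1 - Λ * r ^ 2 - z ^ 2)) * z +
      (N + c) * (u - N * z)) = z * (1 + z ^ 2 + Λ * r ^ 2 + N ^ 2 - κ * c - c ^ 2 - 2 * (r * z) -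
        r * z * (N + c) ^ 2 / (2 * W)) := by
  have hV' : V = u ^ 2 / (4 * W) := by rw [hV]; field_simp
  rw [hV', hu]
  have : W * (1 / W) = 1 := by field_simp
  field_simp
  rw [hW]
  ring

set_option maxHeartbeats 1000000 in
/-- The estimates for solutions that are small in `r` while `(1-w²)/r` grows from small values. -/
theorem growth_estimates {r N κ z u W V : ℝ → ℝ} {b z₀ : ℝ} (hΛ0 : 0 ≤ Λ) (hΛ : Λ < 1 / 4)
    (hb : 0 ≤ b)
    (hr : ∀ t ∈ Icc 0 b, HasDerivAt r (r t * N t) t)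
    (hN : ∀ t ∈ Icc 0 b, HasDerivAt N (-κ t * N t + (1 - Λ * r t ^ 2 - z t ^ 2)) t)
    (hκ : ∀ t ∈ Icc 0 b, HasDerivAt κ (1 + 2 * V t - κ t ^ 2 - 2 * Λ * r t ^ 2) t)
    (hz : ∀ t ∈ Icc 0 b, HasDerivAt z (u t - N t * z t) t)
    (hu : ∀ t ∈ Icc 0 b, HasDerivAt u (-2 * r t * V t + 2 * W t * z t - (κ t - N t) * u t) t)
    (hW : ∀ t ∈ Icc 0 b, W t = 1 - r t * z t) (hV : ∀ t ∈ Icc 0 b, u t ^ 2 = 4 * W t * V t)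
    (hV0 : ∀ t ∈ Icc 0 b, 0 ≤ V t)
    (hrpos : ∀ t ∈ Icc 0 b, 0 < r t) (hNpos : ∀ t ∈ Icc 0 b, 0 ≤ N t)
    (hz₀ : 0 < z₀) (hrb : r 0 * Real.exp (13 / 10 * b) ≤ 1 / 10000)
    (i1 : N 0 ≤ 11 / 10) (i2 : 9 / 10 ≤ κ 0) (i3 : κ 0 ≤ 2) (i4 : z₀ ≤ z 0) (i5 : z 0 ≤ 1)
    (i6 : (N 0 + 1 / 100) * z 0 ≤ u 0) (i7 : u 0 ≤ (N 0 + 9) * z 0) :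
    ∀ t ∈ Icc 0 b, r t ≤ 1 / 10000 ∧ z₀ * Real.exp (t / 200) ≤ z t ∧ z t < 7 := by
  have hE : ∀ c t : ℝ, HasDerivAt (fun t => Real.exp (c * t)) (Real.exp (c * t) * c) t := fun c t => by
    have := ((hasDerivAt_id t).const_mul c).exp
    simpa using this
  -- The barriers support one another and are closed simultaneously. The ratio `d = u / z - N` is
  -- the logarithmic derivative of `z`; its lower bound `1 / 100` yields growth faster than `exp (t
  -- / 200)`, while its upper bound `9` controls `z z'` in the sixth barrier. There the term `-9 z²`
  -- from `9 N'` absorbs `z z' / 2`, so `z` stays below `7`. The bound `N ≤ 6 / 5` limits the growth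
  -- of `r` to `exp (13 t / 10)`, so all terms containing `r` are negligible.
  have key := nonpos_of_barriers (ι := Fin 8) (a := 0) (b := b)
    (g := ![fun t => N t - 6 / 5, fun t => 9 / 10 - κ t, fun t => κ t - 60,
      fun t => (N t + 1 / 100) * z t - u t, fun t => u t - (N t + 9) * z t,
      fun t => 9 * N t + z t ^ 2 / 4 - 57 / 5, fun t => r t - r 0 * Real.exp (13 / 10 * t),
      fun t => z₀ * Real.exp (1 / 200 * t) - z t])
    (g' := ![fun t => -κ t * N t + (1 - Λ * r t ^ 2 - z t ^ 2),
      fun t => -(1 + 2 * V t - κ t ^ 2 - 2 * Λ * r t ^ 2),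
      fun t => 1 + 2 * V t - κ t ^ 2 - 2 * Λ * r t ^ 2,
      fun t => ((-κ t * N t + (1 - Λ * r t ^ 2 - z t ^ 2)) * z t + (N t + 1 / 100) * (u t - N t * z t)) -
        (-2 * r t * V t + 2 * W t * z t - (κ t - N t) * u t),
      fun t => (-2 * r t * V t + 2 * W t * z t - (κ t - N t) * u t) -
        ((-κ t * N t + (1 - Λ * r t ^ 2 - z t ^ 2)) * z t + (N t + 9) * (u t - N t * z t)),
      fun t => 9 * (-κ t * N t + (1 - Λ * r t ^ 2 - z t ^ 2)) + 2 * z t * (u t - N t * z t) / 4,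
      fun t => r t * N t - r 0 * (Real.exp (13 / 10 * t) * (13 / 10)),
      fun t => z₀ * (Real.exp (1 / 200 * t) * (1 / 200)) - (u t - N t * z t)])
    (fun i t ht => by
      fin_cases i
      · exact (hN t ht).sub_const _
      · exact (hκ t ht).const_sub _
      · exact (hκ t ht).sub_const _
      · exact (((hN t ht).add_const _).mul (hz t ht)).sub (hu t ht)
      · exact (hu t ht).sub (((hN t ht).add_const _).mul (hz t ht))
      · refine (((hN t ht).const_mul 9).add (((hz t ht).pow 2).div_const 4)).sub_const _ |>.congr_deriv ?_
        simp
      · exact (hr t ht).sub ((hE _ t).const_mul _)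
      · exact ((hE _ t).const_mul _).sub (hz t ht))
    (fun i => by
      have hN0 := hNpos 0 ⟨le_rfl, hb⟩
      fin_cases i <;> simp
      · linarith
      · linarith
      · linarith
      · linarith
      · linarith
      · have : z 0 ^ 2 ≤ 1 := pow_le_one₀ (by linarith) i5
        linarith
      · exact i4)
    (fun t ht hj => by
      have htI := Ico_subset_Icc_self ht
      have j0 : N t - 6 / 5 ≤ 0 := hj 0
      have j1 : 9 / 10 - κ t ≤ 0 := hj 1
      have j2 : κ t - 60 ≤ 0 := hj 2
      have j3 : (N t + 1 / 100) * z t - u t ≤ 0 := hj 3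
      have j4 : u t - (N t + 9) * z t ≤ 0 := hj 4
      have j5 : 9 * N t + z t ^ 2 / 4 - 57 / 5 ≤ 0 := hj 5
      have j6 : r t - r 0 * Real.exp (13 / 10 * t) ≤ 0 := hj 6
      have j7 : z₀ * Real.exp (1 / 200 * t) - z t ≤ 0 := hj 7
      have hN0 := hNpos t htI
      have hr0 := hrpos t htI
      have hz0 : 0 < z t := by
        have : 0 < z₀ * Real.exp (1 / 200 * t) := by positivity
        linarith
      have hz2 : z t ^ 2 ≤ 456 / 10 := by linarith
      have hz7 : z t < 7 := lt_of_pow_lt_pow_left₀ 2 (by norm_num) (by linarith)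
      have hrs : r t ≤ 1 / 10000 := by
        have h1 : Real.exp (13 / 10 * t) ≤ Real.exp (13 / 10 * b) :=
          Real.exp_le_exp.2 (by linarith [ht.2])
        have h2 := mul_le_mul_of_nonneg_left h1 (hrpos 0 ⟨le_rfl, hb⟩).le
        linarith
      have hrz : r t * z t ≤ 7 / 10000 := by
        have := mul_le_mul hrs hz7.le hz0.le (by norm_num)
        linarith
      have hrz0 : 0 < r t * z t := mul_pos hr0 hz0
      have hWt := hW t htI
      have hWlo : 9993 / 10000 ≤ W t := by rw [hWt]; linarith
      have hWne : W t ≠ 0 := by linarith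
      have hVt := hV t htI
      have hVp := hV0 t htI
      have hr2 : r t ^ 2 ≤ (1 / 10000) ^ 2 := pow_le_pow_left₀ hr0.le hrs 2
      have hΛr0 : 0 ≤ Λ * r t ^ 2 := by positivity
      have hΛr : Λ * r t ^ 2 ≤ 1 / 4 * (1 / 10000) ^ 2 := mul_le_mul hΛ.le hr2 (sq_nonneg _) (by norm_num)
      have hu0 : 0 ≤ u t := by
        have := mul_nonneg (show 0 ≤ N t + 1 / 100 by linarith) hz0.le
        linarith
      intro i
      fin_cases i
      · intro h0
        have h0' : N t = 6 / 5 := by have h1 : N t - 6 / 5 = 0 := h0; linarith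
        change -κ t * N t + (1 - Λ * r t ^ 2 - z t ^ 2) < 0
        rw [h0']
        linarith [sq_nonneg (z t)]
      · intro h0
        have h0' : κ t = 9 / 10 := by have h1 : 9 / 10 - κ t = 0 := h0; linarith
        change -(1 + 2 * V t - κ t ^ 2 - 2 * Λ * r t ^ 2) < 0
        rw [h0']
        linarith
      · intro h0
        have h0' : κ t = 60 := by have h1 : κ t - 60 = 0 := h0; linarith
        change 1 + 2 * V t - κ t ^ 2 - 2 * Λ * r t ^ 2 < 0
        have h1 : u t ≤ 51 / 5 * z t := by
          have := mul_le_mul_of_nonneg_right (show N t + 9 ≤ 51 / 5 by linarith) hz0.le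
          linarith
        have h2 : u t ^ 2 ≤ (51 / 5 * z t) ^ 2 := by gcongr
        have h3 : V t ≤ 1700 := by
          have := mul_le_mul_of_nonneg_right hWlo hVp
          linarith
        rw [h0']
        linarith
      · intro h0
        have h0' : u t = (N t + 1 / 100) * z t := by
          have h1 : (N t + 1 / 100) * z t - u t = 0 := h0
          linarith
        change ((-κ t * N t + (1 - Λ * r t ^ 2 - z t ^ 2)) * z t + (N t + 1 / 100) * (u t - N t * z t)) -
          (-2 * r t * V t + 2 * W t * z t - (κ t - N t) * u t) < 0
        -- On the lower barrier `c = 1 / 100` the bound `κ ≤ 60` gives `κ c ≤ 3 / 5`, which the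
        -- leading `1` outweighs.
        have h1 := slope_deriv (Λ := Λ) (κ := κ t) hWt h0' hVt hWne
        have h2 : r t * z t * (N t + 1 / 100) ^ 2 / (2 * W t) ≤ 1 / 100 := by
          rw [div_le_iff₀ (by linarith)]
          have h3 : (N t + 1 / 100) ^ 2 ≤ (6 / 5 + 1 / 100) ^ 2 :=
            pow_le_pow_left₀ (by linarith) (by linarith) 2
          have := mul_le_mul hrz h3 (sq_nonneg _) (by norm_num)
          linarith
        have h3 : 0 < z t * (1 + z t ^ 2 + Λ * r t ^ 2 + N t ^ 2 - κ t * (1 / 100) - (1 / 100) ^ 2 -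
            2 * (r t * z t) - r t * z t * (N t + 1 / 100) ^ 2 / (2 * W t)) := by
          refine mul_pos hz0 ?_
          linarith [sq_nonneg (z t), sq_nonneg (N t)]
        linarith
      · intro h0
        have h0' : u t = (N t + 9) * z t := by
          have h1 : u t - (N t + 9) * z t = 0 := h0
          linarith
        change (-2 * r t * V t + 2 * W t * z t - (κ t - N t) * u t) -
          ((-κ t * N t + (1 - Λ * r t ^ 2 - z t ^ 2)) * z t + (N t + 9) * (u t - N t * z t)) < 0
        -- On the upper barrier `c = 9` the term `-c² = -81` outweighs `z² < 46` and the remaining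
        -- positive terms.
        have h1 := slope_deriv (Λ := Λ) (κ := κ t) hWt h0' hVt hWne
        have h2 : 0 ≤ r t * z t * (N t + 9) ^ 2 / (2 * W t) := by positivity
        have h3 : N t ^ 2 ≤ (6 / 5) ^ 2 := pow_le_pow_left₀ hN0 (by linarith) 2
        rw [h1]
        refine mul_neg_of_pos_of_neg hz0 ?_
        linarith
      · intro h0
        have h0' : 9 * N t + z t ^ 2 / 4 = 57 / 5 := by
          have h1 : 9 * N t + z t ^ 2 / 4 - 57 / 5 = 0 := h0
          linarith
        change 9 * (-κ t * N t + (1 - Λ * r t ^ 2 - z t ^ 2)) + 2 * z t * (u t - N t * z t) / 4 < 0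
        have h1 : z t * (u t - N t * z t) ≤ z t * (9 * z t) := by gcongr; linarith
        have h2 : 9 / 10 * N t ≤ κ t * N t := by gcongr; linarith
        linarith
      · intro h0
        have h0' : r t = r 0 * Real.exp (13 / 10 * t) := by
          have h1 : r t - r 0 * Real.exp (13 / 10 * t) = 0 := h0
          linarith
        change r t * N t - r 0 * (Real.exp (13 / 10 * t) * (13 / 10)) < 0
        rw [← mul_assoc, ← h0']
        have := mul_lt_mul_of_pos_left (show N t < 13 / 10 by linarith) hr0
        linarith
      · intro h0
        have h0' : z t = z₀ * Real.exp (1 / 200 * t) := by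
          have h1 : z₀ * Real.exp (1 / 200 * t) - z t = 0 := h0
          linarith
        change z₀ * (Real.exp (1 / 200 * t) * (1 / 200)) - (u t - N t * z t) < 0
        rw [← mul_assoc, ← h0']
        linarith)
  intro t ht
  have hj := key t ht
  have j5 : 9 * N t + z t ^ 2 / 4 - 57 / 5 ≤ 0 := hj 5
  have j6 : r t - r 0 * Real.exp (13 / 10 * t) ≤ 0 := hj 6
  have j7 : z₀ * Real.exp (1 / 200 * t) - z t ≤ 0 := hj 7
  have hN0 := hNpos t ht
  refine ⟨?_, ?_, lt_of_pow_lt_pow_left₀ 2 (by norm_num) (by linarith)⟩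
  · have h1 : Real.exp (13 / 10 * t) ≤ Real.exp (13 / 10 * b) :=
      Real.exp_le_exp.2 (by linarith [ht.2])
    have h2 := mul_le_mul_of_nonneg_left h1 (hrpos 0 ⟨le_rfl, hb⟩).le
    linarith
  · rw [show t / 200 = 1 / 200 * t by ring]; linarith

/-- For some parameter the solution crashes. -/
theorem LocalFamily.exists_crash {a s₁ s₂ k : ℝ} {A w : ℝ → ℝ → ℝ}
    (F : LocalFamily Λ a A w) (C : Consts Λ s₁ s₂ k) (hΛ : Λ < 1 / 4) :
    ∃ lam, 0 < lam ∧ Crash Λ s₁ (startData Λ a A w lam) := by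
  have ha := F.a_pos
  -- By this time the lower bound `(a / 2) exp (t / 200)` on `(1 - w²) / r` reaches the upper bound
  -- `7`. It does not depend on `lam`.
  set T := 200 * Real.log (14 / a) with hT
  have hT0 : 0 ≤ T := by
    have : 0 ≤ Real.log (14 / a) := Real.log_nonneg (by rw [le_div_iff₀ ha]; linarith [F.a_le])
    positivity
  -- Since `T` is fixed, a large `lam` starts at so small a radius that `r` stays below `1 / 10000`
  -- throughout `[0, T]`.
  have hlim : Tendsto (fun lam : ℝ => a / (1 + lam) * Real.exp (13 / 10 * T)) atTop (𝓝 0) := by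
    have h1 : Tendsto (fun lam : ℝ => a / (1 + lam)) atTop (𝓝 0) :=
      tendsto_const_nhds.div_atTop (tendsto_atTop_add_const_left _ _ tendsto_id)
    simpa using h1.mul_const (Real.exp (13 / 10 * T))
  obtain ⟨lam, hsmall, hlam9⟩ := ((hlim.eventually (gt_mem_nhds (show (0 : ℝ) < 1 / 10000 by
    norm_num))).and (eventually_ge_atTop 9)).exists
  have hlam : 0 < lam := by linarith
  have hadm := F.admissible C hΛ hlam.le
  obtain ⟨b1, b2, b3, b4⟩ := F.startData_bounds C.nonneg hΛ hlam.le
  obtain ⟨hr0, hr1, hr2⟩ := F.radius_mem hlam.le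
  have hzn := (abs_le.1 (F.z_near lam hlam.le)).2
  have hzl := F.z_large lam hlam9
  have hql := F.q_large lam hlam9
  have main : ∀ b x, 0 ≤ b → b ≤ T → x 0 = startData Λ a A w lam →
      IsSolOn (tauField Λ) tauDom x (Icc 0 b) → (∀ t ∈ Icc 0 b, 0 < (x t).2.1) →
      (x b).1 ≤ 1 / 10000 ∧ a / 2 * Real.exp (b / 200) ≤ (1 - (x b).2.2.1 ^ 2) / (x b).1 ∧
        (1 - (x b).2.2.1 ^ 2) / (x b).1 < 7 := by
    intro b x hb hbT hx0 hx hpos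
    have hts : TauSol Λ (Icc 0 b) x := Admissible.tauSol (s₁ := s₁) (hx0 ▸ hadm) hb hx
    have hrne : ∀ t ∈ Icc 0 b, (x t).1 ≠ 0 := fun t ht => (hts.r_pos t ht).ne'
    rw [← hx0] at b1 b2 b3 b4
    have e1 : (x 0).1 = a / (1 + lam) := by rw [hx0]; rfl
    have e2 : (x 0).2.2.1 = w lam (a / (1 + lam)) := by rw [hx0]; rfl
    have e3 : (x 0).2.2.2.1 = (x 0).2.1 * deriv (w lam) (a / (1 + lam)) := by rw [hx0]; rfl
    have e4 : -2 * (x 0).2.2.1 * (x 0).2.2.2.1 = (x 0).2.1 * ((-2 * w lam (a / (1 + lam)) *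
        deriv (w lam) (a / (1 + lam)) / ((1 - w lam (a / (1 + lam)) ^ 2) / (a / (1 + lam)))) *
        ((1 - w lam (a / (1 + lam)) ^ 2) / (a / (1 + lam)))) := by
      have h1 : (1 - w lam (a / (1 + lam)) ^ 2) / (a / (1 + lam)) ≠ 0 := by
        have : 0 < a / 2 := by positivity
        linarith
      rw [div_mul_cancel₀ _ h1, e2, e3]; ring
    refine growth_estimates (r := fun t => (x t).1) (N := fun t => (x t).2.1)
      (κ := fun t => (x t).2.2.2.2) (z := fun t => (1 - (x t).2.2.1 ^ 2) / (x t).1)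
      (u := fun t => -2 * (x t).2.2.1 * (x t).2.2.2.1) (W := fun t => (x t).2.2.1 ^ 2)
      (V := fun t => (x t).2.2.2.1 ^ 2) (b := b) (z₀ := a / 2) C.nonneg hΛ hb hts.r_eq
      (fun t ht => ?_) hts.κ_eq (fun t ht => ?_) (fun t ht => ?_) (fun t ht => ?_) (fun t ht => ?_)
      (fun t ht => sq_nonneg _) hts.r_pos (fun t ht => (hpos t ht).le) (by positivity) ?_ (by linarith)
      (by linarith) (by linarith) ?_ ?_ ?_ ?_ b ⟨hb, le_rfl⟩
    · simp only [div_pow]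
      exact IsTauSolution.N_eq' hts ht
    · refine ((((hts.w_eq t ht).pow 2).const_sub 1).div (hts.r_eq t ht) (hrne t ht)).congr_deriv ?_
      have := hrne t ht
      simp only [Pi.pow_apply]
      push_cast
      field_simp
    · refine (((hts.w_eq t ht).const_mul (-2)).mul (hts.U_eq t ht)).congr_deriv ?_
      have := hrne t ht
      field_simp
      ring
    · have := hrne t ht
      field_simp
      ring
    · ring
    · rw [e1]
      have : Real.exp (13 / 10 * b) ≤ Real.exp (13 / 10 * T) := Real.exp_le_exp.2 (by linarith)
      exact (mul_le_mul_of_nonneg_left this hr0.le).trans hsmall.le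
    · simp only [e1, e2]; exact hzl
    · simp only [e1, e2]; linarith
    · rw [e4, e1, e2]
      generalize -2 * w lam (a / (1 + lam)) * deriv (w lam) (a / (1 + lam)) /
        ((1 - w lam (a / (1 + lam)) ^ 2) / (a / (1 + lam))) = q at hql
      generalize (1 - w lam (a / (1 + lam)) ^ 2) / (a / (1 + lam)) = z at hzl
      rw [← mul_assoc]
      have : 0 ≤ z := by linarith
      have h1 := hql.1
      gcongr
      nlinarith
    · rw [e4, e1, e2]
      generalize -2 * w lam (a / (1 + lam)) * deriv (w lam) (a / (1 + lam)) /
        ((1 - w lam (a / (1 + lam)) ^ 2) / (a / (1 + lam))) = q at hql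
      generalize (1 - w lam (a / (1 + lam)) ^ 2) / (a / (1 + lam)) = z at hzl
      rw [← mul_assoc]
      have : 0 ≤ z := by linarith
      have h1 := hql.2
      gcongr
      nlinarith
  have hTlarge : a / 2 * Real.exp (T / 200) = 7 := by
    rw [hT, mul_div_cancel_left₀ _ (by norm_num), Real.exp_log (by positivity)]
    field_simp
    norm_num
  have hnot : ∀ x, x 0 = startData Λ a A w lam → IsSolOn (tauField Λ) tauDom x (Icc 0 T) →
      ¬ ∀ t ∈ Icc 0 T, 0 < (x t).2.1 := by
    intro x hx0 hx hpos
    obtain ⟨-, h1, h2⟩ := main T x hT0 le_rfl hx0 hx hpos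
    rw [hTlarge] at h1
    linarith
  -- Up to time `T` the radius is tiny and `(1 - w²) / r > 0`, so no escape is possible; and `N`
  -- cannot stay positive through `T`. Global existence with `N > 0` is excluded likewise, so only a
  -- crash remains.
  have hnE : ¬ Escape Λ s₁ (startData Λ a A w lam) := by
    rintro ⟨b, x, hb, hx0, hx, hpos, hout⟩
    rcases le_total b T with hbT | hbT
    · obtain ⟨h1, h2, -⟩ := main b x hb hbT hx0 hx hpos
      have h3 : 0 < (x b).1 := (hx b ⟨hb, le_rfl⟩).2
      rcases hout with h | h
      · nlinarith [C.one_le]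
      · have h4 : 0 < (1 - (x b).2.2.1 ^ 2) / (x b).1 := lt_of_lt_of_le (by positivity) h2
        have h5 := (div_pos_iff_of_pos_right h3).1 h4
        linarith
    · exact hnot x hx0 (hx.mono (Icc_subset_Icc_right hbT)) fun t ht => hpos t ⟨ht.1, ht.2.trans hbT⟩
  refine ⟨lam, hlam, ?_⟩
  by_contra hnC
  obtain ⟨x, hx0, hx, hreg⟩ := exists_global_of_not C hadm (F.w_sq_lt hlam) hnC hnE
  exact hnot x hx0 (hx.isSolOn.mono Icc_subset_Ici_self) fun t ht => (hreg t ht.1).1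

end EYM

/-! ### Collapse to the second pole after the equator -/

namespace EYM

variable {Λ : ℝ}

theorem exists_tendsto_of_monotoneOn {f : ℝ → ℝ} {a b M : ℝ} (hab : a < b) (hf : MonotoneOn f (Ico a b))
    (hM : ∀ t ∈ Ico a b, f t ≤ M) : ∃ l, Tendsto f (𝓝[<] b) (𝓝 l) ∧ ∀ t ∈ Ico a b, f t ≤ l := by
  have h1 : MonotoneOn f (Ioo a b) := hf.mono Ioo_subset_Ico_self
  have h2 : BddAbove (f '' Ioo a b) := ⟨M, by rintro _ ⟨t, ht, rfl⟩; exact hM t (Ioo_subset_Ico_self ht)⟩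
  refine ⟨_, h1.tendsto_nhdsWithin_Ioo_left (nonempty_Ioo.2 hab) h2, fun t ht => ?_⟩
  obtain ⟨s, hs1, hs2⟩ := exists_between ht.2
  have hs : s ∈ Ioo a b := ⟨ht.1.trans_lt hs1, hs2⟩
  exact (hf ht (Ioo_subset_Ico_self hs) hs1.le).trans (le_csSup h2 ⟨s, hs, rfl⟩)

theorem monotoneOn_Ico_of_hasDerivAt {f f' : ℝ → ℝ} {a b : ℝ}
    (hf : ∀ t ∈ Ico a b, HasDerivAt f (f' t) t) (h : ∀ t ∈ Ico a b, 0 ≤ f' t) :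
    MonotoneOn f (Ico a b) := fun _ hs _ ht hst =>
  monotoneOn_Icc_of_hasDerivAt (fun u hu => hf u ⟨hs.1.trans hu.1, hu.2.trans_lt ht.2⟩)
    (fun u hu => h u ⟨hs.1.trans hu.1, hu.2.trans_lt ht.2⟩) ⟨le_rfl, hst⟩ ⟨hst, le_rfl⟩ hst

/-- Bounds in the region `N < 0`. -/
theorem TauSol.collapse_bounds {s₁ s₂ k a b : ℝ} (C : Consts Λ s₁ s₂ k) {x : ℝ → Phase}
    (hx : TauSol Λ (Ico a b) x) (hN : ∀ t ∈ Ico a b, (x t).2.1 < 0) (hκ : k ≤ (x a).2.2.2.2)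
    (hr : (x a).1 ^ 2 ≤ s₁) (hw : (x a).2.2.1 ^ 2 < 1) :
    (∀ t ∈ Ico a b, (x t).1 ≤ (x a).1) ∧ (∀ t ∈ Ico a b, k ≤ (x t).2.2.2.2) ∧
      (∀ t ∈ Ico a b, (x t).2.2.1 ^ 2 < 1) ∧
      (∀ t ∈ Ico a b, ((x t).1 * (x t).2.1) ^ 2 + 2 * ((x t).1 * (x t).2.2.2.1) ^ 2 +
        2 * (-(x t).2.1 * (x t).1) * ((x t).1 * (x t).2.2.2.2) ≤ 1) := by
  have hk := C.k_pos
  have hanti : ∀ t ∈ Ico a b, (x t).1 ≤ (x a).1 := fun t ht =>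
    antitoneOn_Icc_of_hasDerivAt (fun u hu => hx.r_eq u ⟨hu.1, hu.2.trans_lt ht.2⟩)
      (fun u hu => mul_nonpos_of_nonneg_of_nonpos (hx.r_pos u ⟨hu.1, hu.2.trans_lt ht.2⟩).le
        (hN u ⟨hu.1, hu.2.trans_lt ht.2⟩).le) ⟨le_rfl, ht.1⟩ ⟨ht.1, le_rfl⟩ ht.1
  have hr2 : ∀ t ∈ Ico a b, (x t).1 ^ 2 ≤ s₂ := fun t ht => by
    have h1 : 0 < (x t).1 := hx.r_pos t ht
    have h2 := pow_le_pow_left₀ h1.le (hanti t ht) 2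
    linarith [C.lt]
  have hκt : ∀ t ∈ Ico a b, k ≤ (x t).2.2.2.2 := fun t ht =>
    IsTauSolution.κ_ge C (hx.mono (J := Icc a t) fun u hu => ⟨hu.1, hu.2.trans_lt ht.2⟩) hκ
      (fun u hu => hr2 u ⟨hu.1, hu.2.trans_lt ht.2⟩) t ⟨ht.1, le_rfl⟩
  -- For `N < 0` and `κ > 0` every term of the constraint on the right is nonnegative. Hence `(1 -
  -- w²)²` stays positive, so `w² < 1` persists, and the remaining terms are bounded by `1`.
  have hid : ∀ t ∈ Ico a b, (1 - (x t).2.2.1 ^ 2) ^ 2 = (x t).1 ^ 2 * (1 - Λ * (x t).1 ^ 2) +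
      (((x t).1 * (x t).2.1) ^ 2 + 2 * ((x t).1 * (x t).2.2.2.1) ^ 2 +
        2 * (-(x t).2.1 * (x t).1) * ((x t).1 * (x t).2.2.2.2)) := fun t ht => by
    rw [IsTauSolution.f_sq hx ht]; ring
  have hpos : ∀ t ∈ Ico a b, 0 < (x t).1 ^ 2 * (1 - Λ * (x t).1 ^ 2) := fun t ht => by
    have h1 := hr2 t ht
    have h2 := C.mul_le h1
    have h3 : 0 < (x t).1 := hx.r_pos t ht
    have h4 : 0 ≤ Λ * (x t).1 ^ 2 := mul_nonneg C.nonneg (sq_nonneg _)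
    have h5 : 0 < 1 - Λ * (x t).1 ^ 2 := by nlinarith [sq_nonneg k]
    positivity
  have hpos2 : ∀ t ∈ Ico a b, 0 ≤ ((x t).1 * (x t).2.1) ^ 2 + 2 * ((x t).1 * (x t).2.2.2.1) ^ 2 +
        2 * (-(x t).2.1 * (x t).1) * ((x t).1 * (x t).2.2.2.2) := fun t ht => by
    have h1 : 0 < (x t).1 := hx.r_pos t ht
    have h2 : 0 < -(x t).2.1 := neg_pos.2 (hN t ht)
    have h3 : 0 < (x t).2.2.2.2 := hk.trans_le (hκt t ht)
    positivity
  have hwt : ∀ t ∈ Ico a b, (x t).2.2.1 ^ 2 < 1 := by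
    intro t ht
    by_contra! hcon
    obtain ⟨s, hs, hs0, -⟩ := exists_first_zero (f := fun t => (x t).2.2.1 ^ 2 - 1) ht.1
      (((IsTauSolution.continuousOn_w hx).mono fun u hu => ⟨hu.1, hu.2.trans_lt ht.2⟩).pow 2 |>.sub
        continuousOn_const) (by linarith) (by linarith)
    have hsI : s ∈ Ico a b := ⟨hs.1.le, hs.2.trans_lt ht.2⟩
    have h1 := hid s hsI
    rw [show 1 - (x s).2.2.1 ^ 2 = 0 by linarith] at h1
    have := hpos s hsI
    have := hpos2 s hsI
    linarith
  refine ⟨hanti, hκt, hwt, fun t ht => ?_⟩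
  have h1 := hid t ht
  have h2 := hpos t ht
  have h3 := f_sq_le_one (show (x t).2.2.1 ^ 2 ≤ 3 / 2 by linarith [hwt t ht])
  linarith

/-- There is no global solution with `N < 0`. -/
theorem TauSol.not_collapse_forever {a k : ℝ} (hk : 0 < k) {x : ℝ → Phase} (hx : TauSol Λ (Ici a) x)
    (hN : ∀ t, a ≤ t → (x t).2.1 < 0) (hκ : ∀ t, a ≤ t → k ≤ (x t).2.2.2.2) : False := by
  have hM : 0 < -(x a).2.1 := neg_pos.2 (hN a le_rfl)
  set b := a + 1 / (-(x a).2.1) with hb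
  have hab : a ≤ b := by have : 0 < 1 / (-(x a).2.1) := by positivity
                         linarith
  -- With `κ > 0` the equation gives `N' ≤ -N²`, so `1 / N` grows at least at unit speed and would
  -- reach `0` by time `a + 1 / |N(a)|`.
  have hmono : MonotoneOn (fun t => 1 / (x t).2.1 - t) (Icc a b) := by
    refine monotoneOn_Icc_of_hasDerivAt (fun t ht => ((hasDerivAt_const t (1 : ℝ)).div
      (hx.N_eq t ht.1) (hN t ht.1).ne).sub (hasDerivAt_id t)) fun t ht => ?_
    have h1 := hN t ht.1
    have h2 := hκ t ht.1
    have h3 : 0 < (x t).2.1 ^ 2 := sq_pos_of_neg h1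
    rw [sub_nonneg, le_div_iff₀ h3]
    nlinarith [sq_nonneg (x t).2.2.2.1, mul_pos hk (neg_pos.2 h1)]
  have h1 := hmono ⟨le_rfl, hab⟩ ⟨hab, le_rfl⟩ hab
  simp only at h1
  have h2 : 1 / (x b).2.1 < 0 := one_div_neg.2 (hN b hab)
  have h3 : 1 / (x a).2.1 = -(1 / (-(x a).2.1)) := by rw [one_div, one_div, inv_neg, neg_neg]
  linarith

/-- The behaviour at the second pole. -/
theorem TauSol.collapse {s₁ s₂ k a b : ℝ} (C : Consts Λ s₁ s₂ k) (hab : a < b) {x : ℝ → Phase}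
    (hx : TauSol Λ (Ico a b) x) (hN : ∀ t ∈ Ico a b, (x t).2.1 < 0) (hκ : k ≤ (x a).2.2.2.2)
    (hr : (x a).1 ^ 2 ≤ s₁) (hw : (x a).2.2.1 ^ 2 < 1)
    (hmax : ∀ K, IsCompact K → K ⊆ tauDom → ∃ t ∈ Ico a b, x t ∉ K) :
    Tendsto (fun t => (x t).1) (𝓝[<] b) (𝓝 0) ∧
      Tendsto (fun t => (x t).2.1 ^ 2) (𝓝[<] b) atTop ∧
      ∃ w₀, Tendsto (fun t => (x t).2.2.1) (𝓝[<] b) (𝓝 w₀) ∧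
        Tendsto (fun t => (x t).1 ^ 2 * (x t).2.1 ^ 2) (𝓝[<] b) (𝓝 ((1 - w₀ ^ 2) ^ 2)) := by
  obtain ⟨hra, hκt, hwt, hbd⟩ := hx.collapse_bounds C hN hκ hr hw
  have hk := C.k_pos
  have haI : a ∈ Ico a b := ⟨le_rfl, hab⟩
  have hev : ∀ᶠ t in 𝓝[<] b, t ∈ Ico a b := Ico_mem_nhdsLT hab
  have hrp : ∀ t ∈ Ico a b, 0 < (x t).1 := hx.r_pos
  have hMp : ∀ t ∈ Ico a b, 0 < -(x t).2.1 := fun t ht => neg_pos.2 (hN t ht)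
  have hprod : ∀ t ∈ Ico a b, 0 ≤ 2 * (-(x t).2.1 * (x t).1) * ((x t).1 * (x t).2.2.2.2) := fun t ht => by
    have h1 := hrp t ht
    have h2 := hMp t ht
    have h3 : 0 < (x t).2.2.2.2 := hk.trans_le (hκt t ht)
    positivity
  have hX1 : ∀ t ∈ Ico a b, -(x t).2.1 * (x t).1 ≤ 1 := fun t ht => by
    have := hbd t ht
    have h2 := hprod t ht
    have h3 := mul_pos (hMp t ht) (hrp t ht)
    nlinarith [sq_nonneg ((x t).1 * (x t).2.2.2.1)]
  have hv1 : ∀ t ∈ Ico a b, |(x t).1 * (x t).2.2.2.1| ≤ 1 := fun t ht => by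
    have := hbd t ht
    have h2 := hprod t ht
    rw [← sq_le_one_iff_abs_le_one]
    nlinarith [sq_nonneg ((x t).1 * (x t).2.1)]
  have hMmono : MonotoneOn (fun t => -(x t).2.1) (Ico a b) := by
    refine monotoneOn_Ico_of_hasDerivAt (fun t ht => (hx.N_eq t ht).neg) fun t ht => ?_
    have h1 := hMp t ht
    have h2 : 0 < (x t).2.2.2.2 := hk.trans_le (hκt t ht)
    nlinarith [sq_nonneg (x t).2.2.2.1]
  have hXd : ∀ t ∈ Ico a b, HasDerivAt (fun t => -(x t).2.1 * (x t).1)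
      ((x t).2.2.2.2 * (-(x t).2.1 * (x t).1) + 2 * (x t).1 * (x t).2.2.2.1 ^ 2) t := fun t ht =>
    ((hx.N_eq t ht).neg.mul (hx.r_eq t ht)).congr_deriv (by simp only [Pi.neg_apply]; ring)
  -- The product `-N r` is the square root of `r² A`. It increases and is bounded by `1`, so its
  -- limit `X` exists and is positive.
  have hXmono : MonotoneOn (fun t => -(x t).2.1 * (x t).1) (Ico a b) :=
    monotoneOn_Ico_of_hasDerivAt hXd fun t ht => by
      have h1 := hrp t ht
      have h2 := hMp t ht
      have h3 : 0 < (x t).2.2.2.2 := hk.trans_le (hκt t ht)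
      positivity
  have hXa : 0 < -(x a).2.1 * (x a).1 := mul_pos (hMp a haI) (hrp a haI)
  have hXlo : ∀ t ∈ Ico a b, -(x a).2.1 * (x a).1 ≤ -(x t).2.1 * (x t).1 := fun t ht =>
    hXmono haI ht ht.1
  obtain ⟨X, hX, hXle⟩ := exists_tendsto_of_monotoneOn hab hXmono hX1
  have hXpos : 0 < X := hXa.trans_le (hXle a haI)
  have hr0 : Tendsto (fun t => (x t).1) (𝓝[<] b) (𝓝 0) := by
    obtain ⟨l, hl, hle⟩ := exists_tendsto_of_monotoneOn (f := fun t => -(x t).1) hab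
      (monotoneOn_Ico_of_hasDerivAt (fun t ht => (hx.r_eq t ht).neg) fun t ht => by
        have := mul_pos (hrp t ht) (hMp t ht)
        linarith) (M := 0) fun t ht => by linarith [hrp t ht]
    have hl' : Tendsto (fun t => (x t).1) (𝓝[<] b) (𝓝 (-l)) := by simpa using hl.neg
    have hl0 : 0 ≤ -l := ge_of_tendsto hl' (by filter_upwards [hev] with t ht using (hrp t ht).le)
    rcases hl0.eq_or_lt with h0 | h0
    · rw [← h0] at hl'; exact hl'
    -- A positive limit of `r` would bound `N`, `U` and `κ` through the constraint and trap the
    -- orbit in a compact set, contrary to maximality.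
    · exfalso
      obtain ⟨ρ, hρ⟩ : ∃ ρ, ρ = -l := ⟨_, rfl⟩
      rw [← hρ] at h0
      have hrl : ∀ t ∈ Ico a b, ρ ≤ (x t).1 := fun t ht => by linarith [hle t ht]
      have hMa := hMp a haI
      obtain ⟨t, ht, hout⟩ := hmax (Icc ρ (x a).1 ×ˢ Icc (-(1 / ρ)) 0 ×ˢ Icc (-1) 1 ×ˢ
        Icc (-(1 / ρ)) (1 / ρ) ×ˢ Icc 0 (1 / (2 * (-(x a).2.1) * ρ ^ 2)))
        (isCompact_Icc.prod (isCompact_Icc.prod (isCompact_Icc.prod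
          (isCompact_Icc.prod isCompact_Icc)))) fun p hp => (h0.trans_le hp.1.1 : 0 < p.1)
      have h1 := hrl t ht
      have h2 := hMp t ht
      have h3 : 0 < (x t).2.2.2.2 := hk.trans_le (hκt t ht)
      have h4 := hX1 t ht
      have h5 := abs_le.1 (hv1 t ht)
      have h6 := hbd t ht
      have h7 : -(x a).2.1 ≤ -(x t).2.1 := hMmono haI ht ht.1
      have h8 := hwt t ht
      have hrt := hrp t ht
      have e1 : -(x t).2.1 ≤ 1 / ρ := by
        rw [le_div_iff₀ h0]
        exact (mul_le_mul_of_nonneg_left h1 h2.le).trans h4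
      have e2 : (x t).2.2.2.1 ≤ 1 / (x t).1 := by rw [le_div_iff₀ hrt]; linarith
      have e3 : -(1 / (x t).1) ≤ (x t).2.2.2.1 := by
        rw [neg_le, le_div_iff₀ hrt]; linarith
      have e4 : 1 / (x t).1 ≤ 1 / ρ := one_div_le_one_div_of_le h0 h1
      have e5 : (x t).2.2.2.2 ≤ 1 / (2 * (-(x a).2.1) * ρ ^ 2) := by
        rw [le_div_iff₀ (by positivity)]
        have h9 : (x t).2.2.2.2 * (2 * (-(x a).2.1) * ρ ^ 2) ≤
            (x t).2.2.2.2 * (2 * (-(x t).2.1) * (x t).1 ^ 2) := by gcongr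
        nlinarith [sq_nonneg ((x t).1 * (x t).2.1), sq_nonneg ((x t).1 * (x t).2.2.2.1)]
      have e6 := abs_le.1 ((sq_le_one_iff_abs_le_one _).1 h8.le)
      exact hout ⟨⟨h1, hra t ht⟩, ⟨by linarith, by linarith⟩, ⟨e6.1, e6.2⟩,
        ⟨by linarith, e2.trans e4⟩, ⟨h3.le, e5⟩⟩
  have hrgt : Tendsto (fun t => (x t).1) (𝓝[<] b) (𝓝[>] 0) :=
    tendsto_nhdsWithin_iff.2 ⟨hr0, by filter_upwards [hev] with t ht using hrp t ht⟩
  have hMtop : Tendsto (fun t => -(x t).2.1) (𝓝[<] b) atTop := by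
    refine tendsto_atTop_mono' _ ?_ (Tendsto.const_mul_atTop hXa (tendsto_inv_nhdsGT_zero.comp hrgt))
    filter_upwards [hev] with t ht
    simp only [Function.comp_apply]
    rw [← div_eq_mul_inv, div_le_iff₀ (hrp t ht)]
    exact hXlo t ht
  obtain ⟨w₀, hw₀⟩ : ∃ w₀, Tendsto (fun t => (x t).2.2.1) (𝓝[<] b) (𝓝 w₀) := by
    -- Since `w' = r U ≥ -1`, adding `t` makes `w` monotone on a bounded interval, so a limit
    -- exists.
    obtain ⟨l, hl, -⟩ := exists_tendsto_of_monotoneOn (f := fun t => (x t).2.2.1 + t) (M := 1 + b) hab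
      (monotoneOn_Ico_of_hasDerivAt (fun t ht => (hx.w_eq t ht).add (hasDerivAt_id t)) fun t ht => by
        linarith [(abs_le.1 (hv1 t ht)).1]) fun t ht => by
          have := (abs_le.1 ((sq_le_one_iff_abs_le_one _).1 (hwt t ht).le)).2
          linarith [ht.2]
    refine ⟨l - b, (hl.sub (tendsto_id.mono_left nhdsWithin_le_nhds)).congr fun t => ?_⟩
    simp
  have hv0 : Tendsto (fun t => ((x t).1 * (x t).2.2.2.1) ^ 2) (𝓝[<] b) (𝓝 0) := by
    -- The barrier `(r U)² ≤ K r` holds initially by the second entry of the maximum. The first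
    -- entry makes `K (-N r) ≥ 1`, and at contact the damping `4 N (r U)²` then outweighs both the
    -- force on `w` and the shrinking of the barrier.
    set K := max (1 / (-(x a).2.1 * (x a).1)) (((x a).1 * (x a).2.2.2.1) ^ 2 / (x a).1) with hK
    have hK1 : 1 ≤ K * (-(x a).2.1 * (x a).1) := by
      rw [← div_le_iff₀ hXa]; exact le_max_left _ _
    have hK2 : ((x a).1 * (x a).2.2.2.1) ^ 2 ≤ K * (x a).1 := by
      rw [← div_le_iff₀ (hrp a haI)]; exact le_max_right _ _
    have hKpos : 0 < K := lt_of_lt_of_le (by positivity) (le_max_left _ _)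
    have hle : ∀ t ∈ Ico a b, ((x t).1 * (x t).2.2.2.1) ^ 2 ≤ K * (x t).1 := by
      intro t ht
      have hsub : ∀ u ∈ Icc a t, u ∈ Ico a b := fun u hu => ⟨hu.1, hu.2.trans_lt ht.2⟩
      have := le_of_deriv_neg_of_eq (f := fun u => ((x u).1 * (x u).2.2.2.1) ^ 2 - K * (x u).1) (c := 0)
        (f' := fun u => -2 * ((x u).2.2.1 * (1 - (x u).2.2.1 ^ 2)) * ((x u).1 * (x u).2.2.2.1) -
          2 * ((x u).2.2.2.2 - 2 * (x u).2.1) * ((x u).1 * (x u).2.2.2.1) ^ 2 -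
          K * ((x u).1 * (x u).2.1)) (a := a) (b := t) (fun u hu => by
            have hrne := (hrp u (hsub u hu)).ne'
            refine ((((hx.r_eq u (hsub u hu)).mul (hx.U_eq u (hsub u hu))).pow 2).sub
              ((hx.r_eq u (hsub u hu)).const_mul K)).congr_deriv ?_
            simp only [Pi.mul_apply]
            push_cast
            field_simp
            ring) (by linarith) (fun u hu h0 => by
              have huI := hsub u (Ico_subset_Icc_self hu)
              have h0' : ((x u).1 * (x u).2.2.2.1) ^ 2 = K * (x u).1 := by linarith
              rw [h0']
              have h1 := hv1 u huI
              have h2 := hwt u huI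
              have h3 : |(x u).2.2.1 * (1 - (x u).2.2.1 ^ 2)| ≤ 1 := by
                rw [abs_mul]
                have h4 := (sq_le_one_iff_abs_le_one _).1 h2.le
                have h5 : |1 - (x u).2.2.1 ^ 2| ≤ 1 := by
                  rw [abs_le]; constructor <;> linarith [sq_nonneg (x u).2.2.1]
                exact mul_le_one₀ h4 (abs_nonneg _) h5
              have h6 : |(x u).2.2.1 * (1 - (x u).2.2.1 ^ 2) * ((x u).1 * (x u).2.2.2.1)| ≤ 1 := by
                rw [abs_mul]; exact mul_le_one₀ h3 (abs_nonneg _) h1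
              have h7 := (abs_le.1 h6).1
              have h8 : K * (-(x a).2.1 * (x a).1) ≤ K * (-(x u).2.1 * (x u).1) :=
                mul_le_mul_of_nonneg_left (hXlo u huI) hKpos.le
              have h9 : 0 < (x u).2.2.2.2 * (K * (x u).1) :=
                mul_pos (hk.trans_le (hκt u huI)) (mul_pos hKpos (hrp u huI))
              linarith) t ⟨ht.1, le_rfl⟩
      linarith
    refine squeeze_zero' (Eventually.of_forall fun t => sq_nonneg _)
      (by filter_upwards [hev] with t ht using hle t ht) ?_
    simpa using hr0.const_mul K
  -- With the limits of `w`, `N r` and `r U` known, the constraint determines the limit of `r κ`.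
  -- The claim on `r² A` is exactly that this limit is zero.
  have hy : Tendsto (fun t => (x t).1 * (x t).2.2.2.2) (𝓝[<] b)
      (𝓝 (((1 - w₀ ^ 2) ^ 2 - X ^ 2) / (2 * X))) := by
    have h1 := (((((hw₀.pow 2).const_sub 1).pow 2).sub (hr0.pow 2)).add
      ((hr0.pow 4).const_mul Λ)).sub ((hX.pow 2).add (hv0.const_mul 2))
    have h2 := h1.div (hX.const_mul 2) (by positivity)
    rw [show (1 - w₀ ^ 2) ^ 2 - 0 ^ 2 + Λ * 0 ^ 4 - (X ^ 2 + 2 * 0) = (1 - w₀ ^ 2) ^ 2 - X ^ 2 by ring]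
      at h2
    refine h2.congr' ?_
    filter_upwards [hev] with t ht
    have h3 : 2 * (-(x t).2.1 * (x t).1) ≠ 0 := (mul_pos two_pos (mul_pos (hMp t ht) (hrp t ht))).ne'
    simp only [Pi.div_apply]
    rw [div_eq_iff h3, IsTauSolution.f_sq hx ht]
    ring
  have hY0 : 0 ≤ ((1 - w₀ ^ 2) ^ 2 - X ^ 2) / (2 * X) := ge_of_tendsto hy (by
    filter_upwards [hev] with t ht
    exact (mul_pos (hrp t ht) (hk.trans_le (hκt t ht))).le)
  refine ⟨hr0, ((tendsto_pow_atTop two_ne_zero).comp hMtop).congr fun t => by simp, w₀, hw₀, ?_⟩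
  rcases hY0.eq_or_lt with hY | hY
  · have h1 : (1 - w₀ ^ 2) ^ 2 = X ^ 2 := by
      rw [eq_comm, div_eq_zero_iff] at hY
      rcases hY with h | h <;> linarith
    rw [h1]
    exact (hX.pow 2).congr fun t => by ring
  · exfalso
    obtain ⟨c, hc0, hcY⟩ := exists_between hY
    obtain ⟨l, hlb, hl⟩ := (mem_nhdsLT_iff_exists_Ico_subset).1
      ((hy.eventually (lt_mem_nhds hcY)).and hev)
    -- If `r κ > c > 0` near the end, the derivative of `-N r` dominates that of `-c log r`, so `-N
    -- r + c log r` is nondecreasing. But `log r → -∞` while `-N r ≤ 1`.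
    have hmono : MonotoneOn (fun t => -(x t).2.1 * (x t).1 + c * Real.log (x t).1) (Ico l b) := by
      refine monotoneOn_Ico_of_hasDerivAt (fun t ht => (hXd t (hl ht).2).add
        (((hx.r_eq t (hl ht).2).log (hrp t (hl ht).2).ne').const_mul c)) fun t ht => ?_
      obtain ⟨h1, h2⟩ := hl ht
      have h3 := hrp t h2
      have h4 := mul_nonneg (hMp t h2).le (sub_nonneg.2 (show c ≤ (x t).1 * (x t).2.2.2.2 from le_of_lt h1))
      have h5 : 0 ≤ 2 * (x t).1 * (x t).2.2.2.1 ^ 2 := by positivity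
      rw [mul_div_cancel_left₀ _ h3.ne']
      nlinarith
    have hlog : Tendsto (fun t => c * Real.log (x t).1) (𝓝[<] b) atBot :=
      (Real.tendsto_log_nhdsGT_zero.comp hrgt).const_mul_atBot hc0
    obtain ⟨t, h1, h2⟩ := ((hlog.eventually_lt_atBot
      (-(x l).2.1 * (x l).1 + c * Real.log (x l).1 - 1)).and (Ico_mem_nhdsLT hlb)).exists
    have h3 := hmono ⟨le_rfl, hlb⟩ h2 h2.1
    have h4 := hX1 t (hl h2).2
    simp only at h3
    linarith

end EYM

/-! ### From a crash to a generic solution, and conclusion -/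

namespace EYM

variable {Λ : ℝ}

/-- A crashing solution passes through a zero of `N`, after which it collapses in finite time. -/
theorem Crash.exists_collapse {s₁ s₂ k : ℝ} (C : Consts Λ s₁ s₂ k) {p : Phase}
    (h0 : Admissible Λ s₁ p) (hcrash : Crash Λ s₁ p) :
    ∃ (x : ℝ → Phase) (c b : ℝ), 0 < c ∧ c < b ∧ x 0 = p ∧ TauSol Λ (Ico 0 b) x ∧
      (∀ t ∈ Ico 0 c, 0 < (x t).2.1) ∧ (x c).2.1 = 0 ∧ (∀ t ∈ Ioo c b, (x t).2.1 < 0) ∧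
      Tendsto (fun t => (x t).1) (𝓝[<] b) (𝓝 0) ∧
      Tendsto (fun t => (x t).2.1 ^ 2) (𝓝[<] b) atTop ∧
      ∃ w₀, Tendsto (fun t => (x t).2.2.1) (𝓝[<] b) (𝓝 w₀) ∧
        Tendsto (fun t => (x t).1 ^ 2 * (x t).2.1 ^ 2) (𝓝[<] b) (𝓝 ((1 - w₀ ^ 2) ^ 2)) := by
  obtain ⟨T, y, hT, hy0, hy, hreg, hNT⟩ := hcrash
  obtain ⟨x, hx0, hx⟩ := exists_maximal_solution isOpen_tauDom (contDiffOn_tauField Λ) (x₀ := p) h0.r_pos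
  have agree : ∀ b ≤ T, 0 ≤ b → IsSolOn (tauField Λ) tauDom x (Icc 0 b) → x b = y b := fun b h1 h2 h =>
    IsSolOn.eqOn isOpen_tauDom (contDiffOn_tauField Λ) h (hy.mono (Icc_subset_Icc_right h1))
      ⟨le_rfl, h2⟩ (hx0.trans hy0.symm) ⟨h2, le_rfl⟩
  obtain ⟨J, hJ, hTJ, hxJ, hJcases⟩ : ∃ J : Set ℝ, J.OrdConnected ∧ Icc 0 T ⊆ J ∧
      IsSolOn (tauField Λ) tauDom x J ∧ (J = Ici 0 ∨ ∃ b, T < b ∧ J = Ico 0 b ∧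
        ∀ K, IsCompact K → K ⊆ tauDom → ∃ t ∈ Ico T b, x t ∉ K) := by
    rcases hx with hx | ⟨b, hb, hx, hK⟩
    · exact ⟨Ici 0, ordConnected_Ici, Icc_subset_Ici_self, hx, Or.inl rfl⟩
    · have hTb : T < b := by
        by_contra! hle
        obtain ⟨t, ht, -, hout⟩ := hK (y '' Icc 0 T) (isCompact_Icc.image_of_continuousOn hy.continuousOn)
          (by rintro _ ⟨t, ht, rfl⟩; exact (hy t ht).2) 0 hb
        exact hout ⟨t, ⟨ht.1, ht.2.le.trans hle⟩, (agree t (ht.2.le.trans hle) ht.1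
          (hx.mono fun s hs => ⟨hs.1, hs.2.trans_lt ht.2⟩)).symm⟩
      refine ⟨Ico 0 b, ordConnected_Ico, Icc_subset_Ico_right hTb, hx, Or.inr ⟨b, hTb, rfl, ?_⟩⟩
      intro K h1 h2
      obtain ⟨t, ht, hTt, hout⟩ := hK K h1 h2 T hTb
      exact ⟨t, ⟨hTt, ht.2⟩, hout⟩
  subst hx0
  have hxy : ∀ t ∈ Icc 0 T, x t = y t := fun t ht =>
    agree t ht.2 ht.1 (hxJ.mono ((Icc_subset_Icc_right ht.2).trans hTJ))
  have hts : TauSol Λ J x := hxJ.tauSol hJ (hTJ ⟨le_rfl, hT⟩) h0.defect_eq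
  rw [← hxy T ⟨hT, le_rfl⟩] at hNT
  obtain ⟨c, hc, hcz, hlt⟩ := exists_first_zero (f := fun t => -(x t).2.1) hT
    ((IsTauSolution.continuousOn_N hts).mono hTJ).neg (neg_neg_of_pos h0.N_pos) (neg_nonneg.2 hNT.le)
  have hN0 : (x c).2.1 = 0 := neg_eq_zero.1 hcz
  have hcT : c < T := lt_of_le_of_ne hc.2 fun h => by rw [h] at hN0; linarith
  have hcI : c ∈ Icc 0 T := ⟨hc.1.le, hc.2⟩
  have hregx : ∀ t ∈ Icc 0 T, (x t).1 ^ 2 < s₁ ∧ (x t).2.2.1 ^ 2 < 1 := fun t ht => by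
    rw [hxy t ht]; exact hreg t ht
  have hneg : ∀ t ∈ J, c < t → (x t).2.1 < 0 := fun t ht hct =>
    IsTauSolution.N_neg_of_zero (hts.mono (hJ.out (hTJ hcI) ht)) hN0 (by
      by_contra! hcon
      obtain ⟨hU, hwf⟩ := hcon
      have hf := IsTauSolution.f_sq_of_N_zero hts (hTJ hcI) hN0
      have h1 := C.lt_one (hregx c hcI).1
      rw [hU] at hf
      rcases mul_eq_zero.1 hwf with h | h
      · rw [h] at hf; linarith
      · linarith [(hregx c hcI).2]) t ⟨hct, le_rfl⟩
  have hκ : k ≤ (x T).2.2.2.2 := IsTauSolution.κ_ge C (hts.mono hTJ) (by linarith [h0.κ_ge, C.k_le])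
    (fun t ht => (hregx t ht).1.le.trans C.lt.le) T ⟨hT, le_rfl⟩
  have hrT := (hregx T ⟨hT, le_rfl⟩).1.le
  have hwT := (hregx T ⟨hT, le_rfl⟩).2
  rcases hJcases with rfl | ⟨b, hTb, rfl, hK⟩
  · refine (TauSol.not_collapse_forever C.k_pos (hts.mono (Ici_subset_Ici.2 hT))
      (fun t ht => hneg t (hT.trans ht) (hcT.trans_le ht)) fun t ht => ?_).elim
    exact (TauSol.collapse_bounds C (b := t + 1) (hts.mono fun s hs => hT.trans hs.1)
      (fun s hs => hneg s (hT.trans hs.1) (hcT.trans_le hs.1)) hκ hrT hwT).2.1 t ⟨ht, lt_add_one t⟩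
  · exact ⟨x, c, b, hc.1, hcT.trans hTb, rfl, hts, fun t ht => neg_lt_zero.1 (hlt t ht), hN0,
      fun t ht => hneg t ⟨hc.1.le.trans ht.1.le, ht.2⟩ ht.1,
      TauSol.collapse C hTb (hts.mono (Ico_subset_Ico_left hT))
        (fun t ht => hneg t ⟨hT.trans ht.1, ht.2⟩ (hcT.trans_le ht.1)) hκ hrT hwT hK⟩

/-- A solution that crashes is generic. -/
theorem LocalFamily.isGeneric_of_crash {a s₁ s₂ k : ℝ} {A w : ℝ → ℝ → ℝ}
    (F : LocalFamily Λ a A w) (C : Consts Λ s₁ s₂ k) (hΛ : Λ < 1 / 4) {lam : ℝ} (hlam : 0 ≤ lam)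
    (hcrash : Crash Λ s₁ (startData Λ a A w lam)) : IsGeneric Λ lam := by
  obtain ⟨x, c, b, hc, hcb, hx0, hx, hpos, hN0, hneg, hr, hN, w₀, hw, hrN⟩ :=
    hcrash.exists_collapse C (F.admissible C hΛ hlam)
  have hb : 0 < b := hc.trans hcb
  obtain ⟨z, hz, hzx, hNneg, hbot, hmain⟩ := F.exists_extension hlam ordConnected_Ico
    Ico_subset_Ici_self ⟨le_rfl, hb⟩ hc ⟨hc.le, hcb⟩ hx.isSolOn hx0
  have hU : Iic 0 ∪ Ico 0 b = Iio b := Iic_union_Ico_eq_Iio hb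
  rw [hU] at hz hmain
  have hzN : ∀ t < c, 0 < (z t).2.1 := fun t ht => (le_total t 0).elim (hNneg t) fun h => by
    rw [hzx ⟨h, ht.trans hcb⟩]; exact hpos t ⟨h, ht⟩
  have hzc : (z c).2.1 = 0 := by rw [hzx ⟨hc.le, hcb⟩]; exact hN0
  have hzI : TauSol Λ (Iic c) z := hz.mono (Iic_subset_Iio.2 hcb)
  have himg := hzI.image_Iio hzN hbot
  obtain ⟨B, W, hBW, hzBW⟩ := hmain (Iio c) (z c).1 isOpen_Iio ordConnected_Iio
    (Iic_subset_Iio.2 hc) (Iio_subset_Iio hcb.le) (fun t ht _ => hzN t ht) himg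
  have hmono : StrictMonoOn (fun t => (z t).1) (Iic c) := by
    refine strictMonoOn_of_deriv_pos (convex_Iic c) (IsTauSolution.continuousOn_r hzI) fun t ht => ?_
    rw [interior_Iic] at ht
    rw [(hzI.r_eq t (mem_Iic.2 (le_of_lt ht))).deriv]
    exact mul_pos (hzI.r_pos t (mem_Iic.2 (le_of_lt ht))) (hzN t ht)
  -- Because `r` increases strictly up to `c`, left limits at the equator in `τ` become left limits
  -- in `r`; this transfers `N → 0` to `A → 0` and so identifies the crash radius.
  have hmap : 𝓝[<] (z c).1 ≤ map (fun t => (z t).1) (𝓝[<] c) := by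
    intro s hs
    obtain ⟨T, hT, hTs⟩ := (mem_nhdsLT_iff_exists_Ioo_subset' (sub_one_lt c)).1 (mem_map.1 hs)
    have hT' : T ∈ Iic c := mem_Iic.2 (le_of_lt hT)
    filter_upwards [Ioo_mem_nhdsLT (hmono hT' (mem_Iic.2 le_rfl) hT)] with r hrI
    have h1 : r ∈ (fun t => (z t).1) '' Iio c := by
      rw [himg]; exact ⟨(hzI.r_pos T hT').trans hrI.1, hrI.2⟩
    obtain ⟨t, ht, rfl⟩ := h1
    exact hTs ⟨(hmono.lt_iff_lt hT' (mem_Iic.2 (le_of_lt ht))).1 hrI.1, ht⟩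
  have hBlim : Tendsto B (𝓝[<] (z c).1) (𝓝 0) := by
    refine (tendsto_map'_iff.2 ?_).mono_left hmap
    have h1 : Tendsto (fun t => (z t).2.1 ^ 2) (𝓝[<] c) (𝓝 ((z c).2.1 ^ 2)) :=
      ((hzI.N_eq c (mem_Iic.2 le_rfl)).continuousAt.pow 2).tendsto.mono_left nhdsWithin_le_nhds
    rw [hzc, zero_pow two_ne_zero] at h1
    refine h1.congr' ?_
    filter_upwards [self_mem_nhdsWithin] with t ht
    obtain ⟨h2, h3, -⟩ := hzBW t ht
    rw [Function.comp_apply, h3,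
      Real.sq_sqrt (hBW.A_pos _ ⟨(hzI.r_pos t (mem_Iic.2 (le_of_lt ht))).le, h2⟩).le]
  have hev : x =ᶠ[𝓝[<] b] z := by
    filter_upwards [Ico_mem_nhdsLT hb] with t ht using (hzx ht).symm
  have tr : ∀ {f : Phase → ℝ} {l : Filter ℝ}, Tendsto (fun t => f (x t)) (𝓝[<] b) l →
      Tendsto (fun t => f (z t)) (𝓝[<] b) l := fun {f} _ h =>
    h.congr' (by filter_upwards [hev] with t ht; rw [ht])
  refine ⟨c, b, fun t => (z t).1, fun t => (z t).2.1, fun t => (z t).2.2.1, fun t => (z t).2.2.2.1,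
    fun t => (z t).2.2.2.2, hcb, hz, ⟨B, W, hBW, fun t ht => hzBW t ht⟩, hbot,
    hBW.crashRadius_eq hBlim, hzc, fun t ht => ?_, tr (f := fun q => q.1) hr,
    tr (f := fun q => q.2.1 ^ 2) hN, w₀, tr (f := fun q => q.2.2.1) hw,
    tr (f := fun q => q.1 ^ 2 * q.2.1 ^ 2) hrN⟩
  change (z t).2.1 < 0
  rw [hzx ⟨hc.le.trans ht.1.le, ht.2⟩]
  exact hneg t ht

end EYM

theorem mainTheorem3 (Λ : ℝ) (hΛ0 : 0 ≤ Λ) (hΛ : Λ < 1 / 4) :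
    (∃ lam : ℝ, 0 ≤ lam ∧ EYM.IsGeneric Λ lam) ∧
    (∃ lamc : ℝ, 0 ≤ lamc ∧ EYM.IsOscillating Λ lamc ∧
      ¬ ContinuousWithinAt (EYM.crashRadius Λ) (Set.Ici 0) lamc) := by
  obtain ⟨s₁, s₂, k, C⟩ := EYM.exists_consts hΛ0 hΛ
  obtain ⟨a, A, w, F⟩ := EYM.exists_localFamily Λ
  obtain ⟨lam, hlam, hcrash⟩ := F.exists_crash C hΛ
  exact ⟨⟨lam, hlam.le, F.isGeneric_of_crash C hΛ hlam.le hcrash⟩, F.exists_oscillating C hΛ hlam.le hcrash⟩
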